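/- **Setting.** On the open torus orbit of $\mathbb{C}P^2$ use action-angle coordinates $(y^1,y^2,\theta_1,\theta_2)$, with $y^1,y^2>0$ and $y^3:=1-y^1-y^2>0$. Put $c_3=y^1y^2y^3\in(0,\tfrac1{27}]$, with $c_3=\tfrac1{27}$ exactly over the centre of the triangle. The standard complex structure is $$I_-=G_{ij}\,\partial_{\theta_i}\otimes dy^j-G^{ij}\,\partial_{y^i}\otimes d\theta_j,\qquad (G_{ij})=\frac12\begin{pmatrix}\frac{1-y^2}{y^1y^3}&\frac1{y^3}\\ \frac1{y^3}&\frac{1-y^1}{y^2y^3}\end{pmatrix},\quad (G^{ij})=(G_{ij})^{-1},$$ with holomorphic coordinates $z^a=(y^a/y^3)^{1/2}e^{i\theta_a}$. Let $Q=4c_3\,\partial_{y^1}\wedge\partial_{y^2}-\partial_{\theta_1}\wedge\partial_{\theta_2}=4\,\mathrm{Im}(i z^1z^2\partial_{z^1}\wedge\partial_{z^2})$, regarded as the map $\alpha\mapsto Q(\cdot,\alpha)$ from covectors to vectors, let $h=-\tfrac14\log c_3$, let $\phi_t$ be the flow of $V=Q(\cdot,dh)$, and let $I_+=(\phi_{\Delta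 t*})^{-1}I_-\,\phi_{\Delta t*}$. A 2-form $F$ is regarded as the map $v\mapsto F(\cdot,v)$ from vectors to covectors, so that $(QF)^a{}_c=Q^{ab}F_{bc}$; moreover $I^*\alpha=\alpha\circ I$, and $X\wedge Y=X\otimes Y-Y\otimes X$ for vectors and for covectors. **Proposition.** The flow $\phi_t$ exists on the open orbit for all $t\in\mathbb{R}$. Fix a flow time $\Delta t\in\mathbb{R}$. Then $\phi_{\Delta t}$ is differentiable with invertible differential, and on the open orbit the following hold. 1. There is exactly one 2-form $F$ with $I_+-I_-=-QF$, namely $$F=-(I_+^*d\theta_1-I_-^*d\theta_1)\wedge d\theta_2+(I_+^*d\theta_2-I_-^*d\theta_2)\wedge d\theta_1 .$$ 2. The functions $Y^i=\int_0^{\Delta t}\phi_t^*y^i\,dt$ ($i=1,2$) are differentiable, and $$F=-\frac32\sum_{i=1}^2 dY^i\wedge d\theta_i .$$ 3. For every $c\in(0,\tfrac1{27})$ there are half periods $\omega_1\in\mathbb{R}_{>0}$, $\omega_2\in i\mathbb{R}_{>0}$ such that the lattice generated by $2\omega_1,2\omega_2$ has invariants $g_2=\tfrac1{12}-2c$, $g_3=\tfrac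 c6-\tfrac1{216}-c^2$. At every point with $c_3\neq\tfrac1{27}$, take such half periods for $c=c_3$, let $\wp,\zeta,\sigma$ be the Weierstrass functions of the lattice, and put $\mathsf f=\tfrac23\omega_1$. Then there is $s\in\mathbb{R}$ with $y^k=c_3\big/\big(\tfrac1{12}-\wp(\omega_2+\tfrac{\omega_1}{\pi}(s+\tfrac{2\pi k}3))\big)$ for $k=1,2,3$, and for every such $s$, with $u=\omega_2+\tfrac{\omega_1 s}{\pi}$ and with the principal branch of the logarithm, $$Y^1=\log\frac{\sigma(u+\Delta t)\,\sigma(u-\mathsf f)}{\sigma(u+\Delta t-\mathsf f)\,\sigma(u)}+\Delta t\Big(\frac12-\zeta(\mathsf f)\Big),\qquad Y^2=\log\frac{\sigma(u+\Delta t+\mathsf f)\,\sigma(u)}{\sigma(u+\Delta t)\,\sigma(u+\mathsf f)}+\Delta t\Big(\frac12-\zeta(\mathsf f)\Big).$$ -/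

import Mathlib

open Set

/-! ### Elliptic functions: the functions `ζ` and `σ` of a period lattice -/

namespace PeriodPair

/-- The Weierstrass zeta function
`ζ(z) = 1/z + ∑_{l ≠ 0} (1/(z-l) + 1/l + z/l²)` of the period lattice of `L`.
(With `x / 0 = 0` the summand at `l = 0` is `1/z`.) -/
noncomputable def weierstrassZeta (L : PeriodPair) (z : ℂ) : ℂ :=
  ∑' l : L.lattice, (1 / (z - l) + 1 / (l : ℂ) + z / (l : ℂ) ^ 2)

/-- The Weierstrass sigma function
`σ(z) = z ∏_{l ≠ 0} (1 - z/l) exp(z/l + z²/(2l²))` of the period lattice of `L`.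
(With `x / 0 = 0` the factor at `l = 0` is `1`.) -/
noncomputable def weierstrassSigma (L : PeriodPair) (z : ℂ) : ℂ :=
  z * ∏' l : L.lattice,
    ((1 - z / (l : ℂ)) * Complex.exp (z / (l : ℂ) + z ^ 2 / (2 * (l : ℂ) ^ 2)))

end PeriodPair

namespace ToricCP2

/-! ### Action-angle coordinates on the open torus orbit of `ℂP²` -/

/-- Coordinates `p = (y, θ)` with `y = (y¹, y²)` and `θ = (θ₁, θ₂)`; this is also the model of every
tangent space, with basis `∂_{y¹}, ∂_{y²}, ∂_{θ₁}, ∂_{θ₂}`. The index `i : Fin 2` stands for `i+1`. -/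
abbrev Coord : Type := (Fin 2 → ℝ) × (Fin 2 → ℝ)

/-- `y¹, y²` and `y³ = 1 - y¹ - y²`. -/
def bary (p : Coord) : Fin 3 → ℝ := ![p.1 0, p.1 1, 1 - p.1 0 - p.1 1]

/-- The points lying over the interior of the moment triangle. -/
def interiorDomain : Set Coord := {p | ∀ k, 0 < bary p k}

/-- `c₃ = y¹ y² y³`. -/
def cThree (p : Coord) : ℝ := bary p 0 * bary p 1 * bary p 2

/-- The coordinate covectors `dθ₁, dθ₂`. -/
noncomputable def dTheta (i : Fin 2) : Coord →L[ℝ] ℝ :=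
  (ContinuousLinearMap.proj i).comp (ContinuousLinearMap.snd ℝ (Fin 2 → ℝ) (Fin 2 → ℝ))

/-- The tangent vectors `∂_{y¹}, ∂_{y²}`. -/
def partialY (i : Fin 2) : Coord := (Pi.single i 1, 0)

/-- The tangent vectors `∂_{θ₁}, ∂_{θ₂}`. -/
def partialTheta (i : Fin 2) : Coord := (0, Pi.single i 1)

/-- The Hessian `G_{ij}` of the symplectic potential `G = ½ ∑ yᵏ log yᵏ`. -/
noncomputable def hessG (p : Coord) : Matrix (Fin 2) (Fin 2) ℝ :=
  (1 / 2 : ℝ) • !![(1 - bary p 1) / (bary p 0 * bary p 2), 1 / bary p 2;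
                   1 / bary p 2, (1 - bary p 0) / (bary p 1 * bary p 2)]

/-- The inverse matrix `G^{ij}`. -/
noncomputable def hessGInv (p : Coord) : Matrix (Fin 2) (Fin 2) ℝ :=
  (2 : ℝ) • !![bary p 0 * (1 - bary p 0), -(bary p 0 * bary p 1);
               -(bary p 0 * bary p 1), bary p 1 * (1 - bary p 1)]

/-- The standard complex structure `I₋ = G_{ij} ∂_{θ_i} ⊗ dyʲ - G^{ij} ∂_{yⁱ} ⊗ dθ_j`. -/
noncomputable def Iminus (p : Coord) : Coord →L[ℝ] Coord :=
  LinearMap.toContinuousLinearMap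
    ((-((hessGInv p).mulVecLin ∘ₗ LinearMap.snd ℝ (Fin 2 → ℝ) (Fin 2 → ℝ))).prod
      ((hessG p).mulVecLin ∘ₗ LinearMap.fst ℝ (Fin 2 → ℝ) (Fin 2 → ℝ)))

/-- The inhomogeneous holomorphic coordinates `z^a = (y^a / y³)^{1/2} e^{iθ_a}` of `ℂP²`. -/
noncomputable def affineCoord (a : Fin 2) (p : Coord) : ℂ :=
  (Real.sqrt (p.1 a / bary p 2) : ℂ) * Complex.exp (Complex.I * (p.2 a : ℂ))

/-- The Hitchin Poisson tensor `Q = 4 y¹y²y³ ∂_{y¹} ∧ ∂_{y²} - ∂_{θ₁} ∧ ∂_{θ₂}`, as the map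
`α ↦ Q(·, α)` from covectors to vectors, where `X ∧ Y = X ⊗ Y - Y ⊗ X`. -/
noncomputable def hitchinQ (p : Coord) (α : Coord →L[ℝ] ℝ) : Coord :=
  (4 * cThree p) • (α (partialY 1) • partialY 0 - α (partialY 0) • partialY 1)
    - (α (partialTheta 1) • partialTheta 0 - α (partialTheta 0) • partialTheta 1)

/-- The Hamiltonian `h = -¼ log (y¹y²y³)`. -/
noncomputable def hamiltonian (p : Coord) : ℝ := -(1 / 4) * Real.log (cThree p)

/-- The Hamiltonian vector field `V = Q^# dh`. -/
noncomputable def hamiltonianField (p : Coord) : Coord :=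
  hitchinQ p (fderiv ℝ hamiltonian p)

/-- `φ` is the (complete) flow of `V` on the open orbit: `φ 0 = id` and `d/dt φ_t(p) = V(φ_t(p))`.
-/
def IsHamiltonianFlow (φ : ℝ → Coord → Coord) : Prop :=
  ∀ p ∈ interiorDomain, φ 0 p = p ∧
    ∀ t : ℝ, φ t p ∈ interiorDomain ∧
      HasDerivAt (fun τ => φ τ p) (hamiltonianField (φ t p)) t

/-- The deformed complex structure `I₊ = (φ_{t*})⁻¹ I₋ φ_{t*}`. -/
noncomputable def Iplus (φ : ℝ → Coord → Coord) (t : ℝ) (p : Coord) : Coord →L[ℝ] Coord :=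
  (fderiv ℝ (φ t) p).inverse ∘L Iminus (φ t p) ∘L fderiv ℝ (φ t) p

/-- The wedge product `α ∧ β = α ⊗ β - β ⊗ α` of two covectors, as a bilinear form. -/
noncomputable def wedge (α β : Coord →L[ℝ] ℝ) : Coord →L[ℝ] Coord →L[ℝ] ℝ :=
  α.smulRight β - β.smulRight α

/-- `F` is a 2-form: an alternating bilinear form on each tangent space. -/
def IsTwoForm (F : Coord → Coord →L[ℝ] Coord →L[ℝ] ℝ) : Prop :=
  ∀ p ∈ interiorDomain, ∀ v, F p v v = 0

/-- The equation `I₊ - I₋ = -QF` on the open orbit, where the 2-form `F` is regarded as the map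
`v ↦ F(·, v)` from vectors to covectors; in components,
`(I₊ - I₋)^a_c = -∑_b Q^{ab} F_{bc}`. -/
def SolvesGKS (φ : ℝ → Coord → Coord) (t : ℝ) (F : Coord → Coord →L[ℝ] Coord →L[ℝ] ℝ) : Prop :=
  ∀ p ∈ interiorDomain, ∀ v, Iplus φ t p v - Iminus p v = -hitchinQ p ((F p).flip v)

/-- `Yⁱ = ∫₀^t φ_τ^* yⁱ dτ`. -/
noncomputable def integratedY (φ : ℝ → Coord → Coord) (t : ℝ) (i : Fin 2) (p : Coord) : ℝ :=
  ∫ τ in (0 : ℝ)..t, (φ τ p).1 i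

/-! ### The elliptic parametrisation -/

/-- `L` has real period `2ω₁ > 0`, imaginary period `2ω₂ ∈ i ℝ_{>0}`, and invariants
`g₂ = 1/12 - 2c`, `g₃ = c/6 - 1/216 - c²`. The half periods are `L.ω₁ / 2` and `L.ω₂ / 2`. -/
def HasPeriods (L : PeriodPair) (c : ℝ) : Prop :=
  (L.ω₁.im = 0 ∧ 0 < L.ω₁.re) ∧ (L.ω₂.re = 0 ∧ 0 < L.ω₂.im) ∧
    L.g₂ = 1 / 12 - 2 * (c : ℂ) ∧ L.g₃ = (c : ℂ) / 6 - 1 / 216 - (c : ℂ) ^ 2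

/-- The point `ω₂ + ω₁ s / π` for the half periods `ω₁, ω₂`. -/
noncomputable def ellipticTime (L : PeriodPair) (s : ℝ) : ℂ :=
  L.ω₂ / 2 + (L.ω₁ / 2) / (Real.pi : ℂ) * (s : ℂ)

/-- `p` has coordinates `(c₃, s)`, that is,
`yᵏ = c₃ / (1/12 - ℘(ω₂ + ω₁/π (s + 2πk/3)))` for `k = 1, 2, 3`. -/
def HasAngle (L : PeriodPair) (p : Coord) (s : ℝ) : Prop :=
  ∀ k : Fin 3, (bary p k : ℂ) = (cThree p : ℂ) /
    (1 / 12 - L.weierstrassP (ellipticTime L (s + 2 * Real.pi * ((k : ℕ) + 1) / 3)))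

/-- The third of a period `f = (2/3) ω₁`. -/
noncomputable def thirdPeriod (L : PeriodPair) : ℂ := 2 / 3 * (L.ω₁ / 2)

/-! ### The coordinate expressions above are those of the standard structures of `ℂP²` -/

/-- The matrices `G_{ij}` and `G^{ij}` are inverse to each other. -/
theorem hessG_mul_hessGInv {p : Coord} (hp : p ∈ interiorDomain) :
    hessG p * hessGInv p = 1 := by
  have h0 := hp 0
  have h1 := hp 1
  have h2 := hp 2
  simp only [bary, Matrix.cons_val] at h0 h1 h2
  ext i j
  fin_cases i <;> fin_cases j <;>
    simp [hessG, hessGInv, bary, Matrix.mul_apply, Fin.sum_univ_two] <;> field_simp <;> ring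

/-- The logarithmic differential `d log z^a = ½ (dy^a / y^a - dy³ / y³) + i dθ_a`. -/
noncomputable def dLogAffine (a : Fin 2) (p v : Coord) : ℂ :=
  ((1 / 2 * (v.1 a / p.1 a + (v.1 0 + v.1 1) / bary p 2) : ℝ) : ℂ) + Complex.I * (v.2 a : ℂ)

theorem dLogAffine_re (a : Fin 2) (p v : Coord) :
    (dLogAffine a p v).re = 1 / 2 * (v.1 a / p.1 a + (v.1 0 + v.1 1) / bary p 2) := by
  rw [dLogAffine, Complex.add_re, Complex.ofReal_re, Complex.mul_re, Complex.I_re, Complex.I_im,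
    Complex.ofReal_im]
  ring

theorem dLogAffine_im (a : Fin 2) (p v : Coord) : (dLogAffine a p v).im = v.2 a := by
  rw [dLogAffine, Complex.add_im, Complex.ofReal_im, Complex.mul_im, Complex.I_re, Complex.I_im,
    Complex.ofReal_re]
  ring

theorem fderiv_affineCoord (a : Fin 2) {p : Coord} (hp : p ∈ interiorDomain) (v : Coord) :
    fderiv ℝ (affineCoord a) p v = affineCoord a p * dLogAffine a p v := by
  have h2 : 0 < bary p 2 := hp 2
  have ha : 0 < p.1 a := by
    fin_cases a
    · exact hp 0
    · exact hp 1
  let pr : Fin 2 → Coord →L[ℝ] ℝ := fun i =>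
    (ContinuousLinearMap.proj i).comp (ContinuousLinearMap.fst ℝ (Fin 2 → ℝ) (Fin 2 → ℝ))
  have hy : ∀ i, HasFDerivAt (fun q : Coord => q.1 i) (pr i) p := fun i => (pr i).hasFDerivAt
  have hθ : HasFDerivAt (fun q : Coord => q.2 a) (dTheta a) p := (dTheta a).hasFDerivAt
  have h3 : HasFDerivAt (fun q : Coord => bary q 2) (-pr 0 - pr 1) p :=
    ((hy 0).const_sub 1).sub (hy 1)
  have hl := (((hy a).log ha.ne').sub (h3.log h2.ne')).const_mul (1 / 2 : ℝ)
  have hz := ((Complex.ofRealCLM.hasFDerivAt.comp p hl).add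
    ((Complex.ofRealCLM.hasFDerivAt.comp p hθ).const_mul Complex.I)).cexp
  have hval : ∀ q : Coord, 0 < q.1 a → 0 < bary q 2 → affineCoord a q =
      Complex.exp (((1 / 2 * (Real.log (q.1 a) - Real.log (bary q 2)) : ℝ) : ℂ)
        + Complex.I * (q.2 a : ℂ)) := by
    intro q hqa hq2
    rw [affineCoord, Complex.exp_add, ← Complex.ofReal_exp, Real.sqrt_eq_rpow,
      Real.rpow_def_of_pos (div_pos hqa hq2), Real.log_div hqa.ne' hq2.ne', mul_comm (1 / 2 : ℝ)]
  have hev : affineCoord a =ᶠ[nhds p] fun q : Coord =>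
      Complex.exp (((1 / 2 * (Real.log (q.1 a) - Real.log (bary q 2)) : ℝ) : ℂ)
        + Complex.I * (q.2 a : ℂ)) := by
    filter_upwards [(hy a).continuousAt.eventually (lt_mem_nhds ha),
      h3.continuousAt.eventually (lt_mem_nhds h2)] with q hqa hq2
    exact hval q hqa hq2
  have hz' := hz.congr_of_eventuallyEq hev
  rw [hz'.fderiv, hval p ha h2]
  apply congrArg (fun w => Complex.exp (((1 / 2 * (Real.log (p.1 a) - Real.log (bary p 2)) : ℝ) : ℂ)
        + Complex.I * (p.2 a : ℂ)) * w)
  have hreal : (1 / 2 : ℝ) * ((p.1 a)⁻¹ * v.1 a - (bary p 2)⁻¹ * (-v.1 0 - v.1 1)) =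
      1 / 2 * (v.1 a / p.1 a + (v.1 0 + v.1 1) / bary p 2) := by ring
  rw [dLogAffine, ← hreal]
  rfl

theorem Iminus_fst (p v : Coord) (i : Fin 2) :
    (Iminus p v).1 i = -(hessGInv p i 0 * v.2 0 + hessGInv p i 1 * v.2 1) := by
  fin_cases i <;> simp [Iminus, add_comm]

theorem Iminus_snd (p v : Coord) (i : Fin 2) :
    (Iminus p v).2 i = hessG p i 0 * v.1 0 + hessG p i 1 * v.1 1 := by
  fin_cases i <;> simp [Iminus]

/-- The coordinates `z^a` are holomorphic for `I₋`. -/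
theorem fderiv_affineCoord_Iminus (a : Fin 2) {p : Coord} (hp : p ∈ interiorDomain) (v : Coord) :
    fderiv ℝ (affineCoord a) p (Iminus p v) = Complex.I * fderiv ℝ (affineCoord a) p v := by
  have h0 := hp 0
  have h1 := hp 1
  have h2 := hp 2
  simp only [bary, Matrix.cons_val] at h0 h1 h2
  rw [fderiv_affineCoord a hp, fderiv_affineCoord a hp]
  have key : dLogAffine a p (Iminus p v) = Complex.I * dLogAffine a p v := by
    apply Complex.ext
    · rw [dLogAffine_re, Complex.I_mul_re, dLogAffine_im, Iminus_fst, Iminus_fst, Iminus_fst]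
      fin_cases a <;> simp [hessGInv, bary] <;> field_simp <;> ring
    · rw [dLogAffine_im, Complex.I_mul_im, dLogAffine_re, Iminus_snd]
      fin_cases a <;> simp [hessG, bary] <;> field_simp <;> ring
  rw [key]; ring

theorem dLogAffine_partialY (a j : Fin 2) {p : Coord} (hp : p ∈ interiorDomain) :
    dLogAffine a p (partialY j) = (hessG p a j : ℂ) := by
  have h0 := hp 0
  have h1 := hp 1
  have h2 := hp 2
  simp only [bary, Matrix.cons_val] at h0 h1 h2
  apply Complex.ext
  · rw [dLogAffine_re, Complex.ofReal_re]
    fin_cases a <;> fin_cases j <;> simp [partialY, hessG, bary] <;> field_simp <;> ring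
  · rw [dLogAffine_im, Complex.ofReal_im]
    simp [partialY]

theorem dLogAffine_partialTheta (a j : Fin 2) (p : Coord) :
    dLogAffine a p (partialTheta j) = Complex.I * if a = j then 1 else 0 := by
  fin_cases a <;> fin_cases j <;> simp [dLogAffine, partialTheta]

theorem fderiv_affineCoord_hitchinQ (a : Fin 2) {p : Coord} (α : Coord →L[ℝ] ℝ) :
    fderiv ℝ (affineCoord a) p (hitchinQ p α) =
      4 * cThree p * (α (partialY 1) * fderiv ℝ (affineCoord a) p (partialY 0)
          - α (partialY 0) * fderiv ℝ (affineCoord a) p (partialY 1))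
        - (α (partialTheta 1) * fderiv ℝ (affineCoord a) p (partialTheta 0)
          - α (partialTheta 0) * fderiv ℝ (affineCoord a) p (partialTheta 1)) := by
  rw [hitchinQ, map_sub, map_smul, map_sub, map_sub, map_smul, map_smul, map_smul, map_smul]
  simp only [Complex.real_smul]
  push_cast
  ring

theorem cThree_mul_det {p : Coord} (hp : p ∈ interiorDomain) :
    4 * (cThree p : ℂ) * (hessG p 0 0 * hessG p 1 1 - hessG p 0 1 * hessG p 1 0) = 1 := by
  have h0 := hp 0
  have h1 := hp 1
  have h2 := hp 2
  simp only [bary, Matrix.cons_val] at h0 h1 h2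
  have : 4 * cThree p * (hessG p 0 0 * hessG p 1 1 - hessG p 0 1 * hessG p 1 0) = 1 := by
    simp [cThree, hessG, bary]
    field_simp
    ring
  exact_mod_cast this

/-- `Q = 4 Im σ` for the holomorphic Poisson tensor `σ = i z¹z² ∂_{z¹} ∧ ∂_{z²}`, part one:
`Q(dz¹, dz²) = 2 z¹z²`. -/
theorem hitchinQ_affineCoord {p : Coord} (hp : p ∈ interiorDomain) :
    fderiv ℝ (affineCoord 0) p (hitchinQ p (Complex.reCLM ∘L fderiv ℝ (affineCoord 1) p))
      + Complex.I *
        fderiv ℝ (affineCoord 0) p (hitchinQ p (Complex.imCLM ∘L fderiv ℝ (affineCoord 1) p))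
      = 2 * affineCoord 0 p * affineCoord 1 p := by
  have hw : ∀ w : ℂ, (w.re : ℂ) + Complex.I * w.im = w := fun w => by
    rw [mul_comm]; exact Complex.re_add_im w
  rw [fderiv_affineCoord_hitchinQ, fderiv_affineCoord_hitchinQ]
  simp only [ContinuousLinearMap.comp_apply, Complex.reCLM_apply, Complex.imCLM_apply]
  set dz := fderiv ℝ (affineCoord 1) p with hdz
  set dw := fderiv ℝ (affineCoord 0) p with hdw
  have step : (4 * cThree p * (dz (partialY 1) * dw (partialY 0)
        - dz (partialY 0) * dw (partialY 1))
      - (dz (partialTheta 1) * dw (partialTheta 0) - dz (partialTheta 0) * dw (partialTheta 1)) : ℂ)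
      = 2 * affineCoord 0 p * affineCoord 1 p := by
    simp only [hdz, hdw, fderiv_affineCoord _ hp, dLogAffine_partialY _ _ hp,
      dLogAffine_partialTheta]
    simp only [if_true, zero_ne_one, one_ne_zero, if_false]
    linear_combination affineCoord 0 p * affineCoord 1 p * cThree_mul_det hp
      - affineCoord 0 p * affineCoord 1 p * Complex.I_mul_I
  linear_combination step + 4 * cThree p * (dw (partialY 0) * hw (dz (partialY 1))
    - dw (partialY 1) * hw (dz (partialY 0))) - (dw (partialTheta 0) * hw (dz (partialTheta 1))
    - dw (partialTheta 1) * hw (dz (partialTheta 0)))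

/-- `Q = 4 Im σ`, part two: `Q(dz^a, d(conj z^b)) = 0`. -/
theorem hitchinQ_affineCoord_conj {p : Coord} (hp : p ∈ interiorDomain) (a b : Fin 2) :
    fderiv ℝ (affineCoord a) p (hitchinQ p (Complex.reCLM ∘L fderiv ℝ (affineCoord b) p))
      - Complex.I *
        fderiv ℝ (affineCoord a) p (hitchinQ p (Complex.imCLM ∘L fderiv ℝ (affineCoord b) p))
      = 0 := by
  have hw : ∀ w : ℂ, (w.re : ℂ) - Complex.I * w.im = (starRingEnd ℂ) w := fun w => by
    apply Complex.ext <;> simp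
  rw [fderiv_affineCoord_hitchinQ, fderiv_affineCoord_hitchinQ]
  simp only [ContinuousLinearMap.comp_apply, Complex.reCLM_apply, Complex.imCLM_apply]
  set dz := fderiv ℝ (affineCoord b) p with hdz
  set dw := fderiv ℝ (affineCoord a) p with hdw
  have sym : (hessG p 0 1 : ℂ) = hessG p 1 0 := by simp [hessG]
  have step : (4 * cThree p * ((starRingEnd ℂ) (dz (partialY 1)) * dw (partialY 0)
        - (starRingEnd ℂ) (dz (partialY 0)) * dw (partialY 1))
      - ((starRingEnd ℂ) (dz (partialTheta 1)) * dw (partialTheta 0)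
        - (starRingEnd ℂ) (dz (partialTheta 0)) * dw (partialTheta 1)) : ℂ) = 0 := by
    simp only [hdz, hdw, fderiv_affineCoord _ hp, dLogAffine_partialY _ _ hp,
      dLogAffine_partialTheta, map_mul, Complex.conj_ofReal, Complex.conj_I]
    have hdet := cThree_mul_det hp
    have hI := Complex.I_mul_I
    generalize affineCoord a p = za
    generalize (starRingEnd ℂ) (affineCoord b p) = zb
    fin_cases a <;> fin_cases b <;>
      simp only [Fin.zero_eta, Fin.mk_one, if_true, zero_ne_one, one_ne_zero, if_false, map_one,
        map_zero]
    · ring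
    · linear_combination za * zb * hdet + za * zb * hI
    · linear_combination -za * zb * hdet - za * zb * hI
    · ring
  linear_combination step + 4 * cThree p * (dw (partialY 0) * hw (dz (partialY 1))
    - dw (partialY 1) * hw (dz (partialY 0))) - (dw (partialTheta 0) * hw (dz (partialTheta 1))
    - dw (partialTheta 1) * hw (dz (partialTheta 0)))

end ToricCP2

/-! In action-angle coordinates `V` is the Lotka-Volterra field `y¹(y² - y³) ∂_{y¹} + y²(y³ - y¹)
∂_{y²}` (`hamiltonianField_eq`). It fixes the angles, conserves `c₃` and has zero divergence; these
three facts drive parts 1 and 2, and elliptic functions enter to solve the flow.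

Part 1. The differential of the time-`t` map is a matrix `A` of determinant one on the `y`-part and
the identity on the `θ`-part (`exists_fderiv_eq`). Because `G⁻¹ = 4 c₃ adj G` and `c₃` is conserved,
`I₊` and `I₋` have the same shape: a block `M` from `∂_y` to `∂_θ`, and `-4 c₃ adj M` from `∂_θ` to
`∂_y`. Their difference is then linear in the difference of the covectors `I^*dθ_i`, which gives
`Iplus_sub_Iminus`; uniqueness is nondegeneracy of `Q` (`hitchinQ_injective`).

Part 2. The covector `I₋^*dθ_i` is the differential of `½ log(yⁱ/y³)`, and `I₊^*dθ_i` is that of its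
pullback by the flow. The time derivative of this logarithm is affine in a single coordinate, so its
increment along the flow is a multiple of some `Yʲ` plus a constant (`integratedY_one`,
`integratedY_zero`).

Part 3. Write `w = 1/12 - ℘`. The curve of the level `c` is `℘'² = (w - c)² - 4w³`. Its point with
`w = 0`, `℘' = -c` is the third `L.ω₁ / 3` of the real period (`flex_eq_third`). By the addition
theorem the function `c / w` on the line `ω₂/2 + ℝ` and its translates by thirds of the period sum
to one and satisfy the Lotka-Volterra equations (`orbit_sum`, `hasDerivAt_orbit`), and they cover
the level set (`exists_orbit_eq`). This also proves that the flow is complete: off the centre it is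
elliptic, and the centre is an equilibrium. Suitable lattices exist since `g₂³ - 27 g₃² = c³(1 -
27c) > 0`; the shape of the rectangle is found by the intermediate value theorem
(`exists_isRectangular`). Finally `yⁱ` is a difference of two zeta values plus a constant, so the
sigma quotient is the exponential of a real function with derivative `yⁱ - k`, and its principal
logarithm is that function (`integratedY_eq_log`).

All addition formulas come from `weierstrassSigma_add_mul_sub`, proved by Liouville's theorem. -/

namespace PeriodPair

open Filter Topology

variable (L : PeriodPair)

/-! ### The Weierstrass zeta function -/

lemma norm_zeta_summand_le {r : ℝ} (hr : 0 < r) {z : ℂ} (hz : ‖z‖ < r) {l : ℂ}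
    (h : 2 * r ≤ ‖l‖) :
    ‖1 / (z - l) + 1 / l + z / l ^ 2‖ ≤ 2 * r ^ 2 * ‖l‖ ^ (-3 : ℝ) := by
  have hl : 0 < ‖l‖ := by linarith
  have hl0 : l ≠ 0 := norm_pos_iff.mp hl
  have hzl : ‖l‖ / 2 ≤ ‖z - l‖ := by
    have := norm_sub_norm_le l z
    rw [norm_sub_rev] at this
    linarith
  have hzl0 : z - l ≠ 0 := norm_pos_iff.mp (by linarith)
  have key : 1 / (z - l) + 1 / l + z / l ^ 2 = z ^ 2 / (l ^ 2 * (z - l)) := by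
    field_simp
    ring
  rw [key, norm_div, norm_mul, norm_pow, norm_pow]
  calc ‖z‖ ^ 2 / (‖l‖ ^ 2 * ‖z - l‖) ≤ r ^ 2 / (‖l‖ ^ 2 * (‖l‖ / 2)) := by gcongr
    _ = 2 * r ^ 2 / ‖l‖ ^ 3 := by field_simp
    _ = _ := by rw [Real.rpow_neg hl.le, div_eq_mul_inv]; norm_cast

lemma hasSumLocallyUniformly_weierstrassZeta :
    HasSumLocallyUniformly (fun (l : L.lattice) (z : ℂ) ↦
      1 / (z - l) + 1 / (l : ℂ) + z / (l : ℂ) ^ 2) L.weierstrassZeta := by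
  refine L.hasSumLocallyUniformly_aux (u := fun r l ↦ 2 * r ^ 2 * ‖l‖ ^ (-3 : ℝ)) _
    (fun _ _ ↦ (ZLattice.summable_norm_rpow _ _ (by simp; norm_num)).mul_left _) fun r hr ↦
    Filter.eventually_atTop.mpr ⟨2 * r, ?_⟩
  rintro _ h s hs l rfl
  exact norm_zeta_summand_le hr hs h

lemma hasSum_weierstrassZeta (z : ℂ) :
    HasSum (fun l : L.lattice ↦ 1 / (z - l) + 1 / (l : ℂ) + z / (l : ℂ) ^ 2)
      (L.weierstrassZeta z) :=
  L.hasSumLocallyUniformly_weierstrassZeta.hasSum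

lemma sub_coe_ne_zero {z : ℂ} (hz : z ∉ L.lattice) (l : L.lattice) : z - l ≠ 0 := fun e ↦
  hz (sub_eq_zero.mp e ▸ l.2)

lemma hasDerivAt_zeta_summand {z : ℂ} (hz : z ∉ L.lattice) (l : L.lattice) :
    HasDerivAt (fun z : ℂ ↦ 1 / (z - l) + 1 / (l : ℂ) + z / (l : ℂ) ^ 2)
      (-(1 / (z - l) ^ 2 - 1 / (l : ℂ) ^ 2)) z := by
  have h := L.sub_coe_ne_zero hz l
  have h1 := (((hasDerivAt_id z).sub_const (l : ℂ)).inv h).add_const (1 / (l : ℂ))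
  have h2 := h1.add ((hasDerivAt_id z).div_const ((l : ℂ) ^ 2))
  simp only [id, one_div] at h2 ⊢
  convert! h2 using 1
  ring

/-- The series converges locally uniformly off the lattice and its terms are holomorphic there, so
it may be differentiated term by term; the differentiated series is the one for `-℘`. -/
lemma hasDerivAt_weierstrassZeta {z : ℂ} (hz : z ∉ L.lattice) :
    HasDerivAt L.weierstrassZeta (-L.weierstrassP z) z := by
  have hU : IsOpen ((L.lattice : Set ℂ)ᶜ) := L.isClosed_lattice.isOpen_compl
  have hsum := L.hasSumLocallyUniformly_weierstrassZeta.tendstoLocallyUniformlyOn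
    (s := (L.lattice : Set ℂ)ᶜ)
  have hd : ∀ s : Finset L.lattice, ∀ x ∈ (L.lattice : Set ℂ)ᶜ,
      HasDerivAt (fun z : ℂ ↦ ∑ l ∈ s, (1 / (z - l) + 1 / (l : ℂ) + z / (l : ℂ) ^ 2))
      (-∑ l ∈ s, (1 / (x - l) ^ 2 - 1 / (l : ℂ) ^ 2)) x := by
    intro s x hx
    rw [← Finset.sum_neg_distrib]
    exact HasDerivAt.fun_sum fun l _ ↦ L.hasDerivAt_zeta_summand hx l
  have hdiff := hsum.differentiableOn
    (.of_forall fun s x hx ↦ (hd s x hx).differentiableAt.differentiableWithinAt) hU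
  have hder := hsum.deriv
    (.of_forall fun s x hx ↦ (hd s x hx).differentiableAt.differentiableWithinAt) hU
  have h1 := hder.tendsto_at hz
  have h2 := (L.hasSum_weierstrassP z).neg
  have h3 : deriv L.weierstrassZeta z = -L.weierstrassP z := by
    refine tendsto_nhds_unique h1 ?_
    refine Tendsto.congr (fun s ↦ ?_) h2
    rw [Function.comp_apply, (hd s z hz).deriv, Finset.sum_neg_distrib]
  rw [← h3]
  exact (hdiff.differentiableAt (hU.mem_nhds hz)).hasDerivAt

lemma weierstrassZeta_neg (z : ℂ) : L.weierstrassZeta (-z) = -L.weierstrassZeta z := by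
  rw [weierstrassZeta, weierstrassZeta, ← (Equiv.neg L.lattice).tsum_eq, ← tsum_neg]
  congr with l
  simp only [Equiv.neg_apply, NegMemClass.coe_neg]
  rw [show -z - -(l : ℂ) = -(z - l) by ring, div_neg, div_neg]
  ring

/-! ### The Weierstrass sigma function -/

/-- The canonical factor `(1 - z / l) exp (z / l + z² / (2 l²))` of the sigma function. -/
noncomputable def sigmaFactor (l z : ℂ) : ℂ :=
  (1 - z / l) * Complex.exp (z / l + z ^ 2 / (2 * l ^ 2))

/-- The sigma function divided by its argument. -/
noncomputable def sigmaQuot (z : ℂ) : ℂ := ∏' l : L.lattice, sigmaFactor l z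

lemma weierstrassSigma_eq (z : ℂ) : L.weierstrassSigma z = z * L.sigmaQuot z := rfl

/-- The exponent cancels the first two Taylor terms of `log (1 - w)`, so the derivative vanishes to
second order at `0`; this is what makes the sigma product converge. -/
lemma hasDerivAt_primary (w : ℂ) :
    HasDerivAt (fun w : ℂ ↦ (1 - w) * Complex.exp (w + w ^ 2 / 2))
      (-w ^ 2 * Complex.exp (w + w ^ 2 / 2)) w := by
  have h1 : HasDerivAt (fun w : ℂ ↦ 1 - w) (-1) w := by
    simpa using! (hasDerivAt_id w).const_sub 1
  have h2 : HasDerivAt (fun w : ℂ ↦ w + w ^ 2 / 2) (1 + w) w := by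
    have := (hasDerivAt_id w).add (((hasDerivAt_id w).pow 2).div_const 2)
    convert! this using 1
    simp
  convert! h1.mul h2.cexp using 1
  ring

/-- Mean value inequality on the ball of radius `‖w‖`; the constant is a bound for `e`, as the
exponent has norm at most one there. -/
lemma norm_primary_sub_one_le {w : ℂ} (hw : ‖w‖ ≤ 1 / 2) :
    ‖(1 - w) * Complex.exp (w + w ^ 2 / 2) - 1‖ ≤ 3 * ‖w‖ ^ 3 := by
  have hb : ∀ x ∈ Metric.closedBall (0 : ℂ) ‖w‖,
      ‖-x ^ 2 * Complex.exp (x + x ^ 2 / 2)‖ ≤ 3 * ‖w‖ ^ 2 := by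
    intro x hx
    have hx' : ‖x‖ ≤ ‖w‖ := by simpa using hx
    have h1 : ‖x + x ^ 2 / 2‖ ≤ 1 := by
      refine (norm_add_le _ _).trans ?_
      rw [norm_div, norm_pow, RCLike.norm_ofNat]
      nlinarith [norm_nonneg x]
    have h2 : ‖Complex.exp (x + x ^ 2 / 2)‖ ≤ 3 := by
      refine (Complex.norm_exp_le_exp_norm _).trans ?_
      exact (Real.exp_le_exp.mpr h1).trans (by linarith [Real.exp_one_lt_d9])
    rw [norm_mul, norm_neg, norm_pow, mul_comm]
    gcongr
  have := (convex_closedBall (0 : ℂ) ‖w‖).norm_image_sub_le_of_norm_hasDerivWithin_le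
    (f := fun w : ℂ ↦ (1 - w) * Complex.exp (w + w ^ 2 / 2))
    (fun x _ ↦ (hasDerivAt_primary x).hasDerivWithinAt) hb (x := 0) (y := w) (by simp) (by simp)
  simp only [sub_zero, zero_pow two_ne_zero, zero_div, add_zero, Complex.exp_zero, one_mul]
    at this
  calc _ ≤ _ := this
    _ = _ := by ring

lemma sigmaFactor_eq_primary (l z : ℂ) :
    sigmaFactor l z = (1 - z / l) * Complex.exp (z / l + (z / l) ^ 2 / 2) := by
  rw [sigmaFactor, div_pow, div_div, mul_comm 2]

lemma norm_sigmaFactor_sub_one_le {r : ℝ} (hr : 0 < r) {z : ℂ} (hz : ‖z‖ < r) {l : ℂ}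
    (h : 2 * r ≤ ‖l‖) :
    ‖sigmaFactor l z - 1‖ ≤ 3 * r ^ 3 * ‖l‖ ^ (-3 : ℝ) := by
  have hl : 0 < ‖l‖ := by linarith
  rw [sigmaFactor_eq_primary]
  refine (norm_primary_sub_one_le ?_).trans ?_
  · rw [norm_div, div_le_iff₀ hl]; linarith
  · rw [norm_div, Real.rpow_neg hl.le, mul_assoc]
    have : ‖l‖ ^ (3 : ℝ) = ‖l‖ ^ 3 := by norm_cast
    rw [this, ← div_eq_mul_inv, ← div_pow]
    gcongr

lemma eventually_norm_sigmaFactor_sub_one_le {r : ℝ} (hr : 0 < r) :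
    ∀ᶠ l : L.lattice in cofinite, ∀ z ∈ Metric.ball (0 : ℂ) r,
      ‖sigmaFactor l z - 1‖ ≤ 3 * r ^ 3 * ‖l‖ ^ (-3 : ℝ) := by
  -- The lattice is discrete, so a closed ball in it is finite; outside the ball of radius `2r` the
  -- bound holds.
  refine (isCompact_iff_finite.mp (isCompact_closedBall (0 : L.lattice) (2 * r))).subset ?_
  intro l hl
  simp only [mem_compl_iff, mem_ofPred_eq, not_forall] at hl
  obtain ⟨z, hz, hzl⟩ := hl
  by_contra hl'
  refine hzl (norm_sigmaFactor_sub_one_le hr (by simpa using hz) ?_)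
  simp only [Metric.mem_closedBall, dist_zero_right, not_le] at hl'
  exact hl'.le

lemma summable_norm_rpow_neg_three (C : ℝ) :
    Summable fun l : L.lattice ↦ C * ‖l‖ ^ (-3 : ℝ) :=
  (ZLattice.summable_norm_rpow _ _ (by simp; norm_num)).mul_left _

lemma differentiable_sigmaFactor (l : ℂ) : Differentiable ℂ (sigmaFactor l) := by
  unfold sigmaFactor
  fun_prop

lemma hasProdLocallyUniformlyOn_sigmaQuot {r : ℝ} (hr : 0 < r) :
    HasProdLocallyUniformlyOn (fun (l : L.lattice) z ↦ sigmaFactor l z) L.sigmaQuot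
      (Metric.ball 0 r) := by
  have := (L.summable_norm_rpow_neg_three (3 * r ^ 3)).hasProdLocallyUniformlyOn_one_add
    (f := fun (l : L.lattice) z ↦ sigmaFactor l z - 1) (Metric.isOpen_ball (x := (0 : ℂ)) (ε := r))
    (L.eventually_norm_sigmaFactor_sub_one_le hr)
    (fun l ↦ ((differentiable_sigmaFactor l).continuous.sub continuous_const).continuousOn)
  simpa only [add_sub_cancel] using! this

lemma differentiable_sigmaQuot : Differentiable ℂ L.sigmaQuot := by
  intro z
  have hr : 0 < ‖z‖ + 1 := by positivity
  refine ((L.hasProdLocallyUniformlyOn_sigmaQuot hr).differentiableOn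
    (.of_forall fun s ↦ ?_) Metric.isOpen_ball).differentiableAt
    (Metric.isOpen_ball.mem_nhds (by simp))
  exact (Differentiable.fun_finsetProd (u := s) (f := fun (l : L.lattice) z ↦ sigmaFactor l z)
    fun l _ ↦ differentiable_sigmaFactor l).differentiableOn

lemma sigmaFactor_ne_zero {z : ℂ} {l : L.lattice} (h : l ≠ 0 → z ≠ l) :
    sigmaFactor l z ≠ 0 := by
  refine mul_ne_zero ?_ (Complex.exp_ne_zero _)
  by_cases hl : l = 0
  · simp [hl]
  · have hl' : (l : ℂ) ≠ 0 := by simpa using hl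
    rw [sub_ne_zero, ne_eq, eq_div_iff hl', one_mul]
    exact fun e ↦ h hl e.symm

lemma summable_norm_sigmaFactor_sub_one (z : ℂ) :
    Summable fun l : L.lattice ↦ ‖sigmaFactor l z - 1‖ := by
  have hr : 0 < ‖z‖ + 1 := by positivity
  refine (L.summable_norm_rpow_neg_three (3 * (‖z‖ + 1) ^ 3)).of_norm_bounded_eventually ?_
  filter_upwards [L.eventually_norm_sigmaFactor_sub_one_le hr] with l hl
  simpa using hl z (by simp)

lemma sigmaQuot_ne_zero {z : ℂ} (hz : z ∈ L.lattice → z = 0) : L.sigmaQuot z ≠ 0 := by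
  have := tprod_one_add_ne_zero_of_summable (f := fun l : L.lattice ↦ sigmaFactor l z - 1)
    (fun l ↦ by
      rw [add_sub_cancel]
      refine L.sigmaFactor_ne_zero fun hl e ↦ hl ?_
      ext
      rw [← e]
      exact hz (e ▸ l.2)) (L.summable_norm_sigmaFactor_sub_one z)
  simpa only [add_sub_cancel] using! this

lemma sigmaQuot_zero : L.sigmaQuot 0 = 1 := by
  simp [sigmaQuot, sigmaFactor]

lemma differentiable_weierstrassSigma : Differentiable ℂ L.weierstrassSigma :=
  differentiable_id.mul L.differentiable_sigmaQuot

lemma weierstrassSigma_ne_zero {z : ℂ} (hz : z ∉ L.lattice) : L.weierstrassSigma z ≠ 0 :=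
  mul_ne_zero (fun e ↦ hz (e ▸ zero_mem _)) (L.sigmaQuot_ne_zero fun h ↦ (hz h).elim)

lemma weierstrassSigma_zero : L.weierstrassSigma 0 = 0 := by
  rw [weierstrassSigma_eq, zero_mul]

lemma sigmaFactor_neg (l z : ℂ) : sigmaFactor (-l) (-z) = sigmaFactor l z := by
  simp [sigmaFactor]

lemma sigmaQuot_neg (z : ℂ) : L.sigmaQuot (-z) = L.sigmaQuot z := by
  rw [sigmaQuot, sigmaQuot, ← (Equiv.neg L.lattice).tprod_eq]
  congr with l
  simp only [Equiv.neg_apply, NegMemClass.coe_neg, sigmaFactor_neg]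

lemma weierstrassSigma_neg (z : ℂ) : L.weierstrassSigma (-z) = -L.weierstrassSigma z := by
  rw [weierstrassSigma_eq, weierstrassSigma_eq, sigmaQuot_neg, neg_mul]

lemma logDeriv_sigmaFactor {l z : ℂ} (hl : l ≠ 0) (hz : z ≠ l) :
    logDeriv (sigmaFactor l) z = 1 / (z - l) + 1 / l + z / l ^ 2 := by
  have hd : HasDerivAt (sigmaFactor l)
      (-(1 / l) * Complex.exp (z / l + z ^ 2 / (2 * l ^ 2)) + (1 - z / l) *
        (Complex.exp (z / l + z ^ 2 / (2 * l ^ 2)) * (1 / l + z / l ^ 2))) z := by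
    have h1 : HasDerivAt (fun z : ℂ ↦ 1 - z / l) (-(1 / l)) z :=
      ((hasDerivAt_id z).div_const l).const_sub 1
    have h2 : HasDerivAt (fun z : ℂ ↦ z / l + z ^ 2 / (2 * l ^ 2)) (1 / l + z / l ^ 2) z := by
      have := ((hasDerivAt_id z).div_const l).add
        (((hasDerivAt_id z).pow 2).div_const (2 * l ^ 2))
      convert! this using 1
      simp only [id, Nat.cast_ofNat, Nat.add_one_sub_one, pow_one, mul_one]
      field_simp
    exact h1.mul h2.cexp
  rw [logDeriv_apply, hd.deriv, sigmaFactor]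
  have he := Complex.exp_ne_zero (z / l + z ^ 2 / (2 * l ^ 2))
  generalize Complex.exp (z / l + z ^ 2 / (2 * l ^ 2)) = E at *
  have hzl : z - l ≠ 0 := sub_ne_zero.mpr hz
  have hzl' : 1 - z / l ≠ 0 := by
    rw [sub_ne_zero, ne_eq, eq_div_iff hl, one_mul]
    exact fun e ↦ hz e.symm
  have hlz : l - z ≠ 0 := sub_ne_zero.mpr (Ne.symm hz)
  field_simp
  ring

lemma logDeriv_weierstrassSigma {z : ℂ} (hz : z ∉ L.lattice) :
    logDeriv L.weierstrassSigma z = L.weierstrassZeta z := by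
  have hz0 : z ≠ 0 := fun e ↦ hz (e ▸ zero_mem _)
  have hr : 0 < ‖z‖ + 1 := by positivity
  -- The factor at `l = 0` is the constant `1`, whereas the zeta summand there is `1 / z`. The
  -- prefactor `z` of `σ` supplies the missing `1 / z` at the end.
  have hterm : ∀ l : L.lattice, logDeriv (sigmaFactor l) z =
      (1 / (z - l) + 1 / (l : ℂ) + z / (l : ℂ) ^ 2) - if l = 0 then 1 / z else 0 := by
    intro l
    by_cases hl : l = 0
    · subst hl
      have : sigmaFactor ((0 : L.lattice) : ℂ) = fun _ ↦ 1 := by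
        ext z; simp [sigmaFactor]
      rw [this]
      simp
    · have hl' : (l : ℂ) ≠ 0 := by simpa using hl
      have hzl : z ≠ l := fun e ↦ hz (e ▸ l.2)
      rw [logDeriv_sigmaFactor hl' hzl, if_neg hl, sub_zero]
  have hs : HasSum (fun l : L.lattice ↦ logDeriv (sigmaFactor l) z)
      (L.weierstrassZeta z - 1 / z) := by
    simp_rw [hterm]
    exact (L.hasSum_weierstrassZeta z).sub (hasSum_ite_eq 0 _)
  have hq : logDeriv L.sigmaQuot z = L.weierstrassZeta z - 1 / z := by
    have hne := L.sigmaQuot_ne_zero (z := z) fun h ↦ (hz h).elim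
    have := logDeriv_tprod_eq_tsum (f := fun (l : L.lattice) z ↦ sigmaFactor l z)
      (Metric.isOpen_ball (x := (0 : ℂ)) (ε := ‖z‖ + 1)) (x := z) (by simp)
      (fun l ↦ L.sigmaFactor_ne_zero fun _ e ↦ hz (e ▸ l.2))
      (fun l ↦ (differentiable_sigmaFactor l).differentiableOn) hs.summable
      ⟨_, L.hasProdLocallyUniformlyOn_sigmaQuot hr⟩ hne
    exact this.trans hs.tsum_eq
  have hmul : logDeriv L.weierstrassSigma z = logDeriv (fun z : ℂ ↦ z) z + logDeriv L.sigmaQuot z :=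
    logDeriv_mul z hz0 (L.sigmaQuot_ne_zero fun h ↦ (hz h).elim) differentiableAt_fun_id
      L.differentiable_sigmaQuot.differentiableAt
  rw [hmul, hq, logDeriv_apply]
  simp

lemma hasDerivAt_weierstrassSigma {z : ℂ} (hz : z ∉ L.lattice) :
    HasDerivAt L.weierstrassSigma (L.weierstrassZeta z * L.weierstrassSigma z) z := by
  rw [← L.logDeriv_weierstrassSigma hz, logDeriv_apply,
    div_mul_cancel₀ _ (L.weierstrassSigma_ne_zero hz)]
  exact (L.differentiable_weierstrassSigma z).hasDerivAt

end PeriodPair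

namespace PeriodPair

open Filter Topology

variable (L : PeriodPair)

/-! ### Quasi-periodicity and the addition theorem -/

lemma isOpen_compl_lattice : IsOpen ((L.lattice : Set ℂ)ᶜ) := L.isClosed_lattice.isOpen_compl

lemma isPreconnected_compl_lattice : IsPreconnected ((L.lattice : Set ℂ)ᶜ) :=
  (Set.Countable.isConnected_compl_of_one_lt_rank (by simp)
    (countable_of_Lindelof_of_discrete (X := L.lattice))).2

variable {L} in
lemma add_mem_lattice_iff {z l : ℂ} (hl : l ∈ L.lattice) : z + l ∈ L.lattice ↔ z ∈ L.lattice :=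
  ⟨fun h ↦ by simpa using sub_mem h hl, fun h ↦ add_mem h hl⟩

/-- The difference has derivative zero by periodicity of `℘`, and the complement of the lattice is
connected. -/
lemma exists_weierstrassZeta_add {l : ℂ} (hl : l ∈ L.lattice) :
    ∃ η : ℂ, ∀ z ∉ L.lattice, L.weierstrassZeta (z + l) = L.weierstrassZeta z + η := by
  have hd : ∀ z ∈ (L.lattice : Set ℂ)ᶜ,
      HasDerivAt (fun z ↦ L.weierstrassZeta (z + l) - L.weierstrassZeta z) 0 z := by
    intro z hz
    have h1 := (L.hasDerivAt_weierstrassZeta ((add_mem_lattice_iff hl).not.mpr hz)).comp_add_const z l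
    have h2 := h1.sub (L.hasDerivAt_weierstrassZeta hz)
    rw [L.weierstrassP_add_coe z ⟨l, hl⟩, sub_self] at h2
    exact h2
  obtain ⟨η, h⟩ := L.isOpen_compl_lattice.exists_is_const_of_deriv_eq_zero
    L.isPreconnected_compl_lattice
    (fun z hz ↦ (hd z hz).differentiableAt.differentiableWithinAt) (fun z hz ↦ (hd z hz).deriv)
  exact ⟨η, fun z hz ↦ by rw [← h z hz]; ring⟩

lemma exists_weierstrassSigma_add {l : ℂ} (hl : l ∈ L.lattice) :
    ∃ C η : ℂ, C ≠ 0 ∧ ∀ z ∉ L.lattice,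
      L.weierstrassSigma (z + l) = C * Complex.exp (η * z) * L.weierstrassSigma z := by
  obtain ⟨η, hη⟩ := L.exists_weierstrassZeta_add hl
  have hd : ∀ z ∈ (L.lattice : Set ℂ)ᶜ, HasDerivAt (fun z ↦ L.weierstrassSigma (z + l) *
      Complex.exp (-(η * z)) / L.weierstrassSigma z) 0 z := by
    intro z hz
    have hne := L.weierstrassSigma_ne_zero hz
    have h1 := (L.hasDerivAt_weierstrassSigma
      ((add_mem_lattice_iff hl).not.mpr hz)).comp_add_const z l
    have h2 : HasDerivAt (fun z : ℂ ↦ Complex.exp (-(η * z)))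
        (Complex.exp (-(η * z)) * -(η * 1)) z := ((hasDerivAt_id z).const_mul η).neg.cexp
    have h3 := (h1.mul h2).div (L.hasDerivAt_weierstrassSigma hz) hne
    rw [hη z hz] at h3
    convert! h3 using 1
    field_simp
    simp only [Pi.mul_apply]
    ring
  obtain ⟨C, h⟩ := L.isOpen_compl_lattice.exists_is_const_of_deriv_eq_zero
    L.isPreconnected_compl_lattice
    (fun z hz ↦ (hd z hz).differentiableAt.differentiableWithinAt) (fun z hz ↦ (hd z hz).deriv)
  have key : ∀ z ∉ L.lattice,
      L.weierstrassSigma (z + l) = C * Complex.exp (η * z) * L.weierstrassSigma z := by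
    intro z hz
    have h1 := h z hz
    rw [div_eq_iff (L.weierstrassSigma_ne_zero hz), Complex.exp_neg,
      ← div_eq_mul_inv, div_eq_iff (Complex.exp_ne_zero _)] at h1
    rw [h1]; ring
  refine ⟨C, η, ?_, key⟩
  -- If `C` were zero, `σ` would vanish at `ω₁/2 + l`, which is not a lattice point.
  rintro rfl
  have := key _ L.ω₁_div_two_notMem_lattice
  rw [zero_mul, zero_mul] at this
  exact L.weierstrassSigma_ne_zero
    ((add_mem_lattice_iff hl).not.mpr L.ω₁_div_two_notMem_lattice) this

/-- The elliptic function `σ(z+a) σ(z-a) / (σ(z) σ(a))² + ℘(z) - ℘(a)`, which vanishes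
identically. -/
noncomputable def sigmaDefect (a z : ℂ) : ℂ :=
  L.weierstrassSigma (z + a) * L.weierstrassSigma (z - a) /
    (L.weierstrassSigma z ^ 2 * L.weierstrassSigma a ^ 2) + L.weierstrassP z - L.weierstrassP a

/-- The multipliers of `σ(z + a)` and `σ(z - a)` have product `C² exp(2ηz)`, which is the multiplier
of `σ(z)²`. The multiplier law is only known off the lattice, so `z ± a` in the lattice is treated
apart: both numerators are then zero. -/
lemma sigmaDefect_add {a z l : ℂ} (ha : a ∉ L.lattice) (hz : z ∉ L.lattice) (hl : l ∈ L.lattice) :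
    L.sigmaDefect a (z + l) = L.sigmaDefect a z := by
  obtain ⟨C, η, hC, h⟩ := L.exists_weierstrassSigma_add hl
  have hP : L.weierstrassP (z + l) = L.weierstrassP z := L.weierstrassP_add_coe z ⟨l, hl⟩
  have hσ := L.weierstrassSigma_ne_zero hz
  have hσa := L.weierstrassSigma_ne_zero ha
  have hσl := L.weierstrassSigma_ne_zero ((add_mem_lattice_iff hl).not.mpr hz)
  rw [sigmaDefect, sigmaDefect, hP]
  congr 2
  by_cases h0 : z + a ∈ L.lattice ∨ z - a ∈ L.lattice
  · have hzero : ∀ w ∈ L.lattice, L.weierstrassSigma w = 0 := by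
      intro w hw
      by_cases hw0 : w = 0
      · rw [hw0, weierstrassSigma_zero]
      · rw [weierstrassSigma_eq, sigmaQuot]
        refine mul_eq_zero_of_right _ (tprod_of_exists_eq_zero ⟨⟨w, hw⟩, ?_⟩)
        simp [sigmaFactor, div_self hw0]
    rcases h0 with h0 | h0
    · rw [hzero _ h0, hzero (z + l + a)
        (by simpa [add_right_comm] using add_mem h0 hl)]
      simp
    · rw [hzero _ h0, hzero (z + l - a)
        (by simpa [sub_add_eq_add_sub] using add_mem h0 hl)]
      simp
  · rw [not_or] at h0
    have e1 := h (z + a) h0.1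
    have e2 := h (z - a) h0.2
    rw [show z + a + l = z + l + a by ring] at e1
    rw [show z - a + l = z + l - a by ring] at e2
    rw [e1, e2, h z hz]
    have hexp : Complex.exp (η * (z + a)) * Complex.exp (η * (z - a)) =
        Complex.exp (η * z) ^ 2 := by
      rw [← Complex.exp_add, ← Complex.exp_nat_mul]
      congr 1
      push_cast
      ring
    have hE := Complex.exp_ne_zero (η * z)
    rw [div_eq_div_iff (by positivity) (by positivity)]
    linear_combination C ^ 2 * L.weierstrassSigma (z + a) * L.weierstrassSigma (z - a) *
      L.weierstrassSigma z ^ 2 * L.weierstrassSigma a ^ 2 * hexp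

/-- The double pole of `℘` at `0` cancels that of the sigma quotient. After multiplication by `z²`
the quotient plus `1` is `g`, which is even and vanishes at `0`, hence is divisible by `z²`; two
applications of `dslope` carry out the division. -/
lemma exists_sigmaDefect_eventuallyEq {a : ℂ} (ha : a ∉ L.lattice) :
    ∃ f : ℂ → ℂ, AnalyticAt ℂ f 0 ∧ ∀ᶠ z in 𝓝[≠] 0, f z = L.sigmaDefect a z := by
  have hσa := L.weierstrassSigma_ne_zero ha
  set g : ℂ → ℂ := fun z ↦ L.weierstrassSigma (z + a) * L.weierstrassSigma (z - a) /
    (L.sigmaQuot z ^ 2 * L.weierstrassSigma a ^ 2) + 1 with hg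
  have hσ := L.differentiable_weierstrassSigma
  have hQ := L.differentiable_sigmaQuot
  have hQ0 : ∀ᶠ z in 𝓝 (0 : ℂ), L.sigmaQuot z ≠ 0 :=
    hQ.continuous.continuousAt.eventually_ne (by rw [sigmaQuot_zero]; exact one_ne_zero)
  obtain ⟨U, hU, hUo, h0U⟩ := mem_nhds_iff.mp hQ0
  have hgd : DifferentiableOn ℂ g U := by
    intro z hz
    refine DifferentiableAt.differentiableWithinAt ?_
    refine DifferentiableAt.add (DifferentiableAt.div ?_ ?_ ?_) (by fun_prop)
    · exact ((hσ.comp (differentiable_id.add_const a)).mul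
        (hσ.comp (differentiable_id.sub_const a))) z
    · exact (hQ z).pow 2 |>.mul_const _
    · exact mul_ne_zero (pow_ne_zero 2 (hU hz)) (pow_ne_zero 2 hσa)
  have hUn : U ∈ 𝓝 (0 : ℂ) := hUo.mem_nhds h0U
  have hg0 : g 0 = 0 := by
    simp only [hg, zero_add, zero_sub, sigmaQuot_zero, weierstrassSigma_neg]
    field_simp
    ring
  have hgeven : ∀ z, g (-z) = g z := by
    intro z
    simp only [hg, sigmaQuot_neg]
    rw [show -z + a = -(z - a) by ring, show -z - a = -(z + a) by ring, weierstrassSigma_neg,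
      weierstrassSigma_neg]
    ring
  have hg' : deriv g 0 = 0 := by
    have h1 : HasDerivAt g (deriv g 0) 0 := (hgd.differentiableAt hUn).hasDerivAt
    have h2 : HasDerivAt (fun z ↦ g (-z)) (deriv g 0 * -1) 0 :=
      HasDerivAt.comp (h₂ := g) 0 (by simpa using h1) (hasDerivAt_neg 0)
    rw [funext hgeven] at h2
    have := h1.unique h2
    linear_combination this / 2
  have hd1 := (Complex.differentiableOn_dslope hUn).mpr hgd
  have hd2 := (Complex.differentiableOn_dslope hUn).mpr hd1
  refine ⟨fun z ↦ dslope (dslope g 0) 0 z + L.weierstrassPExcept 0 z - L.weierstrassP a,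
    ((hd2.analyticAt hUn).add (L.analyticAt_weierstrassPExcept 0)).sub analyticAt_const, ?_⟩
  filter_upwards [self_mem_nhdsWithin, mem_nhdsWithin_of_mem_nhds hUn] with z hz hzU
  have hz' : z ≠ 0 := hz
  have hQz : L.sigmaQuot z ≠ 0 := hU hzU
  have hP := L.weierstrassPExcept_add 0 z
  simp only [ZeroMemClass.coe_zero, sub_zero] at hP
  rw [sigmaDefect, ← hP, dslope_of_ne _ hz', slope_def_field, dslope_of_ne _ hz', slope_def_field,
    dslope_same, hg', hg0, L.weierstrassSigma_eq z]
  simp only [hg]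
  field_simp
  ring

/-- Filling in the lattice points gives an entire doubly periodic function, constant by Liouville.
Its value at `z = a` is zero since `σ(0) = 0`. -/
lemma sigmaDefect_eq_zero {a z : ℂ} (ha : a ∉ L.lattice) (hz : z ∉ L.lattice) :
    L.sigmaDefect a z = 0 := by
  classical
  obtain ⟨f, hf, hfe⟩ := L.exists_sigmaDefect_eventuallyEq ha
  set F : ℂ → ℂ := fun z ↦ if z ∈ L.lattice then f 0 else L.sigmaDefect a z with hF
  have hper : ∀ z w, w ∈ L.lattice → F (z + w) = F z := by
    intro z w hw
    simp only [hF, add_mem_lattice_iff hw]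
    split_ifs with h
    · rfl
    · exact L.sigmaDefect_add ha h hw
  have hF0 : DifferentiableAt ℂ F 0 := by
    refine hf.differentiableAt.congr_of_eventuallyEq ?_
    have h1 : ∀ᶠ z in 𝓝[≠] (0 : ℂ), F z = f z := by
      filter_upwards [hfe, mem_nhdsWithin_of_mem_nhds
        (L.compl_lattice_sdiff_singleton_mem_nhds 0), self_mem_nhdsWithin] with z h1 h2 h3
      have hz : z ∉ L.lattice := fun h ↦ h2 ⟨h, h3⟩
      simp only [hF, if_neg hz, h1]
    have h2 : F 0 = f 0 := by simp [hF]
    rw [eventually_nhdsWithin_iff] at h1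
    filter_upwards [h1] with z h
    by_cases h0 : z = 0
    · rw [h0, h2]
    · exact h h0
  have hσ := L.differentiable_weierstrassSigma
  have hdiff : Differentiable ℂ F := by
    intro z
    by_cases hz : z ∈ L.lattice
    · have h1 : F = fun w ↦ F (w - z) := by
        ext w
        rw [← hper (w - z) z hz, sub_add_cancel]
      rw [h1]
      refine DifferentiableAt.comp (g := F) z ?_ (by fun_prop)
      rwa [sub_self]
    · have h1 : F =ᶠ[𝓝 z] L.sigmaDefect a := by
        filter_upwards [L.isOpen_compl_lattice.mem_nhds hz] with w hw
        exact if_neg hw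
      refine DifferentiableAt.congr_of_eventuallyEq ?_ h1
      have hP := L.differentiableOn_weierstrassP.differentiableAt
        (L.isOpen_compl_lattice.mem_nhds hz)
      refine DifferentiableAt.sub_const (DifferentiableAt.add (DifferentiableAt.div ?_ ?_ ?_) hP) _
      · exact ((hσ.comp (differentiable_id.add_const a)).mul
          (hσ.comp (differentiable_id.sub_const a))) z
      · exact ((hσ z).pow 2).mul_const _
      · exact mul_ne_zero (pow_ne_zero 2 (L.weierstrassSigma_ne_zero hz))
          (pow_ne_zero 2 (L.weierstrassSigma_ne_zero ha))
  have hconst := hdiff.apply_eq_apply_of_bounded (IsZLattice.isCompact_range_of_periodic L.lattice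
    F hdiff.continuous hper).isBounded z a
  simp only [hF, if_neg hz, if_neg ha] at hconst
  rw [hconst]
  simp [sigmaDefect, weierstrassSigma_zero]

/-- `σ(z+a) σ(z-a) = (℘(a) - ℘(z)) σ(z)² σ(a)²`. -/
theorem weierstrassSigma_add_mul_sub {a z : ℂ} (ha : a ∉ L.lattice) (hz : z ∉ L.lattice) :
    L.weierstrassSigma (z + a) * L.weierstrassSigma (z - a) =
      (L.weierstrassP a - L.weierstrassP z) *
        (L.weierstrassSigma z ^ 2 * L.weierstrassSigma a ^ 2) := by
  have h := L.sigmaDefect_eq_zero ha hz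
  have hne : L.weierstrassSigma z ^ 2 * L.weierstrassSigma a ^ 2 ≠ 0 :=
    mul_ne_zero (pow_ne_zero 2 (L.weierstrassSigma_ne_zero hz))
      (pow_ne_zero 2 (L.weierstrassSigma_ne_zero ha))
  rw [← div_eq_iff hne]
  rw [sigmaDefect] at h
  linear_combination h

/-- `℘` takes each value at a single pair of opposite points modulo the lattice. -/
theorem weierstrassP_eq_iff {a z : ℂ} (ha : a ∉ L.lattice) (hz : z ∉ L.lattice) :
    L.weierstrassP z = L.weierstrassP a ↔ z + a ∈ L.lattice ∨ z - a ∈ L.lattice := by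
  constructor
  · intro h
    have := L.weierstrassSigma_add_mul_sub ha hz
    rw [h, sub_self, zero_mul, mul_eq_zero] at this
    by_contra! hcon
    exact this.elim (L.weierstrassSigma_ne_zero hcon.1) (L.weierstrassSigma_ne_zero hcon.2)
  · rintro (h | h)
    · have := L.weierstrassP_add_coe (-a) ⟨_, h⟩
      simpa using this
    · have := L.weierstrassP_add_coe a ⟨_, h⟩
      simpa using this

lemma hasDerivAt_weierstrassP {z : ℂ} (hz : z ∉ L.lattice) :
    HasDerivAt L.weierstrassP (L.derivWeierstrassP z) z := by
  rw [← L.deriv_weierstrassP]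
  exact (L.differentiableOn_weierstrassP.differentiableAt
    (L.isOpen_compl_lattice.mem_nhds hz)).hasDerivAt

/-- This is the logarithmic derivative in `z` of the product formula for `σ(z + a) σ(z - a)`. -/
lemma weierstrassZeta_add_add_sub {a z : ℂ} (ha : a ∉ L.lattice) (hz : z ∉ L.lattice)
    (hp : z + a ∉ L.lattice) (hm : z - a ∉ L.lattice) :
    L.weierstrassZeta (z + a) + L.weierstrassZeta (z - a) - 2 * L.weierstrassZeta z =
      L.derivWeierstrassP z / (L.weierstrassP z - L.weierstrassP a) := by
  have h1 := ((L.hasDerivAt_weierstrassSigma hp).comp_add_const z a).mul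
    ((L.hasDerivAt_weierstrassSigma hm).comp_sub_const z a)
  have h2 := ((L.hasDerivAt_weierstrassP hz).const_sub (L.weierstrassP a)).mul
    (((L.hasDerivAt_weierstrassSigma hz).pow 2).mul_const (L.weierstrassSigma a ^ 2))
  have h3 := h1.congr_of_eventuallyEq (f₁ := (fun z ↦ L.weierstrassP a - L.weierstrassP z) *
    fun z ↦ (L.weierstrassSigma ^ 2) z * L.weierstrassSigma a ^ 2) (by
    filter_upwards [L.isOpen_compl_lattice.mem_nhds hz] with w hw
    exact (L.weierstrassSigma_add_mul_sub ha hw).symm)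
  have h4 := h3.unique h2
  have h5 := L.weierstrassSigma_add_mul_sub ha hz
  have hne : L.weierstrassP z - L.weierstrassP a ≠ 0 := by
    rw [sub_ne_zero, ne_eq, L.weierstrassP_eq_iff ha hz, not_or]
    exact ⟨hp, hm⟩
  have hσ := L.weierstrassSigma_ne_zero hz
  have hσa := L.weierstrassSigma_ne_zero ha
  simp only [Pi.pow_apply, Nat.cast_ofNat, Nat.add_one_sub_one, pow_one] at h4
  rw [eq_div_iff hne]
  apply mul_left_cancel₀ (mul_ne_zero (pow_ne_zero 2 hσ) (pow_ne_zero 2 hσa))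
  linear_combination (L.weierstrassZeta (z + a) + L.weierstrassZeta (z - a)) * h5 - h4

/-- The addition theorem of the zeta function. -/
theorem weierstrassZeta_add {a z : ℂ} (ha : a ∉ L.lattice) (hz : z ∉ L.lattice)
    (hp : z + a ∉ L.lattice) (hm : z - a ∉ L.lattice) :
    L.weierstrassZeta (z + a) = L.weierstrassZeta z + L.weierstrassZeta a +
      (L.derivWeierstrassP z - L.derivWeierstrassP a) /
        (2 * (L.weierstrassP z - L.weierstrassP a)) := by
  have h1 := L.weierstrassZeta_add_add_sub ha hz hp hm
  -- With `a` and `z` exchanged, `ζ(z - a)` changes sign; half the sum of the two identities is the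
  -- claim.
  have h2 := L.weierstrassZeta_add_add_sub hz ha (by rwa [add_comm])
    (fun h ↦ hm (by simpa using neg_mem h))
  have hne : L.weierstrassP z - L.weierstrassP a ≠ 0 := by
    rw [sub_ne_zero, ne_eq, L.weierstrassP_eq_iff ha hz, not_or]
    exact ⟨hp, hm⟩
  rw [← neg_sub z a, weierstrassZeta_neg, add_comm a z, ← neg_sub (L.weierstrassP z), div_neg] at h2
  rw [mul_comm 2, ← div_div, sub_div]
  linear_combination h1 / 2 + h2 / 2

/-- `℘'(a) = -σ(2a) / σ(a)⁴`. -/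
theorem derivWeierstrassP_eq {a : ℂ} (ha : a ∉ L.lattice) :
    L.derivWeierstrassP a * L.weierstrassSigma a ^ 4 = -L.weierstrassSigma (2 * a) := by
  -- The product formula is differentiated at `z = a`, where only the term with `σ'(0) = 1` survives
  -- on the left.
  have hσ0 : HasDerivAt L.weierstrassSigma 1 (a - a) := by
    rw [sub_self]
    have := (hasDerivAt_id (0 : ℂ)).mul (L.differentiable_sigmaQuot 0).hasDerivAt
    convert! this using 1
    simp [sigmaQuot_zero]
  have h1 := (((L.differentiable_weierstrassSigma (a + a)).hasDerivAt).comp_add_const a a).mul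
    (hσ0.comp_sub_const a a)
  have h2 := ((L.hasDerivAt_weierstrassP ha).const_sub (L.weierstrassP a)).mul
    (((L.hasDerivAt_weierstrassSigma ha).pow 2).mul_const (L.weierstrassSigma a ^ 2))
  have h3 := h1.congr_of_eventuallyEq (f₁ := (fun z ↦ L.weierstrassP a - L.weierstrassP z) *
    fun z ↦ (L.weierstrassSigma ^ 2) z * L.weierstrassSigma a ^ 2) (by
    filter_upwards [L.isOpen_compl_lattice.mem_nhds ha] with w hw
    exact (L.weierstrassSigma_add_mul_sub ha hw).symm)
  have h4 := h3.unique h2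
  simp only [Pi.pow_apply, sub_self, weierstrassSigma_zero, zero_mul, mul_zero, mul_one, zero_add,
    add_zero] at h4
  rw [two_mul]
  linear_combination h4

lemma derivWeierstrassP_ne_zero {a : ℂ} (ha : 2 * a ∉ L.lattice) :
    L.derivWeierstrassP a ≠ 0 := by
  intro h
  have ha' : a ∉ L.lattice := fun h ↦ ha (by rw [two_mul]; exact add_mem h h)
  have := L.derivWeierstrassP_eq ha'
  rw [h, zero_mul, eq_comm, neg_eq_zero] at this
  exact L.weierstrassSigma_ne_zero ha this

lemma derivWeierstrassP_eq_zero {a : ℂ} (ha : 2 * a ∈ L.lattice) : L.derivWeierstrassP a = 0 := by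
  have h := L.derivWeierstrassP_add_coe (-a) ⟨_, ha⟩
  rw [show -a + 2 * a = a by ring, derivWeierstrassP_neg] at h
  linear_combination h / 2

/-- `℘'' = 6 ℘² - g₂ / 2`. -/
theorem hasDerivAt_derivWeierstrassP {z : ℂ} (hz : z ∉ L.lattice) :
    HasDerivAt L.derivWeierstrassP (6 * L.weierstrassP z ^ 2 - L.g₂ / 2) z := by
  have hd : ∀ z ∈ (L.lattice : Set ℂ)ᶜ,
      HasDerivAt L.derivWeierstrassP (deriv L.derivWeierstrassP z) z := fun z hz ↦
    (L.analyticOnNhd_derivWeierstrassP z hz).differentiableAt.hasDerivAt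
  have hprod : ∀ z ∈ (L.lattice : Set ℂ)ᶜ,
      (deriv L.derivWeierstrassP z - (6 * L.weierstrassP z ^ 2 - L.g₂ / 2)) *
        L.derivWeierstrassP z = 0 := by
    intro z hz
    have h1 := (hd z hz).pow 2
    have hP := L.hasDerivAt_weierstrassP hz
    have h2 := ((((hP.pow 3).const_mul 4).sub (hP.const_mul L.g₂)).sub_const L.g₃)
    have h3 := h1.unique (h2.congr_of_eventuallyEq (by
      filter_upwards [L.isOpen_compl_lattice.mem_nhds hz] with w hw
      exact L.derivWeierstrassP_sq w hw))
    simp only [Nat.cast_ofNat, Nat.add_one_sub_one, pow_one] at h3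
    linear_combination h3 / 2
  have han : AnalyticOnNhd ℂ
      (fun z ↦ deriv L.derivWeierstrassP z - (6 * L.weierstrassP z ^ 2 - L.g₂ / 2))
      (L.lattice : Set ℂ)ᶜ := fun z hz ↦
    (L.analyticOnNhd_derivWeierstrassP.deriv z hz).sub
      ((analyticAt_const.mul ((L.analyticOnNhd_weierstrassP z hz).pow 2)).sub analyticAt_const)
  -- Differentiating the cubic equation gives the claim multiplied by `℘'`. On a connected domain
  -- one analytic factor vanishes identically, and `℘'` does not vanish at `ω₁/4`.
  rcases han.eq_zero_or_eq_zero_of_mul_eq_zero L.analyticOnNhd_derivWeierstrassP hprod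
    L.isPreconnected_compl_lattice with h | h
  · have := h z hz
    rw [sub_eq_zero] at this
    rw [← this]
    exact hd z hz
  · exfalso
    have h4 : 2 * (L.ω₁ / 4) ∉ L.lattice := by
      rw [show 2 * (L.ω₁ / 4) = L.ω₁ / 2 by ring]
      exact L.ω₁_div_two_notMem_lattice
    exact L.derivWeierstrassP_ne_zero h4
      (h _ fun h' ↦ h4 (by rw [two_mul]; exact add_mem h' h'))

end PeriodPair

namespace PeriodPair

open Filter Topology

/-! ### Rectangular lattices -/

/-- The lattice of `L` is rectangular: `ω₁` is real and `ω₂` is imaginary. -/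
structure IsRectangular (L : PeriodPair) : Prop where
  ω₁_im : L.ω₁.im = 0
  ω₁_re_pos : 0 < L.ω₁.re
  ω₂_re : L.ω₂.re = 0
  ω₂_im_pos : 0 < L.ω₂.im

namespace IsRectangular

variable {L : PeriodPair} (hL : L.IsRectangular)

include hL

lemma ω₁_eq : L.ω₁ = (L.ω₁.re : ℂ) := by
  apply Complex.ext <;> simp [hL.ω₁_im]

lemma mem_lattice_iff {z : ℂ} :
    z ∈ L.lattice ↔ ∃ m n : ℤ, z.re = m * L.ω₁.re ∧ z.im = n * L.ω₂.im := by
  rw [PeriodPair.mem_lattice]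
  refine exists₂_congr fun m n ↦ ?_
  rw [Complex.ext_iff]
  simp [hL.ω₁_im, hL.ω₂_re, eq_comm]

lemma conj_mem_lattice_iff {z : ℂ} : (starRingEnd ℂ) z ∈ L.lattice ↔ z ∈ L.lattice := by
  have h : ∀ w ∈ L.lattice, (starRingEnd ℂ) w ∈ L.lattice := by
    intro w hw
    obtain ⟨m, n, h1, h2⟩ := hL.mem_lattice_iff.mp hw
    exact hL.mem_lattice_iff.mpr ⟨m, -n, by simpa using h1, by simp [h2]⟩
  exact ⟨fun h' ↦ by simpa using h _ h', h z⟩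

/-- Complex conjugation as a permutation of a rectangular lattice. -/
def conjEquiv : L.lattice ≃ L.lattice where
  toFun l := ⟨(starRingEnd ℂ) l, hL.conj_mem_lattice_iff.mpr l.2⟩
  invFun l := ⟨(starRingEnd ℂ) l, hL.conj_mem_lattice_iff.mpr l.2⟩
  left_inv l := by simp
  right_inv l := by simp

lemma weierstrassP_conj (z : ℂ) :
    L.weierstrassP ((starRingEnd ℂ) z) = (starRingEnd ℂ) (L.weierstrassP z) := by
  rw [weierstrassP, weierstrassP, ← hL.conjEquiv.tsum_eq, Complex.conj_tsum]
  congr with l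
  simp [conjEquiv]

lemma derivWeierstrassP_conj (z : ℂ) :
    L.derivWeierstrassP ((starRingEnd ℂ) z) = (starRingEnd ℂ) (L.derivWeierstrassP z) := by
  rw [derivWeierstrassP, derivWeierstrassP, ← hL.conjEquiv.tsum_eq, map_neg, Complex.conj_tsum]
  congr with l
  simp [conjEquiv, Complex.conj_ofNat]

lemma weierstrassZeta_conj (z : ℂ) :
    L.weierstrassZeta ((starRingEnd ℂ) z) = (starRingEnd ℂ) (L.weierstrassZeta z) := by
  rw [weierstrassZeta, weierstrassZeta, ← hL.conjEquiv.tsum_eq, Complex.conj_tsum]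
  congr with l
  simp [conjEquiv]

lemma G_conj (n : ℕ) : (starRingEnd ℂ) (L.G n) = L.G n := by
  rw [G, Complex.conj_tsum, ← hL.conjEquiv.tsum_eq]
  congr with l
  simp [conjEquiv]

/-- The point `ω₂ / 2 + x` for real `x`. -/
noncomputable def _root_.PeriodPair.midline (L : PeriodPair) (x : ℝ) : ℂ := L.ω₂ / 2 + x

omit hL in
lemma _root_.PeriodPair.midline_im (L : PeriodPair) (x : ℝ) :
    (L.midline x).im = L.ω₂.im / 2 := by
  simp [midline]

lemma im_half_ne (n : ℤ) : L.ω₂.im / 2 ≠ n * L.ω₂.im := by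
  intro h
  have h1 : (1 : ℝ) = 2 * n := by
    apply mul_right_cancel₀ hL.ω₂_im_pos.ne'
    linarith
  have h2 : (1 : ℤ) = 2 * n := by exact_mod_cast h1
  omega

lemma notMem_of_im {z : ℂ} (hz : z.im = L.ω₂.im / 2) : z ∉ L.lattice := by
  intro h
  obtain ⟨m, n, -, h2⟩ := hL.mem_lattice_iff.mp h
  exact hL.im_half_ne n (hz ▸ h2)

lemma midline_notMem (x : ℝ) : L.midline x ∉ L.lattice := hL.notMem_of_im (L.midline_im x)

lemma ofReal_notMem {x : ℝ} (hx : x ∈ Ioo 0 L.ω₁.re) : (x : ℂ) ∉ L.lattice := by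
  intro h
  obtain ⟨m, n, h1, -⟩ := hL.mem_lattice_iff.mp h
  rw [Complex.ofReal_re] at h1
  have ha := hL.ω₁_re_pos
  have h2 : (0 : ℝ) < m := by
    by_contra! h3
    nlinarith [hx.1]
  have h3 : (m : ℝ) < 1 := by
    by_contra! h3
    nlinarith [hx.2]
  have : (0 : ℤ) < m := by exact_mod_cast h2
  have : m < (1 : ℤ) := by exact_mod_cast h3
  omega

omit hL in
lemma ofReal_re_of_conj {z : ℂ} (h : (starRingEnd ℂ) z = z) : ((z.re : ℝ) : ℂ) = z :=
  Complex.conj_eq_iff_re.mp h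

lemma ofReal_weierstrassP (x : ℝ) : ((L.weierstrassP x).re : ℂ) = L.weierstrassP x :=
  ofReal_re_of_conj (by rw [← hL.weierstrassP_conj, Complex.conj_ofReal])

lemma ofReal_derivWeierstrassP (x : ℝ) :
    ((L.derivWeierstrassP x).re : ℂ) = L.derivWeierstrassP x :=
  ofReal_re_of_conj (by rw [← hL.derivWeierstrassP_conj, Complex.conj_ofReal])

lemma ofReal_weierstrassZeta (x : ℝ) : ((L.weierstrassZeta x).re : ℂ) = L.weierstrassZeta x :=
  ofReal_re_of_conj (by rw [← hL.weierstrassZeta_conj, Complex.conj_ofReal])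

/-- Conjugation fixes the line `ω₂/2 + ℝ` modulo a period; this is why `℘` and `℘'` are real on it.
-/
lemma conj_midline (x : ℝ) : (starRingEnd ℂ) (L.midline x) = L.midline x - L.ω₂ := by
  have h : (starRingEnd ℂ) L.ω₂ = -L.ω₂ := by
    apply Complex.ext <;> simp [hL.ω₂_re]
  rw [midline, map_add, map_div₀, h, Complex.conj_ofReal, Complex.conj_ofNat]
  ring

lemma ofReal_weierstrassP_midline (x : ℝ) :
    ((L.weierstrassP (L.midline x)).re : ℂ) = L.weierstrassP (L.midline x) :=
  ofReal_re_of_conj (by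
    rw [← hL.weierstrassP_conj, hL.conj_midline]
    exact L.weierstrassP_sub_coe _ ⟨_, L.ω₂_mem_lattice⟩)

lemma ofReal_derivWeierstrassP_midline (x : ℝ) :
    ((L.derivWeierstrassP (L.midline x)).re : ℂ) = L.derivWeierstrassP (L.midline x) :=
  ofReal_re_of_conj (by
    rw [← hL.derivWeierstrassP_conj, hL.conj_midline]
    exact L.derivWeierstrassP_sub_coe _ ⟨_, L.ω₂_mem_lattice⟩)

lemma continuousOn_weierstrassP_real :
    ContinuousOn (fun x : ℝ ↦ (L.weierstrassP x).re) (Ioo 0 L.ω₁.re) := by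
  intro x hx
  have := (L.hasDerivAt_weierstrassP (hL.ofReal_notMem hx)).continuousAt
  exact (Complex.continuous_re.continuousAt.comp (f := fun x : ℝ ↦ L.weierstrassP x)
    (this.comp Complex.continuous_ofReal.continuousAt)).continuousWithinAt

/-- Equal values force `x + y` or `x - y` into the lattice. The only positive period in the range of
`x + y` is `ω₁`, reached when both points are the half period. -/
lemma injOn_weierstrassP_real :
    InjOn (fun x : ℝ ↦ (L.weierstrassP x).re) (Ioc 0 (L.ω₁.re / 2)) := by
  intro x hx y hy hxy
  have ha := hL.ω₁_re_pos
  have hx' : x ∈ Ioo 0 L.ω₁.re := ⟨hx.1, by linarith [hx.2]⟩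
  have hy' : y ∈ Ioo 0 L.ω₁.re := ⟨hy.1, by linarith [hy.2]⟩
  have h : L.weierstrassP x = L.weierstrassP y := by
    rw [← hL.ofReal_weierstrassP, ← hL.ofReal_weierstrassP y]
    exact congrArg _ hxy
  rcases (L.weierstrassP_eq_iff (hL.ofReal_notMem hy') (hL.ofReal_notMem hx')).mp h with h | h
  · rw [← Complex.ofReal_add] at h
    by_contra hne
    have : x + y ≠ L.ω₁.re := by
      rintro h1
      have := hx.2
      have := hy.2
      exact hne (by linarith)
    exact hL.ofReal_notMem ⟨by linarith [hx.1, hy.1],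
      lt_of_le_of_ne (by linarith [hx.2, hy.2]) this⟩ h
  · rw [← Complex.ofReal_sub] at h
    by_contra hne
    rcases lt_or_gt_of_ne hne with h1 | h1
    · refine hL.ofReal_notMem (x := y - x) ⟨by linarith, by linarith [hx.1, hy.2]⟩ ?_
      have := neg_mem h
      rwa [← Complex.ofReal_neg, neg_sub] at this
    · exact hL.ofReal_notMem ⟨by linarith, by linarith [hx.2, hy.1]⟩ h

-- Near zero `℘` is `1/x²` plus a function continuous at `0`.
omit hL in
lemma _root_.PeriodPair.exists_weierstrassP_real_gt (L : PeriodPair) (v : ℝ) {δ : ℝ} (hδ : 0 < δ) :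
    ∃ x ∈ Ioo 0 δ, v < (L.weierstrassP x).re := by
  have hre : Tendsto (fun x : ℝ ↦ (L.weierstrassPExcept 0 x).re + 1 / x ^ 2) (𝓝[>] 0) atTop := by
    have h1 : Tendsto (fun x : ℝ ↦ (L.weierstrassPExcept 0 x).re) (𝓝[>] 0)
        (𝓝 (L.weierstrassPExcept 0 ((0 : ℝ) : ℂ)).re) := by
      have h0 : ContinuousAt (L.weierstrassPExcept 0) ((0 : ℝ) : ℂ) := by
        rw [Complex.ofReal_zero]
        exact (L.analyticAt_weierstrassPExcept 0).continuousAt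
      exact tendsto_nhdsWithin_of_tendsto_nhds (Complex.continuous_re.continuousAt.comp
        (f := fun x : ℝ ↦ L.weierstrassPExcept 0 x)
        (h0.comp (Complex.continuous_ofReal.continuousAt (x := 0))))
    refine h1.add_atTop ?_
    have h2 : Tendsto (fun x : ℝ ↦ x⁻¹ ^ 2) (𝓝[>] 0) atTop :=
      (tendsto_pow_atTop two_ne_zero).comp tendsto_inv_nhdsGT_zero
    refine h2.congr fun x ↦ ?_
    rw [inv_pow, one_div]
  obtain ⟨x, hx1, hx2⟩ := ((hre.eventually_gt_atTop v).and
    (Ioo_mem_nhdsGT hδ)).exists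
  refine ⟨x, hx2, ?_⟩
  have h := L.weierstrassPExcept_add 0 (x : ℂ)
  simp only [ZeroMemClass.coe_zero, sub_zero] at h
  rw [← h]
  have h3 : (1 / (x : ℂ) ^ 2 - 1 / 0 ^ 2 : ℂ) = ((1 / x ^ 2 : ℝ) : ℂ) := by
    push_cast
    simp
  rw [h3, Complex.add_re, Complex.ofReal_re]
  exact hx1

lemma exists_weierstrassP_real_eq {v : ℝ} (hv : (L.weierstrassP (L.ω₁.re / 2 : ℝ)).re ≤ v) :
    ∃ x ∈ Ioc 0 (L.ω₁.re / 2), (L.weierstrassP x).re = v := by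
  have ha := hL.ω₁_re_pos
  obtain ⟨x₀, hx₀, h⟩ := L.exists_weierstrassP_real_gt v (half_pos ha)
  obtain ⟨x, hx, hxv⟩ := intermediate_value_Icc' hx₀.2.le (hL.continuousOn_weierstrassP_real.mono
    (fun y hy ↦ ⟨hx₀.1.trans_le hy.1, by linarith [hy.2]⟩)) ⟨hv, h.le⟩
  exact ⟨x, ⟨hx₀.1.trans_le hx.1, hx.2⟩, hxv⟩

/-- Every real value from `℘(ω₁/2)` upwards is already taken on the real axis. As `℘` takes a value
only at one pair `±y` modulo the lattice, it cannot take it on the midline as well. -/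
lemma weierstrassP_midline_lt (x : ℝ) :
    (L.weierstrassP (L.midline x)).re < (L.weierstrassP (L.ω₁.re / 2 : ℝ)).re := by
  by_contra! hcon
  obtain ⟨y, hy, h⟩ := hL.exists_weierstrassP_real_eq hcon
  have ha := hL.ω₁_re_pos
  have hy' : (y : ℂ) ∉ L.lattice := hL.ofReal_notMem ⟨hy.1, by linarith [hy.2]⟩
  have h' : L.weierstrassP (L.midline x) = L.weierstrassP y := by
    rw [← hL.ofReal_weierstrassP_midline, ← hL.ofReal_weierstrassP, h]
  rcases (L.weierstrassP_eq_iff hy' (hL.midline_notMem x)).mp h' with h1 | h1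
  · exact hL.notMem_of_im (by simp [midline]) h1
  · exact hL.notMem_of_im (by simp [midline]) h1

/-- On the half period `℘` is continuous and injective, and it starts above its final value, so it
decreases. -/
lemma derivWeierstrassP_real_nonpos {t : ℝ} (ht : t ∈ Ioo 0 (L.ω₁.re / 2)) :
    (L.derivWeierstrassP t).re ≤ 0 := by
  have ha := hL.ω₁_re_pos
  obtain ⟨x₀, hx₀, h⟩ := L.exists_weierstrassP_real_gt (L.weierstrassP (L.ω₁.re / 2 : ℝ)).re ht.1
  have hlt : x₀ ≤ L.ω₁.re / 2 := (hx₀.2.trans ht.2).le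
  have hanti : StrictAntiOn (fun x : ℝ ↦ (L.weierstrassP x).re) (Icc x₀ (L.ω₁.re / 2)) := by
    refine ContinuousOn.strictAntiOn_of_injOn_Icc hlt h.le
      (hL.continuousOn_weierstrassP_real.mono fun y hy ↦ ?_)
      (hL.injOn_weierstrassP_real.mono fun y hy ↦ ?_)
    · exact ⟨hx₀.1.trans_le hy.1, by linarith [hy.2]⟩
    · exact ⟨hx₀.1.trans_le hy.1, hy.2⟩
  have hmem : t ∈ Ioo 0 L.ω₁.re := ⟨ht.1, by linarith [ht.2]⟩
  have hd := (L.hasDerivAt_weierstrassP (hL.ofReal_notMem hmem)).real_of_complex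
  have := AntitoneOn.derivWithin_nonpos (x := t) hanti.antitoneOn
  rwa [derivWithin_of_mem_nhds (Icc_mem_nhds hx₀.2 ht.2), hd.deriv] at this

/-! The values of `℘` at the half periods -/

omit hL in
/-- The values of `℘` at `ω₁/2`, `(ω₁+ω₂)/2` and `ω₂/2`, for a rectangular lattice. -/
noncomputable def _root_.PeriodPair.halfPeriodValue (L : PeriodPair) : Fin 3 → ℝ :=
  ![(L.weierstrassP (L.ω₁.re / 2 : ℝ)).re, (L.weierstrassP (L.midline (L.ω₁.re / 2))).re,
    (L.weierstrassP (L.midline 0)).re]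

lemma halfPeriodValue_one_lt : L.halfPeriodValue 1 < L.halfPeriodValue 0 :=
  hL.weierstrassP_midline_lt _

lemma halfPeriodValue_two_lt : L.halfPeriodValue 2 < L.halfPeriodValue 0 :=
  hL.weierstrassP_midline_lt _

lemma halfPeriodValue_one_ne_two : L.halfPeriodValue 1 ≠ L.halfPeriodValue 2 := by
  intro h
  have ha := hL.ω₁_re_pos
  have h' : L.weierstrassP (L.midline (L.ω₁.re / 2)) = L.weierstrassP (L.midline 0) := by
    rw [← hL.ofReal_weierstrassP_midline, ← hL.ofReal_weierstrassP_midline 0]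
    exact congrArg _ h
  have hmem : ((L.ω₁.re / 2 : ℝ) : ℂ) ∉ L.lattice :=
    hL.ofReal_notMem ⟨half_pos ha, half_lt_self ha⟩
  rcases (L.weierstrassP_eq_iff (hL.midline_notMem _) (hL.midline_notMem _)).mp h' with h1 | h1
  · rw [midline, midline, show L.ω₂ / 2 + ((L.ω₁.re / 2 : ℝ) : ℂ) + (L.ω₂ / 2 + ((0 : ℝ) : ℂ)) =
      ((L.ω₁.re / 2 : ℝ) : ℂ) + L.ω₂ by push_cast; ring, add_mem_lattice_iff L.ω₂_mem_lattice] at h1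
    exact hmem h1
  · rw [midline, midline, show L.ω₂ / 2 + ((L.ω₁.re / 2 : ℝ) : ℂ) - (L.ω₂ / 2 + ((0 : ℝ) : ℂ)) =
      ((L.ω₁.re / 2 : ℝ) : ℂ) by push_cast; ring] at h1
    exact hmem h1

lemma g₂_eq : ((L.g₂.re : ℝ) : ℂ) = L.g₂ :=
  ofReal_re_of_conj (by simp [g₂, hL.G_conj, Complex.conj_ofNat])

lemma g₃_eq : ((L.g₃.re : ℝ) : ℂ) = L.g₃ :=
  ofReal_re_of_conj (by simp [g₃, hL.G_conj, Complex.conj_ofNat])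

lemma cubic_halfPeriodValue (k : Fin 3) :
    4 * L.halfPeriodValue k ^ 3 - L.g₂.re * L.halfPeriodValue k - L.g₃.re = 0 := by
  have ha := hL.ω₁_re_pos
  have key : ∀ (z : ℂ) (v : ℝ), z ∉ L.lattice → 2 * z ∈ L.lattice → (v : ℂ) = L.weierstrassP z →
      4 * v ^ 3 - L.g₂.re * v - L.g₃.re = 0 := by
    intro z v hz h2 hv
    have h := L.derivWeierstrassP_sq z hz
    rw [L.derivWeierstrassP_eq_zero h2, ← hv, ← hL.g₂_eq, ← hL.g₃_eq] at h
    have h' : ((4 * v ^ 3 - L.g₂.re * v - L.g₃.re : ℝ) : ℂ) = 0 := by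
      push_cast
      linear_combination -h
    exact_mod_cast h'
  have h1 : 2 * ((L.ω₁.re / 2 : ℝ) : ℂ) = L.ω₁ := by
    rw [hL.ω₁_eq]; push_cast; rw [Complex.ofReal_re]; ring
  fin_cases k
  · refine key _ _ ?_ ?_ (hL.ofReal_weierstrassP _)
    · exact hL.ofReal_notMem ⟨half_pos ha, half_lt_self ha⟩
    · rw [h1]
      exact L.ω₁_mem_lattice
  · refine key _ _ (hL.midline_notMem _) ?_ (hL.ofReal_weierstrassP_midline _)
    rw [midline, mul_add, h1, mul_div_cancel₀ _ two_ne_zero]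
    exact add_mem L.ω₂_mem_lattice L.ω₁_mem_lattice
  · refine key _ _ (hL.midline_notMem _) ?_ (hL.ofReal_weierstrassP_midline _)
    rw [midline, mul_add, mul_div_cancel₀ _ two_ne_zero]
    simpa using L.ω₂_mem_lattice

/-- Vieta's formulas, obtained by dividing differences of the three cubic equations by the nonzero
differences of the roots. -/
lemma halfPeriodValue_sum :
    L.halfPeriodValue 0 + L.halfPeriodValue 1 + L.halfPeriodValue 2 = 0 ∧
    L.g₂.re = 2 * (L.halfPeriodValue 0 ^ 2 + L.halfPeriodValue 1 ^ 2 + L.halfPeriodValue 2 ^ 2) ∧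
    L.g₃.re = 4 * (L.halfPeriodValue 0 * L.halfPeriodValue 1 * L.halfPeriodValue 2) := by
  have c0 := hL.cubic_halfPeriodValue 0
  have c1 := hL.cubic_halfPeriodValue 1
  have c2 := hL.cubic_halfPeriodValue 2
  have h01 : L.halfPeriodValue 0 - L.halfPeriodValue 1 ≠ 0 :=
    sub_ne_zero.mpr hL.halfPeriodValue_one_lt.ne'
  have h02 : L.halfPeriodValue 0 - L.halfPeriodValue 2 ≠ 0 :=
    sub_ne_zero.mpr hL.halfPeriodValue_two_lt.ne'
  have h12 : L.halfPeriodValue 1 - L.halfPeriodValue 2 ≠ 0 :=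
    sub_ne_zero.mpr hL.halfPeriodValue_one_ne_two
  generalize L.halfPeriodValue 0 = e₁ at *
  generalize L.halfPeriodValue 1 = e₂ at *
  generalize L.halfPeriodValue 2 = e₃ at *
  have i1 : L.g₂.re = 4 * (e₁ ^ 2 + e₁ * e₂ + e₂ ^ 2) := by
    apply mul_left_cancel₀ h01
    linear_combination c1 - c0
  have i2 : L.g₂.re = 4 * (e₁ ^ 2 + e₁ * e₃ + e₃ ^ 2) := by
    apply mul_left_cancel₀ h02
    linear_combination c2 - c0
  have i3 : e₁ + e₂ + e₃ = 0 := by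
    apply mul_left_cancel₀ h12
    linear_combination (i2 - i1) / 4
  obtain rfl : e₃ = -e₁ - e₂ := by linear_combination i3
  refine ⟨by ring, by linear_combination i1, ?_⟩
  linear_combination -c0 - e₁ * i1

lemma g₂_re_pos : 0 < L.g₂.re := by
  obtain ⟨h0, h2, -⟩ := hL.halfPeriodValue_sum
  have := hL.halfPeriodValue_one_lt
  have := hL.halfPeriodValue_two_lt
  have h : 0 < L.halfPeriodValue 0 := by linarith
  rw [h2]
  positivity

lemma cubic_eq (x : ℝ) : 4 * x ^ 3 - L.g₂.re * x - L.g₃.re =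
    4 * ((x - L.halfPeriodValue 0) * (x - L.halfPeriodValue 1) * (x - L.halfPeriodValue 2)) := by
  obtain ⟨h0, h2, h3⟩ := hL.halfPeriodValue_sum
  rw [h2, h3]
  linear_combination (4 * x ^ 2 - 2 * x * (L.halfPeriodValue 0 + L.halfPeriodValue 1 +
    L.halfPeriodValue 2)) * h0

end IsRectangular

end PeriodPair

namespace ToricCP2

open Filter Topology PeriodPair

/-! ### The elliptic curve of a level set of `y¹y²y³` -/

variable {L : PeriodPair} {c : ℝ}

lemma HasPeriods.isRectangular (h : HasPeriods L c) : L.IsRectangular :=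
  ⟨h.1.1, h.1.2, h.2.1.1, h.2.1.2⟩

lemma HasPeriods.derivWeierstrassP_sq (h : HasPeriods L c) {z : ℂ} (hz : z ∉ L.lattice) :
    L.derivWeierstrassP z ^ 2 =
      (1 / 12 - L.weierstrassP z - c) ^ 2 - 4 * (1 / 12 - L.weierstrassP z) ^ 3 := by
  rw [L.derivWeierstrassP_sq z hz, h.2.2.1, h.2.2.2]
  ring

lemma HasPeriods.cubic_eq (h : HasPeriods L c) (x : ℝ) :
    (1 / 12 - x - c) ^ 2 - 4 * (1 / 12 - x) ^ 3 =
    4 * ((x - L.halfPeriodValue 0) * (x - L.halfPeriodValue 1) * (x - L.halfPeriodValue 2)) := by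
  have hL := h.isRectangular
  have h2 : L.g₂.re = 1 / 12 - 2 * c := by
    rw [h.2.2.1, show (1 / 12 - 2 * (c : ℂ)) = ((1 / 12 - 2 * c : ℝ) : ℂ) by push_cast; ring,
      Complex.ofReal_re]
  have h3 : L.g₃.re = c / 6 - 1 / 216 - c ^ 2 := by
    rw [h.2.2.2, show ((c : ℂ) / 6 - 1 / 216 - (c : ℂ) ^ 2) =
      ((c / 6 - 1 / 216 - c ^ 2 : ℝ) : ℂ) by push_cast; ring, Complex.ofReal_re]
  rw [← hL.cubic_eq, h2, h3]
  ring

/-- At the root, `w = 1/12 - e₁` satisfies `(w - c)² = 4w³`; for `w ≤ 0` the left side is positive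
and the right side is not. -/
lemma HasPeriods.halfPeriodValue_zero_lt (h : HasPeriods L c) (hc : 0 < c) :
    L.halfPeriodValue 0 < 1 / 12 := by
  have h0 := h.cubic_eq (L.halfPeriodValue 0)
  rw [sub_self, zero_mul, zero_mul, mul_zero] at h0
  by_contra! hcon
  have h1 : (1 / 12 - L.halfPeriodValue 0) ^ 3 ≤ 0 :=
    Odd.pow_nonpos (by decide) (by linarith)
  have h2 : 1 / 12 - L.halfPeriodValue 0 - c < 0 := by linarith
  nlinarith [sq_nonneg (1 / 12 - L.halfPeriodValue 0 - c), mul_pos_of_neg_of_neg h2 h2]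

/-- The cubic equals `-4c³ < 0` at `1/12 - c`, which therefore cannot lie at or above the largest
root. -/
lemma HasPeriods.sub_halfPeriodValue_zero_lt (h : HasPeriods L c) (hc : 0 < c) :
    1 / 12 - L.halfPeriodValue 0 < c := by
  by_contra! hcon
  have hL := h.isRectangular
  have h1 := hL.halfPeriodValue_one_lt
  have h2 := hL.halfPeriodValue_two_lt
  have h0 := h.cubic_eq (1 / 12 - c)
  have hc3 : 0 < c ^ 3 := by positivity
  have : 0 ≤ (1 / 12 - c - L.halfPeriodValue 0) * (1 / 12 - c - L.halfPeriodValue 1) *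
      (1 / 12 - c - L.halfPeriodValue 2) := by
    refine mul_nonneg (mul_nonneg ?_ ?_) ?_ <;> linarith
  nlinarith

/-- The value `1/12` exceeds the largest root, so `℘` attains it on the real axis. There `w = 0`, so
`℘'² = c²`, and `℘` is decreasing. -/
lemma HasPeriods.exists_flex (h : HasPeriods L c) (hc : 0 < c) :
    ∃ t ∈ Ioo 0 (L.ω₁.re / 2), L.weierstrassP (t : ℝ) = 1 / 12 ∧
      L.derivWeierstrassP (t : ℝ) = -c := by
  have hL := h.isRectangular
  have ha := hL.ω₁_re_pos
  have h0 := h.halfPeriodValue_zero_lt hc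
  obtain ⟨t, ht, htv⟩ := hL.exists_weierstrassP_real_eq (v := 1 / 12) h0.le
  have ht' : t ≠ L.ω₁.re / 2 := by
    rintro rfl
    exact h0.ne htv
  have hmem : t ∈ Ioo 0 (L.ω₁.re / 2) := ⟨ht.1, lt_of_le_of_ne ht.2 ht'⟩
  have hnot : (t : ℂ) ∉ L.lattice := hL.ofReal_notMem ⟨ht.1, by linarith [ht.2]⟩
  have hP : L.weierstrassP (t : ℝ) = 1 / 12 := by
    rw [← hL.ofReal_weierstrassP, htv]
    push_cast
    ring
  refine ⟨t, hmem, hP, ?_⟩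
  have hsq := h.derivWeierstrassP_sq hnot
  have hneg := hL.derivWeierstrassP_real_nonpos hmem
  rw [hP, ← hL.ofReal_derivWeierstrassP] at hsq
  have hsq' : (L.derivWeierstrassP t).re ^ 2 = c ^ 2 := by
    have : (((L.derivWeierstrassP t).re ^ 2 : ℝ) : ℂ) = ((c ^ 2 : ℝ) : ℂ) := by
      push_cast
      rw [hsq]
      ring
    exact_mod_cast this
  rw [← hL.ofReal_derivWeierstrassP]
  rcases sq_eq_sq_iff_eq_or_eq_neg.mp hsq' with h1 | h1
  · linarith
  · rw [h1]
    push_cast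
    ring

/-- Differentiate the addition theorem of `ζ` in `z` and eliminate `℘''` and `℘'²`. -/
lemma HasPeriods.weierstrassP_add_flex (h : HasPeriods L c) {t z : ℂ} (ht : t ∉ L.lattice)
    (hPt : L.weierstrassP t = 1 / 12) (hPt' : L.derivWeierstrassP t = -c) (hz : z ∉ L.lattice)
    (hp : z + t ∉ L.lattice) (hm : z - t ∉ L.lattice) :
    1 / 12 - L.weierstrassP (z + t) = c * (1 / 12 - L.weierstrassP z - c - L.derivWeierstrassP z) /
      (2 * (1 / 12 - L.weierstrassP z) ^ 2) := by
  have hU := L.isOpen_compl_lattice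
  have hne : L.weierstrassP z - 1 / 12 ≠ 0 := by
    rw [← hPt, sub_ne_zero, ne_eq, L.weierstrassP_eq_iff ht hz, not_or]
    exact ⟨hp, hm⟩
  have hne' : 1 / 12 - L.weierstrassP z ≠ 0 := fun e ↦ hne (by linear_combination -e)
  have hP := L.hasDerivAt_weierstrassP hz
  have h1 := (L.hasDerivAt_weierstrassZeta hp).comp_add_const z t
  have h2 := ((L.hasDerivAt_weierstrassZeta hz).add_const (L.weierstrassZeta t)).add
    (((L.hasDerivAt_derivWeierstrassP hz).sub_const (L.derivWeierstrassP t)).div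
      ((hP.sub_const (L.weierstrassP t)).const_mul 2) (by rw [hPt]; simpa using hne))
  have e1 : ∀ᶠ w in 𝓝 z, w ∉ L.lattice := hU.mem_nhds hz
  have e2 : ∀ᶠ w in 𝓝 z, w + t ∉ L.lattice :=
    (continuous_id.add continuous_const).continuousAt.eventually_mem (hU.mem_nhds hp)
  have e3 : ∀ᶠ w in 𝓝 z, w - t ∉ L.lattice :=
    (continuous_id.sub continuous_const).continuousAt.eventually_mem (hU.mem_nhds hm)
  have h3 := h1.unique (h2.congr_of_eventuallyEq (by
    filter_upwards [e1, e2, e3] with w h1 h2 h3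
    exact L.weierstrassZeta_add ht h1 h2 h3))
  have hsq := h.derivWeierstrassP_sq hz
  rw [hPt, hPt', h.2.2.1] at h3
  generalize L.weierstrassP (z + t) = Pt at *
  generalize L.weierstrassP z = P at *
  generalize L.derivWeierstrassP z = P' at *
  rw [eq_div_iff (mul_ne_zero two_ne_zero (pow_ne_zero 2 hne'))]
  rw [← sub_eq_iff_eq_add', eq_div_iff (pow_ne_zero 2 (mul_ne_zero two_ne_zero hne))] at h3
  linear_combination h3 / 2 - hsq

end ToricCP2

/-! ### The real oval of a level set and translation by a third of the period -/

namespace ToricCP2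

open Filter Topology PeriodPair

/-- The real function `c / (1/12 - ℘(ω₂/2 + x))`, whose translates by thirds of the real period
solve the Lotka-Volterra equations. -/
noncomputable def orbit (L : PeriodPair) (c x : ℝ) : ℝ :=
  c / (1 / 12 - (L.weierstrassP (L.midline x)).re)

variable {L : PeriodPair} {c : ℝ}

lemma midline_add (L : PeriodPair) (x y : ℝ) : L.midline (x + y) = L.midline x + y := by
  simp [midline, add_assoc]

lemma midline_sub (L : PeriodPair) (x y : ℝ) : L.midline (x - y) = L.midline x - y := by
  simp [midline, add_sub_assoc]

lemma HasPeriods.gap_pos (h : HasPeriods L c) (hc : 0 < c) (x : ℝ) :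
    0 < 1 / 12 - (L.weierstrassP (L.midline x)).re := by
  have h1 := h.isRectangular.weierstrassP_midline_lt x
  have h2 : _ < (1 / 12 : ℝ) := h.halfPeriodValue_zero_lt hc
  have h3 : L.halfPeriodValue 0 = (L.weierstrassP (L.ω₁.re / 2 : ℝ)).re := rfl
  linarith

lemma HasPeriods.ofReal_orbit (h : HasPeriods L c) (x : ℝ) :
    (orbit L c x : ℂ) = c / (1 / 12 - L.weierstrassP (L.midline x)) := by
  rw [orbit, ← h.isRectangular.ofReal_weierstrassP_midline]
  push_cast
  rfl

lemma HasPeriods.orbit_pos (h : HasPeriods L c) (hc : 0 < c) (x : ℝ) : 0 < orbit L c x :=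
  div_pos hc (h.gap_pos hc x)

lemma HasPeriods.orbit_add_period (h : HasPeriods L c) (x : ℝ) :
    orbit L c (x + L.ω₁.re) = orbit L c x := by
  rw [orbit, orbit, midline_add, ← h.isRectangular.ω₁_eq,
    L.weierstrassP_add_coe _ ⟨_, L.ω₁_mem_lattice⟩]

lemma HasPeriods.slope_sq (h : HasPeriods L c) (x : ℝ) :
    (L.derivWeierstrassP (L.midline x)).re ^ 2 =
      (1 / 12 - (L.weierstrassP (L.midline x)).re - c) ^ 2 -
        4 * (1 / 12 - (L.weierstrassP (L.midline x)).re) ^ 3 := by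
  have hL := h.isRectangular
  rw [← Complex.ofReal_inj]
  push_cast
  rw [hL.ofReal_derivWeierstrassP_midline, hL.ofReal_weierstrassP_midline]
  exact h.derivWeierstrassP_sq (hL.midline_notMem x)

/-- Inverting the formula for `1/12 - ℘(z + t)` and rationalising with `℘'² = (w - c)² - 4w³` makes
it linear in `℘'`. The sign `ε` covers both translates; the backward one is the forward formula at
`-z`. -/
lemma HasPeriods.orbit_add_flex_aux (h : HasPeriods L c) (hc : 0 < c) {t : ℝ} {ε : ℝ}
    (hε : ε = 1 ∨ ε = -1) (ht : (t : ℂ) ∉ L.lattice)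
    (hPt : L.weierstrassP t = 1 / 12) (hPt' : L.derivWeierstrassP t = -c) (x : ℝ) :
    orbit L c (x + ε * t) = (1 - orbit L c x + ε * (L.derivWeierstrassP (L.midline x)).re /
        (1 / 12 - (L.weierstrassP (L.midline x)).re)) / 2 := by
  have hL := h.isRectangular
  have hw := (h.gap_pos hc x).ne'
  have hw' := (h.gap_pos hc (x + ε * t)).ne'
  have key : 1 / 12 - (L.weierstrassP (L.midline (x + ε * t))).re =
      c * (1 / 12 - (L.weierstrassP (L.midline x)).re - c -
        ε * (L.derivWeierstrassP (L.midline x)).re) /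
      (2 * (1 / 12 - (L.weierstrassP (L.midline x)).re) ^ 2) := by
    have hp : L.midline x + t ∉ L.lattice := by
      rw [← midline_add]; exact hL.midline_notMem _
    have hm : L.midline x - t ∉ L.lattice := by
      rw [← midline_sub]; exact hL.midline_notMem _
    have hcast : ((1 / 12 - (L.weierstrassP (L.midline (x + ε * t))).re : ℝ) : ℂ) =
      ((c * (1 / 12 - (L.weierstrassP (L.midline x)).re - c -
        ε * (L.derivWeierstrassP (L.midline x)).re) /
      (2 * (1 / 12 - (L.weierstrassP (L.midline x)).re) ^ 2) : ℝ) : ℂ) := by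
      push_cast
      rw [hL.ofReal_weierstrassP_midline, hL.ofReal_weierstrassP_midline,
        hL.ofReal_derivWeierstrassP_midline]
      rcases hε with rfl | rfl
      · have := h.weierstrassP_add_flex ht hPt hPt' (hL.midline_notMem x) hp hm
        rw [one_mul, midline_add, this]
        push_cast
        ring
      · have := h.weierstrassP_add_flex ht hPt hPt' (z := -L.midline x)
          (fun h' ↦ hL.midline_notMem x (by simpa using neg_mem h'))
          (fun h' ↦ hm (by simpa [sub_eq_add_neg, add_comm] using neg_mem h'))
          (fun h' ↦ hp (by simpa [sub_eq_add_neg, add_comm] using neg_mem h'))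
        rw [show -L.midline x + t = -(L.midline x - t) by ring, weierstrassP_neg,
          weierstrassP_neg, derivWeierstrassP_neg] at this
        rw [neg_one_mul, ← sub_eq_add_neg, midline_sub, this]
        push_cast
        ring
    exact_mod_cast hcast
  have hsq := h.slope_sq x
  have hε2 : ε ^ 2 = 1 := by rcases hε with rfl | rfl <;> norm_num
  rw [orbit, orbit]
  rw [key] at hw' ⊢
  generalize (L.derivWeierstrassP (L.midline x)).re = P at *
  generalize 1 / 12 - (L.weierstrassP (L.midline x)).re = w at *
  have hne : w - c - ε * P ≠ 0 := by
    intro e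
    rw [e, mul_zero, zero_div] at hw'
    exact hw' rfl
  have hc' := hc.ne'
  field_simp
  linear_combination P ^ 2 * hε2 + hsq

/-- Three consecutive translates by `t` sum to one. Comparing the sums centred at `0` and `t` gives
equal values at `2t` and `-t`, so `3t` is a period or `t` is one modulo `ω₂`. The bounds on `t`
leave only `3t = ω₁`. -/
lemma HasPeriods.flex_eq_third (h : HasPeriods L c) (hc : 0 < c) {t : ℝ}
    (ht : t ∈ Ioo 0 (L.ω₁.re / 2))
    (hPt : L.weierstrassP t = 1 / 12) (hPt' : L.derivWeierstrassP t = -c) :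
    t = L.ω₁.re / 3 := by
  have hL := h.isRectangular
  have ha := hL.ω₁_re_pos
  have ht' : (t : ℂ) ∉ L.lattice := hL.ofReal_notMem ⟨ht.1, by linarith [ht.2]⟩
  have hsum : ∀ x, orbit L c (x + -1 * t) + orbit L c x + orbit L c (x + 1 * t) = 1 := by
    intro x
    rw [h.orbit_add_flex_aux hc (.inr rfl) ht' hPt hPt', h.orbit_add_flex_aux hc (.inl rfl) ht' hPt
      hPt']
    ring
  have h0 := hsum 0
  have h1 := hsum t
  rw [show t + -1 * t = 0 by ring] at h1
  rw [show (0 : ℝ) + 1 * t = t by ring] at h0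
  have h2 : orbit L c (t + 1 * t) = orbit L c (0 + -1 * t) := by linarith
  rw [orbit, orbit, div_eq_div_iff (h.gap_pos hc _).ne' (h.gap_pos hc _).ne',
    mul_right_inj' hc.ne', sub_right_inj] at h2
  replace h2 := h2.symm
  have h3 : L.weierstrassP (L.midline (t + 1 * t)) = L.weierstrassP (L.midline (0 + -1 * t)) := by
    rw [← hL.ofReal_weierstrassP_midline, h2, hL.ofReal_weierstrassP_midline]
  rcases (L.weierstrassP_eq_iff (hL.midline_notMem _) (hL.midline_notMem _)).mp h3 with h4 | h4
  · exfalso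
    rw [midline, midline, show L.ω₂ / 2 + ((t + 1 * t : ℝ) : ℂ) + (L.ω₂ / 2 +
      ((0 + -1 * t : ℝ) : ℂ)) = t + L.ω₂ by push_cast; ring,
      add_mem_lattice_iff L.ω₂_mem_lattice] at h4
    exact ht' h4
  · rw [midline, midline, show L.ω₂ / 2 + ((t + 1 * t : ℝ) : ℂ) - (L.ω₂ / 2 +
      ((0 + -1 * t : ℝ) : ℂ)) = ((3 * t : ℝ) : ℂ) by push_cast; ring] at h4
    by_contra hne
    rcases lt_or_gt_of_ne hne with h5 | h5
    · exact hL.ofReal_notMem ⟨by linarith [ht.1], by linarith⟩ h4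
    · have := (add_mem_lattice_iff (neg_mem L.ω₁_mem_lattice)).mpr h4
      rw [hL.ω₁_eq, ← Complex.ofReal_neg, ← Complex.ofReal_add] at this
      exact hL.ofReal_notMem ⟨by linarith, by linarith [ht.2]⟩ this

lemma ofReal_third (h : HasPeriods L c) : ((L.ω₁.re / 3 : ℝ) : ℂ) = thirdPeriod L := by
  rw [thirdPeriod, h.isRectangular.ω₁_eq]
  push_cast
  rw [Complex.ofReal_re]
  ring

lemma HasPeriods.thirdPeriod_values (h : HasPeriods L c) (hc : 0 < c) :
    thirdPeriod L ∉ L.lattice ∧ L.weierstrassP (thirdPeriod L) = 1 / 12 ∧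
      L.derivWeierstrassP (thirdPeriod L) = -c := by
  obtain ⟨t, ht, h1, h2⟩ := h.exists_flex hc
  have h3 := h.flex_eq_third hc ht h1 h2
  have ha := h.isRectangular.ω₁_re_pos
  rw [← ofReal_third h, ← h3]
  exact ⟨h.isRectangular.ofReal_notMem ⟨ht.1, by linarith [ht.2]⟩, h1, h2⟩

lemma HasPeriods.orbit_add_third (h : HasPeriods L c) (hc : 0 < c) (x : ℝ) :
    orbit L c (x + L.ω₁.re / 3) = (1 - orbit L c x + (L.derivWeierstrassP (L.midline x)).re /
        (1 / 12 - (L.weierstrassP (L.midline x)).re)) / 2 := by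
  obtain ⟨h1, h2, h3⟩ := h.thirdPeriod_values hc
  rw [← ofReal_third h] at h1 h2 h3
  simpa using h.orbit_add_flex_aux hc (.inl rfl) h1 h2 h3 x

lemma HasPeriods.orbit_sub_third (h : HasPeriods L c) (hc : 0 < c) (x : ℝ) :
    orbit L c (x - L.ω₁.re / 3) = (1 - orbit L c x - (L.derivWeierstrassP (L.midline x)).re /
        (1 / 12 - (L.weierstrassP (L.midline x)).re)) / 2 := by
  obtain ⟨h1, h2, h3⟩ := h.thirdPeriod_values hc
  rw [← ofReal_third h] at h1 h2 h3
  have := h.orbit_add_flex_aux hc (.inr rfl) h1 h2 h3 x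
  rwa [neg_one_mul, neg_one_mul, neg_div, ← sub_eq_add_neg, ← sub_eq_add_neg] at this

lemma HasPeriods.orbit_sum (h : HasPeriods L c) (hc : 0 < c) (x : ℝ) :
    orbit L c (x - L.ω₁.re / 3) + orbit L c x + orbit L c (x + L.ω₁.re / 3) = 1 := by
  rw [h.orbit_add_third hc, h.orbit_sub_third hc]
  ring

lemma hasDerivAt_midline (L : PeriodPair) (x : ℝ) : HasDerivAt L.midline 1 x := by
  unfold midline
  simpa using! (Complex.ofRealCLM.hasDerivAt (x := x)).const_add (L.ω₂ / 2)

/-- The derivative of `c / w` is `(c / w)(℘' / w)`, and `℘' / w` is the difference of the two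
translates. -/
lemma HasPeriods.hasDerivAt_orbit (h : HasPeriods L c) (hc : 0 < c) (x : ℝ) :
    HasDerivAt (orbit L c)
      (orbit L c x * (orbit L c (x + L.ω₁.re / 3) - orbit L c (x - L.ω₁.re / 3))) x := by
  have h1 : HasDerivAt (fun x ↦ L.weierstrassP (L.midline x))
      (L.derivWeierstrassP (L.midline x) * 1) x :=
    (L.hasDerivAt_weierstrassP (h.isRectangular.midline_notMem x)).comp x (hasDerivAt_midline L x)
  have h2 : HasDerivAt (fun x ↦ (L.weierstrassP (L.midline x)).re)
      (L.derivWeierstrassP (L.midline x) * 1).re x :=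
    Complex.reCLM.hasFDerivAt.comp_hasDerivAt x h1
  have hw := (h.gap_pos hc x).ne'
  have h3 := (hasDerivAt_const x c).div (h2.const_sub (1 / 12)) hw
  convert! h3 using 1
  rw [h.orbit_add_third hc, h.orbit_sub_third hc, orbit, mul_one]
  generalize 1 / 12 - (L.weierstrassP (L.midline x)).re = w at *
  field_simp
  ring

/-- Every point of the level set `y¹y²y³ = c` lies on the orbit. -/
lemma HasPeriods.exists_orbit_eq (h : HasPeriods L c) (hc : 0 < c) {y₁ y₂ y₃ : ℝ} (h1 : 0 < y₁)
    (h2 : 0 < y₂) (h3 : 0 < y₃) (hsum : y₁ + y₂ + y₃ = 1) (hprod : y₁ * y₂ * y₃ = c) :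
    ∃ x, orbit L c (x + L.ω₁.re / 3) = y₁ ∧ orbit L c (x - L.ω₁.re / 3) = y₂ ∧
      orbit L c x = y₃ := by
  have hL := h.isRectangular
  have ha := hL.ω₁_re_pos
  set w := c / y₃ with hw
  have hwc : c < w := by
    rw [hw, lt_div_iff₀ h3]
    nlinarith
  have hwy : w * y₃ = c := div_mul_cancel₀ c h3.ne'
  have hwprod : y₁ * y₂ = w := by
    apply mul_right_cancel₀ h3.ne'
    rw [hprod, hwy]
  -- Here `w = y₁y₂`, and the identity says that `℘ = 1/12 - w`, `℘' = w(y₁ - y₂)` is a point of the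
  -- curve.
  have hv : (w * (y₁ - y₂)) ^ 2 = (w - c) ^ 2 - 4 * w ^ 3 := by
    have e1 : w - c = w * (y₁ + y₂) := by
      rw [← hwy, show y₁ + y₂ = 1 - y₃ by linarith]
      ring
    rw [e1]
    linear_combination -4 * w ^ 2 * hwprod
  have hcub := h.cubic_eq (1 / 12 - w)
  have hnn : 0 ≤ (1 / 12 - w - L.halfPeriodValue 0) * ((1 / 12 - w - L.halfPeriodValue 1) *
      (1 / 12 - w - L.halfPeriodValue 2)) := by
    have : 0 ≤ (w * (y₁ - y₂)) ^ 2 := sq_nonneg _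
    rw [hv] at this
    rw [sub_sub_cancel] at hcub
    linarith
  have hlt : 1 / 12 - w - L.halfPeriodValue 0 < 0 := by
    linarith [h.sub_halfPeriodValue_zero_lt hc]
  -- Below the largest root a nonnegative cubic forces `1/12 - w` between the other two roots, which
  -- are the values of `℘` at `midline 0` and `midline (ω₁/2)`.
  have hle : (1 / 12 - w - L.halfPeriodValue 1) * (1 / 12 - w - L.halfPeriodValue 2) ≤ 0 := by
    by_contra! hcon
    exact absurd hnn (not_le.mpr (mul_neg_of_neg_of_pos hlt hcon))
  have hcont : ContinuousOn (fun x ↦ (L.weierstrassP (L.midline x)).re) (uIcc 0 (L.ω₁.re / 2)) := by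
    intro x _
    have h1 : ContinuousAt (fun x ↦ L.weierstrassP (L.midline x)) x :=
      ((L.hasDerivAt_weierstrassP (hL.midline_notMem x)).comp x
        (hasDerivAt_midline L x)).continuousAt
    exact (Complex.continuous_re.continuousAt.comp h1).continuousWithinAt
  have hmem : 1 / 12 - w ∈ uIcc (L.weierstrassP (L.midline 0)).re
      (L.weierstrassP (L.midline (L.ω₁.re / 2))).re := by
    change 1 / 12 - w ∈ uIcc (L.halfPeriodValue 2) (L.halfPeriodValue 1)
    rw [mem_uIcc]
    rcases mul_nonpos_iff.mp hle with h' | h'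
    · exact .inr ⟨by linarith, by linarith⟩
    · exact .inl ⟨by linarith, by linarith⟩
  obtain ⟨x₀, -, hx₀⟩ := intermediate_value_uIcc hcont hmem
  -- The curve determines `℘'` up to sign; replacing `x₀` by `-x₀` keeps `℘` and flips `℘'`.
  have hex : ∃ x, (L.weierstrassP (L.midline x)).re = 1 / 12 - w ∧
      (L.derivWeierstrassP (L.midline x)).re = w * (y₁ - y₂) := by
    have hs := h.slope_sq x₀
    simp only at hx₀
    rw [hx₀, sub_sub_cancel, ← hv, sq_eq_sq_iff_eq_or_eq_neg] at hs
    rcases hs with hs | hs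
    · exact ⟨x₀, hx₀, hs⟩
    · have hm : L.midline (-x₀) = -L.midline x₀ + L.ω₂ := by
        simp only [midline]
        push_cast
        ring
      refine ⟨-x₀, ?_, ?_⟩
      · rw [hm, L.weierstrassP_add_coe _ ⟨_, L.ω₂_mem_lattice⟩, weierstrassP_neg, hx₀]
      · rw [hm, L.derivWeierstrassP_add_coe _ ⟨_, L.ω₂_mem_lattice⟩, derivWeierstrassP_neg,
          Complex.neg_re, hs, neg_neg]
  obtain ⟨x, hx1, hx2⟩ := hex
  have hw0 : w ≠ 0 := (hc.trans hwc).ne'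
  have hx3 : orbit L c x = y₃ := by
    rw [orbit, hx1, sub_sub_cancel, ← hwy, mul_div_cancel_left₀ _ hw0]
  refine ⟨x, ?_, ?_, hx3⟩
  · rw [h.orbit_add_third hc, hx3, hx1, hx2, sub_sub_cancel, mul_div_cancel_left₀ _ hw0]
    linarith
  · rw [h.orbit_sub_third hc, hx3, hx1, hx2, sub_sub_cancel, mul_div_cancel_left₀ _ hw0]
    linarith

/-- The zeta addition theorem with `a = -f`, where `℘(f) = 1/12` and `℘'(f) = -c`, has right side
`½(c - ℘')/w` apart from zeta values, matching the formula for the translate. -/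
lemma HasPeriods.orbit_add_third_eq_zeta (h : HasPeriods L c) (hc : 0 < c) (x : ℝ) :
    (orbit L c (x + L.ω₁.re / 3) : ℂ) = L.weierstrassZeta (L.midline x) -
      L.weierstrassZeta (L.midline x - thirdPeriod L) +
      (1 / 2 - L.weierstrassZeta (thirdPeriod L)) := by
  have hL := h.isRectangular
  obtain ⟨h1, h2, h3⟩ := h.thirdPeriod_values hc
  have hp : L.midline x + thirdPeriod L ∉ L.lattice := by
    rw [← ofReal_third h, ← midline_add]; exact hL.midline_notMem _
  have hm : L.midline x - thirdPeriod L ∉ L.lattice := by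
    rw [← ofReal_third h, ← midline_sub]; exact hL.midline_notMem _
  have hadd := L.weierstrassZeta_add (a := -thirdPeriod L) (z := L.midline x)
    (fun h' ↦ h1 (by simpa using neg_mem h')) (hL.midline_notMem x)
    (by rwa [← sub_eq_add_neg]) (by rwa [sub_neg_eq_add])
  rw [← sub_eq_add_neg, weierstrassZeta_neg, weierstrassP_neg, derivWeierstrassP_neg, h2, h3]
    at hadd
  have hw := (h.gap_pos hc x).ne'
  rw [hadd, h.orbit_add_third hc, orbit]
  have hw' : (1 / 12 - L.weierstrassP (L.midline x)) ≠ 0 := by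
    have := Complex.ofReal_ne_zero.mpr hw
    push_cast at this
    rwa [hL.ofReal_weierstrassP_midline] at this
  push_cast
  rw [hL.ofReal_weierstrassP_midline, hL.ofReal_derivWeierstrassP_midline]
  rw [show 2 * (L.weierstrassP (L.midline x) - 1 / 12) =
    -(2 * (1 / 12 - L.weierstrassP (L.midline x))) by ring]
  generalize L.weierstrassP (L.midline x) = P at *
  generalize (1 / 12 : ℂ) - P = w at *
  field_simp
  ring

lemma HasPeriods.orbit_sub_third_eq_zeta (h : HasPeriods L c) (hc : 0 < c) (x : ℝ) :
    (orbit L c (x - L.ω₁.re / 3) : ℂ) = L.weierstrassZeta (L.midline x + thirdPeriod L) -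
      L.weierstrassZeta (L.midline x) + (1 / 2 - L.weierstrassZeta (thirdPeriod L)) := by
  have hL := h.isRectangular
  obtain ⟨h1, h2, h3⟩ := h.thirdPeriod_values hc
  have hp : L.midline x + thirdPeriod L ∉ L.lattice := by
    rw [← ofReal_third h, ← midline_add]; exact hL.midline_notMem _
  have hm : L.midline x - thirdPeriod L ∉ L.lattice := by
    rw [← ofReal_third h, ← midline_sub]; exact hL.midline_notMem _
  have hadd := L.weierstrassZeta_add h1 (hL.midline_notMem x) hp hm
  rw [h2, h3] at hadd
  have hw := (h.gap_pos hc x).ne'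
  rw [hadd, h.orbit_sub_third hc, orbit]
  have hw' : (1 / 12 - L.weierstrassP (L.midline x)) ≠ 0 := by
    have := Complex.ofReal_ne_zero.mpr hw
    push_cast at this
    rwa [hL.ofReal_weierstrassP_midline] at this
  push_cast
  rw [hL.ofReal_weierstrassP_midline, hL.ofReal_derivWeierstrassP_midline]
  rw [show 2 * (L.weierstrassP (L.midline x) - 1 / 12) =
    -(2 * (1 / 12 - L.weierstrassP (L.midline x))) by ring]
  generalize L.weierstrassP (L.midline x) = P at *
  generalize (1 / 12 : ℂ) - P = w at *
  field_simp
  ring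

/-! ### The coordinates `(c₃, s)` -/

lemma ellipticTime_eq_midline (h : HasPeriods L c) (s : ℝ) :
    ellipticTime L s = L.midline (L.ω₁.re / 2 / Real.pi * s) := by
  rw [ellipticTime, midline, h.isRectangular.ω₁_eq]
  push_cast
  rw [Complex.ofReal_re]

/-- The index `k` of `Fin 3` stands for `k + 1` thirds of the real period; two thirds agree with
minus one third, and three thirds with no shift. -/
lemma hasAngle_iff {p : Coord} (h : HasPeriods L (cThree p)) {s x : ℝ}
    (hs : ellipticTime L s = L.midline x) :
    HasAngle L p s ↔ bary p 0 = orbit L (cThree p) (x + L.ω₁.re / 3) ∧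
      bary p 1 = orbit L (cThree p) (x - L.ω₁.re / 3) ∧ bary p 2 = orbit L (cThree p) x := by
  have hx : L.ω₁.re / 2 / Real.pi * s = x := by
    rw [ellipticTime_eq_midline h, midline, midline] at hs
    exact_mod_cast add_left_cancel hs
  have key : ∀ k : Fin 3, L.midline (L.ω₁.re / 2 / Real.pi *
      (s + 2 * Real.pi * ((k : ℕ) + 1) / 3)) = L.midline (x + ((k : ℕ) + 1) * (L.ω₁.re / 3)) := by
    intro k
    rw [← hx]
    congr 1
    field_simp [Real.pi_ne_zero]
  have h1 : orbit L (cThree p) (x + 2 * (L.ω₁.re / 3)) =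
      orbit L (cThree p) (x - L.ω₁.re / 3) := by
    rw [← h.orbit_add_period (x - L.ω₁.re / 3)]
    congr 1
    ring
  have h2 : orbit L (cThree p) (x + 3 * (L.ω₁.re / 3)) = orbit L (cThree p) x := by
    rw [← h.orbit_add_period x]
    congr 1
    ring
  rw [HasAngle, ← h1, ← h2]
  simp only [ellipticTime_eq_midline h, key, ← h.ofReal_orbit, Complex.ofReal_inj, Fin.forall_fin_succ]
  norm_num

end ToricCP2

namespace PeriodPair

open Filter Topology

/-! ### Rectangular lattices with given invariants -/

/-- The rectangular lattice with periods `a` and `b i`. -/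
noncomputable def rect {a b : ℝ} (ha : 0 < a) (hb : 0 < b) : PeriodPair where
  ω₁ := a
  ω₂ := b * Complex.I
  indep := by
    rw [LinearIndependent.pair_iff]
    intro s t h
    have h1 := congrArg Complex.re h
    have h2 := congrArg Complex.im h
    simp at h1 h2
    exact ⟨h1.resolve_right ha.ne', h2.resolve_right hb.ne'⟩

lemma isRectangular_rect {a b : ℝ} (ha : 0 < a) (hb : 0 < b) : (rect ha hb).IsRectangular := by
  constructor <;> simp [rect, ha, hb]

/-- The Eisenstein sum of the lattice with periods `1` and `t i`. -/
noncomputable def eisensteinSum (k : ℕ) (t : ℝ) : ℂ :=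
  ∑' x : ℤ × ℤ, (((x.1 : ℂ) + x.2 * (t * Complex.I)) ^ k)⁻¹

lemma G_eq_tsum (L : PeriodPair) (k : ℕ) :
    L.G k = ∑' x : ℤ × ℤ, ((x.1 * L.ω₁ + x.2 * L.ω₂) ^ k)⁻¹ := by
  rw [G, ← L.latticeEquivProd.symm.toEquiv.tsum_eq]
  congr with x
  exact congrArg (fun z ↦ (z ^ k)⁻¹) (L.latticeEquiv_symm_apply x)

lemma G_rect {s t : ℝ} (hs : 0 < s) (ht : 0 < s * t) (k : ℕ) :
    (rect hs ht).G k = ((s : ℂ) ^ k)⁻¹ * eisensteinSum k t := by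
  rw [G_eq_tsum, eisensteinSum, ← tsum_mul_left]
  congr with x
  rw [← mul_inv, ← mul_pow]
  congr 2
  simp only [rect]
  push_cast
  ring

/-- Multiplication by `s i` carries the lattice of `1` and `t i` onto this one. The factor `i⁶ = -1`
later produces negative `g₃`. -/
lemma G_rect_swap {s t : ℝ} (hs : 0 < s) (ht : 0 < s * t) (k : ℕ) :
    (rect ht hs).G k = (((s : ℂ) * Complex.I) ^ k)⁻¹ * eisensteinSum k t := by
  rw [G_eq_tsum, eisensteinSum, ← tsum_mul_left,
    ← ((Equiv.prodComm ℤ ℤ).trans ((Equiv.neg ℤ).prodCongr (Equiv.refl ℤ))).tsum_eq]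
  refine tsum_congr fun x ↦ ?_
  rw [← mul_inv, ← mul_pow]
  simp only [rect, Equiv.trans_apply, Equiv.prodCongr_apply, Equiv.prodComm_apply, Prod.map,
    Equiv.neg_apply, Equiv.refl_apply, Prod.swap]
  congr 2
  push_cast
  linear_combination (-(x.2 : ℂ) * s * t) * Complex.I_mul_I

lemma summable_eisenstein_bound {k : ℕ} (hk : 2 < k) :
    Summable fun x : ℤ × ℤ ↦ ‖(((x.1 : ℂ) + x.2 * Complex.I) ^ k)⁻¹‖ := by
  set L := rect one_pos one_pos with hL
  have h := ZLattice.summable_norm_rpow L.lattice (-(k : ℝ)) (by simp; exact_mod_cast hk)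
  rw [← L.latticeEquivProd.symm.toEquiv.summable_iff] at h
  refine h.congr fun x ↦ ?_
  have e : (L.latticeEquivProd.symm x : ℂ) = (x.1 : ℂ) + x.2 * Complex.I := by
    rw [L.latticeEquiv_symm_apply, hL, rect]
    simp
  rw [norm_inv, norm_pow, ← e, Function.comp_apply, Real.rpow_neg (norm_nonneg _),
    Real.rpow_natCast]
  rfl

lemma normSq_add_mul_I (x : ℤ × ℤ) (t : ℝ) :
    ‖(x.1 : ℂ) + x.2 * (t * Complex.I)‖ ^ 2 = (x.1 : ℝ) ^ 2 + ((x.2 : ℝ) * t) ^ 2 := by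
  rw [show (x.1 : ℂ) + x.2 * (t * Complex.I) = ((x.1 : ℝ) : ℂ) + ((x.2 * t : ℝ) : ℂ) * Complex.I by
    push_cast; ring, ← Complex.normSq_eq_norm_sq, Complex.normSq_add_mul_I]

lemma norm_eisenstein_le {k : ℕ} {t : ℝ} (ht : 1 ≤ t) (x : ℤ × ℤ) :
    ‖(((x.1 : ℂ) + x.2 * (t * Complex.I)) ^ k)⁻¹‖ ≤
      ‖(((x.1 : ℂ) + x.2 * Complex.I) ^ k)⁻¹‖ := by
  by_cases hx : x = 0
  · simp [hx]
  have h1 := normSq_add_mul_I x 1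
  have h2 := normSq_add_mul_I x t
  rw [Complex.ofReal_one, one_mul, mul_one] at h1
  have hle : (x.2 : ℝ) ^ 2 ≤ ((x.2 : ℝ) * t) ^ 2 := by
    rw [mul_pow]
    exact le_mul_of_one_le_right (sq_nonneg _) (one_le_pow₀ ht)
  have hpos : 0 < ‖(x.1 : ℂ) + x.2 * Complex.I‖ := by
    refine (norm_nonneg _).lt_of_ne fun h ↦ ?_
    rw [← h] at h1
    refine (show (0 : ℝ) < (x.1 : ℝ) ^ 2 + (x.2 : ℝ) ^ 2 from ?_).ne' (by rw [← h1]; norm_num)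
    have : x.1 ≠ 0 ∨ x.2 ≠ 0 := by
      by_contra! h
      exact hx (Prod.ext h.1 h.2)
    rcases this with h | h
    · have : (x.1 : ℝ) ≠ 0 := by exact_mod_cast h
      positivity
    · have : (x.2 : ℝ) ≠ 0 := by exact_mod_cast h
      positivity
  rw [norm_inv, norm_inv, norm_pow, norm_pow]
  have : ‖(x.1 : ℂ) + x.2 * Complex.I‖ ≤ ‖(x.1 : ℂ) + x.2 * (t * Complex.I)‖ := by
    refine (sq_le_sq₀ (norm_nonneg _) (norm_nonneg _)).mp ?_
    rw [h1, h2]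
    linarith
  gcongr

lemma continuousOn_eisensteinSum {k : ℕ} (hk : 2 < k) :
    ContinuousOn (eisensteinSum k) (Ici 1) := by
  refine continuousOn_tsum (fun x ↦ ?_) (summable_eisenstein_bound hk)
    (fun x t ht ↦ norm_eisenstein_le ht x)
  by_cases hx : x = 0
  · simp only [hx, Prod.fst_zero, Prod.snd_zero, Int.cast_zero, zero_mul, add_zero]
    exact continuousOn_const
  · refine ContinuousOn.inv₀ (by fun_prop) fun t ht ↦ pow_ne_zero _ fun h ↦ hx ?_
    have h2 := normSq_add_mul_I x t
    rw [h, norm_zero] at h2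
    have ht' : (0 : ℝ) < t := one_pos.trans_le ht
    have h3 : (x.1 : ℝ) = 0 := by nlinarith [sq_nonneg (x.1 : ℝ), sq_nonneg ((x.2 : ℝ) * t)]
    have h4 : (x.2 : ℝ) * t = 0 := by nlinarith [sq_nonneg (x.1 : ℝ), sq_nonneg ((x.2 : ℝ) * t)]
    have h5 := (mul_eq_zero.mp h4).resolve_right ht'.ne'
    exact Prod.ext (by exact_mod_cast h3) (by exact_mod_cast h5)

/-- Lattice points off the real axis escape to infinity; dominated convergence, with the square
lattice as majorant, leaves the sum over the integers. -/
lemma tendsto_eisensteinSum {k : ℕ} (hk : 2 < k) (hk2 : Even k) :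
    Tendsto (eisensteinSum k) atTop (𝓝 (2 * riemannZeta k)) := by
  have hlim : ∑' x : ℤ × ℤ, (if x.2 = 0 then ((x.1 : ℂ) ^ k)⁻¹ else 0) = 2 * riemannZeta k := by
    rw [two_mul_riemannZeta_eq_tsum_int_inv_pow_of_even (by omega) hk2]
    have hinj : Function.Injective fun m : ℤ ↦ (m, (0 : ℤ)) := fun a b h ↦ congrArg Prod.fst h
    rw [← hinj.tsum_eq]
    · simp
    · intro x hx
      have : x.2 = 0 := by
        by_contra h
        simp [h] at hx
      exact ⟨x.1, Prod.ext rfl this.symm⟩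
  rw [← hlim]
  refine tendsto_tsum_of_dominated_convergence (summable_eisenstein_bound hk) (fun x ↦ ?_) ?_
  · split_ifs with hx
    · simp only [hx, Int.cast_zero, zero_mul, add_zero]
      exact tendsto_const_nhds
    · have hx' : (x.2 : ℝ) ≠ 0 := by exact_mod_cast hx
      have h1 : Tendsto (fun t : ℝ ↦ ‖(x.1 : ℂ) + x.2 * (t * Complex.I)‖) atTop atTop := by
        refine tendsto_atTop_mono (f := fun t : ℝ ↦ |(x.2 : ℝ)| * t) (fun t ↦ ?_)
          (tendsto_id.const_mul_atTop (abs_pos.mpr hx'))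
        refine le_trans (le_abs_self _) ?_
        rw [abs_mul, abs_abs, ← abs_mul]
        refine abs_le_of_sq_le_sq ?_ (norm_nonneg _)
        rw [normSq_add_mul_I]
        nlinarith [sq_nonneg (x.1 : ℝ)]
      rw [tendsto_zero_iff_norm_tendsto_zero]
      simp only [norm_inv, norm_pow]
      exact ((tendsto_pow_atTop (by omega)).comp h1).inv_tendsto_atTop
  · filter_upwards [eventually_ge_atTop 1] with t ht x
    exact norm_eisenstein_le ht x

lemma riemannZeta_six : riemannZeta 6 = (Real.pi : ℂ) ^ 6 / 945 := by
  have h := riemannZeta_two_mul_nat (k := 3) (by norm_num)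
  have hb : bernoulli 6 = 1 / 42 := by
    rw [bernoulli_eq_bernoulli'_of_ne_one (by norm_num), bernoulli'_def]
    have h5 : bernoulli' 5 = 0 := by
      rw [bernoulli'_def]
      norm_num [Finset.sum_range_succ, show Nat.choose 5 2 = 10 by rfl,
        show Nat.choose 5 4 = 5 by rfl, show Nat.choose 5 3 = 10 by rfl]
    norm_num [Finset.sum_range_succ, h5, show Nat.choose 6 2 = 15 by rfl,
      show Nat.choose 6 4 = 15 by rfl, show Nat.choose 6 3 = 20 by rfl]
  norm_num [hb, Nat.factorial] at h
  rw [h]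
  ring

lemma riemannZeta_four_mul : 60 * (2 * riemannZeta (4 : ℕ)) = ((4 * Real.pi ^ 4 / 3 : ℝ) : ℂ) := by
  rw [Nat.cast_ofNat, riemannZeta_four]
  push_cast
  ring

lemma riemannZeta_six_mul :
    140 * (2 * riemannZeta (6 : ℕ)) = ((8 * Real.pi ^ 6 / 27 : ℝ) : ℂ) := by
  rw [Nat.cast_ofNat, riemannZeta_six]
  push_cast
  ring

/-- The square lattice is invariant under multiplication by `i`, while `i⁶ = -1`. -/
lemma eisensteinSum_six_one : eisensteinSum 6 1 = 0 := by
  have h1 := G_rect one_pos (t := 1) (by norm_num) 6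
  have h2 := G_rect_swap one_pos (t := 1) (by norm_num) 6
  have h3 : (rect one_pos (by norm_num : (0 : ℝ) < 1 * 1)) =
      rect (by norm_num : (0 : ℝ) < 1 * 1) one_pos := by
    simp only [rect, mul_one]
  rw [h3, h2] at h1
  have hI : (Complex.I ^ 6 : ℂ) = -1 := by
    rw [show 6 = 4 + 2 by norm_num, pow_add, Complex.I_pow_four, Complex.I_sq, one_mul]
  norm_num [hI] at h1
  exact self_eq_neg.mp h1.symm

/-- Intermediate values for `g₃ - ρ g₂^{3/2}`: at the square lattice `g₃ = 0`, and as `t → ∞` the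
ratio `g₃² / g₂³` tends to its degenerate value `1/27`. -/
lemma exists_eisenstein_ratio {ρ : ℝ} (h0 : 0 ≤ ρ) (h1 : ρ ^ 2 < 1 / 27) :
    ∃ t : ℝ, 1 ≤ t ∧ (140 * eisensteinSum 6 t).re = ρ * ((60 * eisensteinSum 4 t).re *
      √(60 * eisensteinSum 4 t).re) := by
  set g2 : ℝ → ℝ := fun t ↦ (60 * eisensteinSum 4 t).re with hg2
  set g3 : ℝ → ℝ := fun t ↦ (140 * eisensteinSum 6 t).re with hg3
  have hc2 : ContinuousOn g2 (Ici 1) := Complex.continuous_re.comp_continuousOn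
    (continuousOn_const.mul (continuousOn_eisensteinSum (by norm_num)))
  have hc3 : ContinuousOn g3 (Ici 1) := Complex.continuous_re.comp_continuousOn
    (continuousOn_const.mul (continuousOn_eisensteinSum (by norm_num)))
  have hl2 : Tendsto g2 atTop (𝓝 (4 * Real.pi ^ 4 / 3)) := by
    have := (tendsto_eisensteinSum (k := 4) (by norm_num) (by decide)).const_mul 60
    rw [riemannZeta_four_mul] at this
    exact (Complex.continuous_re.tendsto _).comp this
  have hl3 : Tendsto g3 atTop (𝓝 (8 * Real.pi ^ 6 / 27)) := by
    have := (tendsto_eisensteinSum (k := 6) (by norm_num) (by decide)).const_mul 140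
    rw [riemannZeta_six_mul] at this
    exact (Complex.continuous_re.tendsto _).comp this
  have hpos2 : 0 < 4 * Real.pi ^ 4 / 3 := by positivity
  have hlim : Tendsto (fun t ↦ g3 t - ρ * (g2 t * √(g2 t))) atTop (𝓝 (8 * Real.pi ^ 6 / 27 -
      ρ * (4 * Real.pi ^ 4 / 3 * √(4 * Real.pi ^ 4 / 3)))) :=
    hl3.sub ((hl2.mul ((Real.continuous_sqrt.tendsto _).comp hl2)).const_mul ρ)
  have hlimpos : 0 < 8 * Real.pi ^ 6 / 27 - ρ * (4 * Real.pi ^ 4 / 3 * √(4 * Real.pi ^ 4 / 3)) := by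
    rw [sub_pos]
    refine lt_of_pow_lt_pow_left₀ 2 (by positivity) ?_
    rw [mul_pow, mul_pow, Real.sq_sqrt hpos2.le]
    calc ρ ^ 2 * ((4 * Real.pi ^ 4 / 3) ^ 2 * (4 * Real.pi ^ 4 / 3))
        < 1 / 27 * ((4 * Real.pi ^ 4 / 3) ^ 2 * (4 * Real.pi ^ 4 / 3)) := by gcongr
      _ = (8 * Real.pi ^ 6 / 27) ^ 2 := by ring
  obtain ⟨M, hM1, hM⟩ := ((hlim.eventually (lt_mem_nhds hlimpos)).and
    (eventually_ge_atTop 1)).exists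
  have hsub : Icc 1 M ⊆ Ici 1 := fun t ht ↦ ht.1
  have hcont : ContinuousOn (fun t ↦ g3 t - ρ * (g2 t * √(g2 t))) (Icc 1 M) :=
    (hc3.mono hsub).sub (continuousOn_const.mul
      ((hc2.mono hsub).mul (Real.continuous_sqrt.comp_continuousOn (hc2.mono hsub))))
  have h3 : g3 1 = 0 := by simp [hg3, eisensteinSum_six_one]
  have hstart : g3 1 - ρ * (g2 1 * √(g2 1)) ≤ 0 := by
    rw [h3, zero_sub, neg_nonpos]
    -- The real square root of a nonpositive number is `0`, so the sign of `g₂` need not be known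
    -- here.
    rcases le_total 0 (g2 1) with h | h
    · positivity
    · rw [Real.sqrt_eq_zero'.mpr h]
      simp
  obtain ⟨t, ht, h⟩ := intermediate_value_Icc hM hcont ⟨hstart, hM1.le⟩
  exact ⟨t, ht.1, sub_eq_zero.mp h⟩

lemma exists_rect_invariants {A B : ℝ} (hA : 0 < A) (hB : 0 ≤ B) (h : 27 * B ^ 2 < A ^ 3) :
    ∃ (s t : ℝ) (_ : 0 < s) (_ : 0 < s * t),
      60 * ((s : ℂ) ^ 4)⁻¹ * eisensteinSum 4 t = A ∧
      140 * ((s : ℂ) ^ 6)⁻¹ * eisensteinSum 6 t = B := by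
  have hsA : 0 < √A := Real.sqrt_pos.mpr hA
  have hsA2 : √A ^ 2 = A := Real.sq_sqrt hA.le
  obtain ⟨t, ht1, ht⟩ := exists_eisenstein_ratio (ρ := B / (A * √A)) (by positivity) (by
    rw [div_pow, mul_pow, hsA2, div_lt_iff₀ (by positivity)]
    linarith)
  have ht0 : 0 < t := one_pos.trans_le ht1
  have hR := isRectangular_rect one_pos (by simpa using ht0 : (0 : ℝ) < 1 * t)
  have e2 : (rect one_pos (by simpa using ht0 : (0 : ℝ) < 1 * t)).g₂ = 60 * eisensteinSum 4 t := by
    rw [g₂, G_rect]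
    simp
  have e3 : (rect one_pos (by simpa using ht0 : (0 : ℝ) < 1 * t)).g₃ = 140 * eisensteinSum 6 t := by
    rw [g₃, G_rect]
    simp
  have r2 := hR.g₂_eq
  have r3 := hR.g₃_eq
  have p2 := hR.g₂_re_pos
  rw [e2] at r2 p2
  rw [e3] at r3
  set a := (60 * eisensteinSum 4 t).re with ha
  set b := (140 * eisensteinSum 6 t).re with hb
  have hq : 0 < a / A := by positivity
  -- Scaling by `s` divides `g₂` by `s⁴` and `g₃` by `s⁶`; this `s` corrects `g₂`, and the choice of
  -- `t` makes `g₃` correct as well.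
  set s := √√(a / A) with hs
  have hs0 : 0 < s := Real.sqrt_pos.mpr (Real.sqrt_pos.mpr hq)
  have hs2 : s ^ 2 = √(a / A) := Real.sq_sqrt (Real.sqrt_nonneg _)
  have hs4 : s ^ 4 * A = a := by
    rw [show s ^ 4 = (s ^ 2) ^ 2 by ring, hs2, Real.sq_sqrt hq.le, div_mul_cancel₀ _ hA.ne']
  have hs6 : s ^ 6 * B = b := by
    have h1 : √a = s ^ 2 * √A := by
      rw [hs2, ← Real.sqrt_mul hq.le, div_mul_cancel₀ _ hA.ne']
    rw [ht, h1, ← hs4]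
    field_simp
  have hsC : (s : ℂ) ≠ 0 := by exact_mod_cast hs0.ne'
  refine ⟨s, t, hs0, by positivity, ?_, ?_⟩
  · rw [mul_comm (60 : ℂ), mul_assoc, ← r2, ← hs4]
    push_cast
    field_simp
  · rw [mul_comm (140 : ℂ), mul_assoc, ← r3, ← hs6]
    push_cast
    field_simp

/-- Real invariants with `27 g₃² < g₂³` and `0 < g₂` belong to a rectangular lattice. -/
theorem exists_isRectangular {A B : ℝ} (hA : 0 < A) (h : 27 * B ^ 2 < A ^ 3) :
    ∃ L : PeriodPair, L.IsRectangular ∧ L.g₂ = A ∧ L.g₃ = B := by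
  rcases le_total 0 B with hB | hB
  · obtain ⟨s, t, hs, ht, h2, h3⟩ := exists_rect_invariants hA hB h
    refine ⟨rect hs ht, isRectangular_rect hs ht, ?_, ?_⟩
    · rw [g₂, G_rect, ← mul_assoc, h2]
    · rw [g₃, G_rect, ← mul_assoc, h3]
  · obtain ⟨s, t, hs, ht, h2, h3⟩ := exists_rect_invariants hA (neg_nonneg.mpr hB)
      (by rwa [neg_sq])
    have i4 : ((s : ℂ) * Complex.I) ^ 4 = (s : ℂ) ^ 4 := by
      rw [mul_pow, Complex.I_pow_four, mul_one]
    have i6 : ((s : ℂ) * Complex.I) ^ 6 = -(s : ℂ) ^ 6 := by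
      rw [mul_pow, show Complex.I ^ 6 = Complex.I ^ 4 * Complex.I ^ 2 by ring, Complex.I_pow_four,
        Complex.I_sq]
      ring
    refine ⟨rect ht hs, isRectangular_rect ht hs, ?_, ?_⟩
    · rw [g₂, G_rect_swap, ← mul_assoc, i4, h2]
    · rw [g₃, G_rect_swap, ← mul_assoc, i6, inv_neg, mul_neg, neg_mul, h3]
      push_cast
      ring

end PeriodPair

namespace ToricCP2

theorem exists_hasPeriods {c : ℝ} (hc : c ∈ Ioo 0 (1 / 27)) : ∃ L, HasPeriods L c := by
  obtain ⟨L, hL, h2, h3⟩ := PeriodPair.exists_isRectangular (A := 1 / 12 - 2 * c)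
    (B := c / 6 - 1 / 216 - c ^ 2) (by linarith [hc.2]) (by
      have : 0 < c ^ 3 * (1 - 27 * c) := mul_pos (pow_pos hc.1 3) (by linarith [hc.2])
      nlinarith)
  refine ⟨L, ⟨hL.ω₁_im, hL.ω₁_re_pos⟩, ⟨hL.ω₂_re, hL.ω₂_im_pos⟩, ?_, ?_⟩
  · rw [h2]; push_cast; ring
  · rw [h3]; push_cast; ring

end ToricCP2

/-! ### Differentiability of a flow in the initial value -/

section Variational

open Filter Topology

variable {E : Type*} [NormedAddCommGroup E] [NormedSpace ℝ E] [CompleteSpace E]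

/-- Short-time existence for the linear equation `Φ' = A Φ`. -/
lemma exists_fundamentalSolution {A : ℝ → E →L[ℝ] E} (hA : Continuous A) {K : NNReal}
    (hK : ∀ t, ‖A t‖ ≤ K) {T : ℝ} (hT : 0 ≤ T) (hKT : 2 * K * T ≤ 1) :
    ∃ Φ : ℝ → E →L[ℝ] E, Φ 0 = ContinuousLinearMap.id ℝ E ∧
      ∀ t ∈ Icc 0 T, HasDerivWithinAt Φ (A t ∘L Φ t) (Icc 0 T) t := by
  have hPL : IsPicardLindelof (fun t Φ ↦ A t ∘L Φ) (⟨0, le_refl 0, hT⟩ : Icc 0 T)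
      (ContinuousLinearMap.id ℝ E) 1 0 (2 * K) K := by
    refine ⟨fun t _ ↦ LipschitzOnWith.of_dist_le_mul fun Φ _ Ψ _ ↦ ?_, fun Φ _ ↦ ?_,
      fun t _ Φ hΦ ↦ ?_, ?_⟩
    · rw [dist_eq_norm, dist_eq_norm, ← ContinuousLinearMap.comp_sub]
      exact ((A t).opNorm_comp_le _).trans (mul_le_mul_of_nonneg_right (hK t) (norm_nonneg _))
    · exact (hA.clm_comp continuous_const).continuousOn
    · have h1 : ‖Φ‖ ≤ 2 := by
        have h2 := norm_le_norm_add_norm_sub' Φ (ContinuousLinearMap.id ℝ E)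
        rw [mem_closedBall_iff_norm] at hΦ
        have h3 := ContinuousLinearMap.norm_id_le (𝕜 := ℝ) (E := E)
        push_cast at hΦ
        linarith
      calc ‖A t ∘L Φ‖ ≤ ‖A t‖ * ‖Φ‖ := (A t).opNorm_comp_le _
        _ ≤ K * 2 := mul_le_mul (hK t) h1 (norm_nonneg _) K.2
        _ = ((2 * K : NNReal) : ℝ) := by push_cast; ring
    · have : max (T - 0) (0 - 0) = T := by simp [hT]
      push_cast
      rw [this]
      linarith
  exact hPL.exists_eq_forall_mem_Icc_hasDerivWithinAt₀

/-- The flow of `v` is differentiable for short times, and its differential solves the linearised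
equation. -/
theorem exists_hasFDerivAt_flow {v : E → E} {v' : E → E →L[ℝ] E} {S : Set E} (hS : IsOpen S)
    {K : NNReal} {C : ℝ} (hC : 0 ≤ C) (hv' : ContinuousOn v' S) (hK : ∀ x ∈ S, ‖v' x‖ ≤ K)
    (hK0 : 0 < K) (hlip : LipschitzOnWith K v S)
    (hv : ∀ x ∈ S, ∀ y ∈ S, ‖v y - v x - v' x (y - x)‖ ≤ C * ‖y - x‖ ^ 2)
    {ψ : ℝ → E → E} (hψ0 : ∀ x ∈ S, ψ 0 x = x) (hψS : ∀ x ∈ S, ∀ t, ψ t x ∈ S)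
    (hψ : ∀ x ∈ S, ∀ t, HasDerivAt (fun τ ↦ ψ τ x) (v (ψ t x)) t)
    {T : ℝ} (hT : 0 ≤ T) (hKT : 2 * K * T ≤ 1) {x : E} (hx : x ∈ S) :
    ∃ Φ : ℝ → E →L[ℝ] E, Φ 0 = ContinuousLinearMap.id ℝ E ∧
      (∀ t ∈ Icc 0 T, HasDerivWithinAt Φ (v' (ψ t x) ∘L Φ t) (Icc 0 T) t) ∧
      ∀ t ∈ Icc 0 T, HasFDerivAt (ψ t) (Φ t) x := by
  have hcont : ∀ y ∈ S, Continuous fun τ ↦ ψ τ y := fun y hy ↦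
    continuous_iff_continuousAt.mpr fun t ↦ (hψ y hy t).continuousAt
  obtain ⟨Φ, hΦ0, hΦ⟩ := exists_fundamentalSolution (A := fun t ↦ v' (ψ t x))
    (hv'.comp_continuous (hcont x hx) (hψS x hx)) (fun t ↦ hK _ (hψS x hx t)) hT hKT
  refine ⟨Φ, hΦ0, hΦ, fun t ht ↦ ?_⟩
  have hdist : ∀ y ∈ S, ∀ τ ∈ Icc 0 T, ‖ψ τ y - ψ τ x‖ ≤ ‖y - x‖ * Real.exp (K * T) := by
    intro y hy τ hτ
    have := dist_le_of_trajectories_ODE_of_mem (v := fun _ ↦ v) (s := fun _ ↦ S) (K := K)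
      (f := fun τ ↦ ψ τ y) (g := fun τ ↦ ψ τ x) (a := 0) (b := T) (δ := ‖y - x‖)
      (fun _ _ ↦ hlip) (hcont y hy).continuousOn (fun s _ ↦ (hψ y hy s).hasDerivWithinAt)
      (fun s _ ↦ hψS y hy s) (hcont x hx).continuousOn
      (fun s _ ↦ (hψ x hx s).hasDerivWithinAt) (fun s _ ↦ hψS x hx s)
      (by rw [hψ0 y hy, hψ0 x hx, dist_eq_norm]) τ hτ
    rw [dist_eq_norm, sub_zero] at this
    refine this.trans (mul_le_mul_of_nonneg_left (Real.exp_le_exp.mpr ?_) (norm_nonneg _))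
    exact mul_le_mul_of_nonneg_left hτ.2 K.2
  -- The remainder starts at zero and obeys the linearised equation up to the Taylor error of `v`,
  -- which `hdist` bounds quadratically in `‖y - x‖`. Grönwall's inequality keeps it quadratic.
  have hbound : ∀ y ∈ S, ‖ψ t y - ψ t x - Φ t (y - x)‖ ≤
      (C * Real.exp (K * T) ^ 2 / K * (Real.exp (K * t) - 1)) * ‖y - x‖ ^ 2 := by
    intro y hy
    have hder : ∀ τ ∈ Icc 0 T, HasDerivWithinAt (fun τ ↦ ψ τ y - ψ τ x - Φ τ (y - x))
        (v (ψ τ y) - v (ψ τ x) - (v' (ψ τ x) ∘L Φ τ) (y - x)) (Icc 0 T) τ := fun τ hτ ↦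
      ((hψ y hy τ).hasDerivWithinAt.sub (hψ x hx τ).hasDerivWithinAt).sub
        (by simpa using (hΦ τ hτ).clm_apply (hasDerivWithinAt_const τ (Icc 0 T) (y - x)))
    have := norm_le_gronwallBound_of_norm_deriv_right_le
      (f := fun τ ↦ ψ τ y - ψ τ x - Φ τ (y - x)) (δ := 0) (K := K)
      (ε := C * (‖y - x‖ * Real.exp (K * T)) ^ 2)
      (f' := fun τ ↦ v (ψ τ y) - v (ψ τ x) - (v' (ψ τ x) ∘L Φ τ) (y - x)) (a := 0) (b := T)
      (fun τ hτ ↦ (hder τ hτ).continuousWithinAt)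
      (fun τ hτ ↦ (hder τ ⟨hτ.1, hτ.2.le⟩).mono_of_mem_nhdsWithin (Icc_mem_nhdsGE_of_mem hτ))
      (by simp [hψ0 y hy, hψ0 x hx, hΦ0])
      (fun τ hτ ↦ by
        have h1 := hv _ (hψS x hx τ) _ (hψS y hy τ)
        have h2 := (v' (ψ τ x)).le_of_opNorm_le (hK _ (hψS x hx τ))
          (ψ τ y - ψ τ x - Φ τ (y - x))
        have h3 := pow_le_pow_left₀ (norm_nonneg _) (hdist y hy τ ⟨hτ.1, hτ.2.le⟩) 2
        have h4 : v (ψ τ y) - v (ψ τ x) - (v' (ψ τ x) ∘L Φ τ) (y - x) =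
            v' (ψ τ x) (ψ τ y - ψ τ x - Φ τ (y - x)) +
              (v (ψ τ y) - v (ψ τ x) - v' (ψ τ x) (ψ τ y - ψ τ x)) := by
          rw [(v' (ψ τ x)).map_sub (ψ τ y - ψ τ x), ContinuousLinearMap.comp_apply]
          abel
        rw [h4]
        exact (norm_add_le _ _).trans
          (add_le_add h2 (h1.trans (mul_le_mul_of_nonneg_left h3 hC)))) t ht
    refine this.trans (le_of_eq ?_)
    rw [gronwallBound_of_K_ne_0 (by exact_mod_cast hK0.ne')]
    simp only [sub_zero, zero_mul, zero_add]
    ring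
  have hO : (fun y ↦ ψ t y - ψ t x - Φ t (y - x)) =O[𝓝 x] fun y ↦ ‖y - x‖ ^ 2 := by
    refine Asymptotics.IsBigO.of_bound
      (C * Real.exp (K * T) ^ 2 / K * (Real.exp (K * t) - 1)) ?_
    filter_upwards [hS.mem_nhds hx] with y hy
    rw [norm_pow, norm_norm]
    exact hbound y hy
  have hlin : HasFDerivAt (fun y ↦ Φ t (y - x)) (Φ t) x := by
    simpa only [map_sub] using (Φ t).hasFDerivAt.sub_const (Φ t x)
  have h1 := ((hO.hasFDerivAt (𝕜 := ℝ) one_lt_two).add hlin).add_const (ψ t x)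
  rw [zero_add] at h1
  exact h1.congr_of_eventuallyEq (Eventually.of_forall fun y ↦ by simp)

end Variational

namespace ToricCP2

/-! ### The Hamiltonian flow -/

lemma mem_interiorDomain {p : Coord} :
    p ∈ interiorDomain ↔ 0 < p.1 0 ∧ 0 < p.1 1 ∧ 0 < 1 - p.1 0 - p.1 1 := by
  simp [interiorDomain, bary, Fin.forall_fin_succ]

lemma isOpen_interiorDomain : IsOpen interiorDomain := by
  have : interiorDomain = {p : Coord | 0 < p.1 0} ∩ {p | 0 < p.1 1} ∩
      {p | 0 < 1 - p.1 0 - p.1 1} := by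
    ext p
    rw [mem_interiorDomain, ← and_assoc]
    rfl
  rw [this]
  exact ((isOpen_lt continuous_const (by fun_prop)).inter
    (isOpen_lt continuous_const (by fun_prop))).inter (isOpen_lt continuous_const (by fun_prop))

/-- The polynomial vector field `y¹(y² - y³) ∂_{y¹} + y²(y³ - y¹) ∂_{y²}`. -/
def volterraField (p : Coord) : Coord :=
  (![p.1 0 * (p.1 0 + 2 * p.1 1 - 1), p.1 1 * (1 - 2 * p.1 0 - p.1 1)], 0)

lemma cThree_pos {p : Coord} (hp : p ∈ interiorDomain) : 0 < cThree p :=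
  mul_pos (mul_pos (hp 0) (hp 1)) (hp 2)

lemma cThree_eq (p : Coord) : cThree p = p.1 0 * p.1 1 * (1 - p.1 0 - p.1 1) := by
  simp [cThree, bary]

/-- The coordinate covectors `dy¹, dy²`. -/
noncomputable def dY (i : Fin 2) : Coord →L[ℝ] ℝ :=
  (ContinuousLinearMap.proj i).comp (ContinuousLinearMap.fst ℝ (Fin 2 → ℝ) (Fin 2 → ℝ))

@[simp] lemma dY_apply (i : Fin 2) (v : Coord) : dY i v = v.1 i := rfl

@[simp] lemma dTheta_apply (i : Fin 2) (v : Coord) : dTheta i v = v.2 i := rfl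

lemma hasFDerivAt_fst_apply (i : Fin 2) (p : Coord) :
    HasFDerivAt (fun q : Coord ↦ q.1 i) (dY i) p := (dY i).hasFDerivAt

lemma hasFDerivAt_bary_two (p : Coord) :
    HasFDerivAt (fun q : Coord ↦ 1 - q.1 0 - q.1 1) (-dY 0 - dY 1) p :=
  ((hasFDerivAt_fst_apply 0 p).const_sub 1).sub (hasFDerivAt_fst_apply 1 p)

/-- The factor `4 c₃` of `Q` cancels the denominator of `dh = -dc₃ / (4 c₃)`, leaving a polynomial
field. -/
lemma hamiltonianField_eq {p : Coord} (hp : p ∈ interiorDomain) :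
    hamiltonianField p = volterraField p := by
  have hc := cThree_pos hp
  have h1 := (((hasFDerivAt_fst_apply 0 p).mul (hasFDerivAt_fst_apply 1 p)).mul
    (hasFDerivAt_bary_two p))
  have h2 : HasFDerivAt cThree _ p := h1.congr_of_eventuallyEq (Filter.Eventually.of_forall cThree_eq)
  have h3 : HasFDerivAt hamiltonian _ p := (h2.log hc.ne').const_mul (-(1 / 4))
  rw [hamiltonianField, h3.fderiv, hitchinQ, volterraField]
  ext i
  · fin_cases i <;> simp [partialY, partialTheta] <;> field_simp <;> ring
  · fin_cases i <;> simp [partialY, partialTheta]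

/-- The differential of `volterraField`. -/
noncomputable def volterraDeriv (p : Coord) : Coord →L[ℝ] Coord :=
  (ContinuousLinearMap.pi ![(p.1 0 + 2 * p.1 1 - 1) • dY 0 + p.1 0 • (dY 0 + (2 : ℝ) • dY 1),
    (1 - 2 * p.1 0 - p.1 1) • dY 1 - p.1 1 • ((2 : ℝ) • dY 0 + dY 1)]).prod 0

lemma volterraDeriv_apply (p v : Coord) : volterraDeriv p v =
    (![(p.1 0 + 2 * p.1 1 - 1) * v.1 0 + p.1 0 * (v.1 0 + 2 * v.1 1),
      (1 - 2 * p.1 0 - p.1 1) * v.1 1 - p.1 1 * (2 * v.1 0 + v.1 1)], 0) := by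
  refine Prod.ext ?_ rfl
  ext i
  fin_cases i <;> simp [volterraDeriv] <;> ring

lemma abs_fst_le (v : Coord) (i : Fin 2) : |v.1 i| ≤ ‖v‖ :=
  (norm_le_pi_norm v.1 i).trans (norm_fst_le v)

lemma norm_le_of_abs_le {a b M : ℝ} (ha : |a| ≤ M) (hb : |b| ≤ M) :
    ‖((![a, b], 0) : Coord)‖ ≤ M := by
  have hM : 0 ≤ M := (abs_nonneg a).trans ha
  refine max_le ((pi_norm_le_iff_of_nonneg hM).mpr fun i ↦ ?_) (by simpa using hM)
  fin_cases i
  · exact ha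
  · exact hb

lemma norm_volterraDeriv_le {p : Coord} (hp : p ∈ interiorDomain) : ‖volterraDeriv p‖ ≤ 5 := by
  refine ContinuousLinearMap.opNorm_le_bound _ (by norm_num) fun v ↦ ?_
  obtain ⟨h0, h1, h2⟩ := mem_interiorDomain.mp hp
  have a0 := abs_le.mp (abs_fst_le v 0)
  have a1 := abs_le.mp (abs_fst_le v 1)
  rw [volterraDeriv_apply]
  generalize ‖v‖ = M at *
  apply norm_le_of_abs_le
  · rw [abs_le]
    constructor <;> nlinarith
  · rw [abs_le]
    constructor <;> nlinarith

lemma volterraField_sub (p q : Coord) : volterraField q - volterraField p - volterraDeriv p (q - p) =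
    (![(q.1 0 - p.1 0) * (q.1 0 - p.1 0 + 2 * (q.1 1 - p.1 1)),
      -(q.1 1 - p.1 1) * (2 * (q.1 0 - p.1 0) + (q.1 1 - p.1 1))], 0) := by
  rw [volterraDeriv_apply, volterraField, volterraField]
  refine Prod.ext ?_ (by simp)
  ext i
  fin_cases i <;> simp <;> ring

lemma norm_volterraField_sub_le (p q : Coord) :
    ‖volterraField q - volterraField p - volterraDeriv p (q - p)‖ ≤ 3 * ‖q - p‖ ^ 2 := by
  rw [volterraField_sub]
  have a0 := abs_fst_le (q - p) 0
  have a1 := abs_fst_le (q - p) 1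
  simp only [Prod.fst_sub, Pi.sub_apply] at a0 a1
  generalize q.1 0 - p.1 0 = a at *
  generalize q.1 1 - p.1 1 = b at *
  have e : 3 * ‖q - p‖ ^ 2 = ‖q - p‖ * (3 * ‖q - p‖) := by ring
  have hn := norm_nonneg (q - p)
  rw [e]
  generalize ‖q - p‖ = M at *
  apply norm_le_of_abs_le
  · rw [abs_mul]
    refine mul_le_mul a0 ?_ (abs_nonneg _) hn
    rw [abs_le] at *
    constructor <;> linarith
  · rw [abs_mul, abs_neg]
    refine mul_le_mul a1 ?_ (abs_nonneg _) hn
    rw [abs_le] at *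
    constructor <;> linarith

/-- Exact because the field is quadratic. As the triangle is convex, the derivative bound becomes a
Lipschitz bound. -/
lemma volterraField_sub_eq_midpoint (p q : Coord) : volterraField q - volterraField p =
    volterraDeriv ((1 / 2 : ℝ) • (p + q)) (q - p) := by
  rw [volterraDeriv_apply, volterraField, volterraField]
  refine Prod.ext ?_ (by simp)
  ext i
  fin_cases i <;> simp <;> ring

lemma midpoint_mem_interiorDomain {p q : Coord} (hp : p ∈ interiorDomain)
    (hq : q ∈ interiorDomain) : (1 / 2 : ℝ) • (p + q) ∈ interiorDomain := by
  rw [mem_interiorDomain] at *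
  simp only [Prod.smul_fst, Prod.fst_add, Pi.smul_apply, Pi.add_apply, smul_eq_mul]
  refine ⟨?_, ?_, ?_⟩ <;> linarith

lemma lipschitzOnWith_volterraField : LipschitzOnWith 5 volterraField interiorDomain := by
  refine LipschitzOnWith.of_dist_le_mul fun q hq p hp ↦ ?_
  rw [dist_eq_norm, dist_eq_norm, volterraField_sub_eq_midpoint]
  exact ContinuousLinearMap.le_of_opNorm_le _
    (norm_volterraDeriv_le (midpoint_mem_interiorDomain hp hq)) _

lemma continuous_volterraDeriv : Continuous volterraDeriv := by
  refine continuous_clm_apply.mpr fun v ↦ ?_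
  simp only [volterraDeriv_apply]
  refine Continuous.prodMk (continuous_pi fun i ↦ ?_) continuous_const
  fin_cases i <;> simp <;> fun_prop

end ToricCP2

/-! ### Existence, symmetries and differentiability of the flow -/

namespace ToricCP2

/-- `γ` is an integral curve of the Hamiltonian field, defined for all times. -/
def IsOrbitCurve (γ : ℝ → Coord) : Prop :=
  ∀ t, HasDerivAt γ (volterraField (γ t)) t ∧ γ t ∈ interiorDomain

lemma IsOrbitCurve.eq_of_zero {γ₁ γ₂ : ℝ → Coord} (h₁ : IsOrbitCurve γ₁) (h₂ : IsOrbitCurve γ₂)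
    (h : γ₁ 0 = γ₂ 0) : γ₁ = γ₂ :=
  ODE_solution_unique_univ (v := fun _ ↦ volterraField) (s := fun _ ↦ interiorDomain)
    (fun _ ↦ lipschitzOnWith_volterraField) h₁ h₂ h

lemma IsOrbitCurve.comp_add {γ : ℝ → Coord} (h : IsOrbitCurve γ) (s : ℝ) :
    IsOrbitCurve fun t ↦ γ (t + s) :=
  fun t ↦ ⟨(h (t + s)).1.comp_add_const t s, (h (t + s)).2⟩

lemma IsOrbitCurve.add_snd {γ : ℝ → Coord} (h : IsOrbitCurve γ) (η : Fin 2 → ℝ) :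
    IsOrbitCurve fun t ↦ γ t + (0, η) := by
  refine fun t ↦ ⟨?_, ?_⟩
  · have e : volterraField (γ t + (0, η)) = volterraField (γ t) := by simp [volterraField]
    rw [e]
    exact (h t).1.add_const _
  · have := (h t).2
    rw [mem_interiorDomain] at *
    simpa using this

/-- The integral curve given by the elliptic parametrisation. -/
noncomputable def ellipticCurve (L : PeriodPair) (c x : ℝ) (θ : Fin 2 → ℝ) (t : ℝ) : Coord :=
  (![orbit L c (x + t + L.ω₁.re / 3), orbit L c (x + t - L.ω₁.re / 3)], θ)

/-- A shift by a third of the period permutes the three translates cyclically, so the derivative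
formula for one of them yields the whole system. -/
lemma HasPeriods.isOrbitCurve_ellipticCurve {L : PeriodPair} {c : ℝ} (h : HasPeriods L c)
    (hc : 0 < c) (x : ℝ) (θ : Fin 2 → ℝ) : IsOrbitCurve (ellipticCurve L c x θ) := by
  intro t
  have hs := h.orbit_sum hc (x + t)
  have e1 : orbit L c (x + t + L.ω₁.re / 3 + L.ω₁.re / 3) = orbit L c (x + t - L.ω₁.re / 3) := by
    rw [← h.orbit_add_period (x + t - L.ω₁.re / 3)]
    congr 1
    ring
  have e2 : orbit L c (x + t - L.ω₁.re / 3 - L.ω₁.re / 3) = orbit L c (x + t + L.ω₁.re / 3) := by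
    rw [← h.orbit_add_period (x + t - L.ω₁.re / 3 - L.ω₁.re / 3)]
    congr 1
    ring
  have d1 := h.hasDerivAt_orbit hc (x + t + L.ω₁.re / 3)
  have d2 := h.hasDerivAt_orbit hc (x + t - L.ω₁.re / 3)
  rw [e1, add_sub_cancel_right] at d1
  rw [e2, sub_add_cancel] at d2
  have f1 : HasDerivAt (fun t ↦ x + t + L.ω₁.re / 3) 1 t :=
    ((hasDerivAt_id t).const_add x).add_const _
  have f2 : HasDerivAt (fun t ↦ x + t - L.ω₁.re / 3) 1 t :=
    ((hasDerivAt_id t).const_add x).sub_const _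
  have g1 := d1.comp t f1
  have g2 := d2.comp t f2
  refine ⟨HasDerivAt.prodMk (hasDerivAt_pi.mpr fun i ↦ ?_) (hasDerivAt_const t θ), ?_⟩
  · fin_cases i
    · refine g1.congr_deriv ?_
      simp [ellipticCurve]
      exact Or.inl (by linarith)
    · refine g2.congr_deriv ?_
      simp [ellipticCurve]
      exact Or.inl (by linarith)
  · rw [mem_interiorDomain]
    refine ⟨h.orbit_pos hc _, h.orbit_pos hc _, ?_⟩
    have := h.orbit_pos hc (x + t)
    simp only [ellipticCurve, Matrix.cons_val_zero, Matrix.cons_val_one]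
    linarith

lemma HasPeriods.exists_ellipticCurve_zero {L : PeriodPair} {p : Coord}
    (h : HasPeriods L (cThree p)) (hp : p ∈ interiorDomain) :
    ∃ x, ellipticCurve L (cThree p) x p.2 0 = p ∧ orbit L (cThree p) x = bary p 2 := by
  obtain ⟨x, h1, h2, h3⟩ := h.exists_orbit_eq (cThree_pos hp) (hp 0) (hp 1) (hp 2)
    (by simp [bary]) rfl
  refine ⟨x, Prod.ext ?_ rfl, h3⟩
  ext i
  fin_cases i <;> simp [ellipticCurve, h1, h2] <;> rfl

lemma cThree_le {p : Coord} (hp : p ∈ interiorDomain) : cThree p ≤ 1 / 27 := by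
  obtain ⟨h0, h1, h2⟩ := mem_interiorDomain.mp hp
  rw [cThree_eq]
  nlinarith [mul_nonneg h0.le (sq_nonneg (p.1 1 - (1 - p.1 0 - p.1 1))),
    mul_nonneg h1.le (sq_nonneg (p.1 0 - (1 - p.1 0 - p.1 1))),
    mul_nonneg h2.le (sq_nonneg (p.1 0 - p.1 1)), sq_nonneg (p.1 0 - p.1 1),
    sq_nonneg (p.1 1 - (1 - p.1 0 - p.1 1)), sq_nonneg (p.1 0 - (1 - p.1 0 - p.1 1))]

lemma eq_third_of_cThree_eq {p : Coord} (hp : p ∈ interiorDomain) (h : cThree p = 1 / 27) :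
    p.1 0 = 1 / 3 ∧ p.1 1 = 1 / 3 := by
  obtain ⟨h0, h1, h2⟩ := mem_interiorDomain.mp hp
  rw [cThree_eq] at h
  set a := p.1 0
  set b := p.1 1
  -- With `y³ = 1 - a - b` and `e₂` the sum of pairwise products, the three terms add up to `e₂ - 9
  -- c₃`, so `e₂ ≥ 1/3`; the sum of squared differences is `2 - 6 e₂ ≤ 0`.
  have m0 := mul_nonneg h0.le (sq_nonneg (b - (1 - a - b)))
  have m1 := mul_nonneg h1.le (sq_nonneg (a - (1 - a - b)))
  have m2 := mul_nonneg h2.le (sq_nonneg (a - b))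
  have key : (a - b) ^ 2 + (b - (1 - a - b)) ^ 2 + (a - (1 - a - b)) ^ 2 ≤ 0 := by nlinarith
  have k1 := sq_nonneg (a - b)
  have k2 := sq_nonneg (b - (1 - a - b))
  have k3 := sq_nonneg (a - (1 - a - b))
  have e2 : b - (1 - a - b) = 0 := pow_eq_zero_iff two_ne_zero |>.mp (by linarith)
  have e3 : a - (1 - a - b) = 0 := pow_eq_zero_iff two_ne_zero |>.mp (by linarith)
  constructor <;> linarith

lemma exists_isOrbitCurve {p : Coord} (hp : p ∈ interiorDomain) :
    ∃ γ, IsOrbitCurve γ ∧ γ 0 = p := by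
  rcases (cThree_le hp).lt_or_eq with h | h
  · obtain ⟨L, hL⟩ := exists_hasPeriods ⟨cThree_pos hp, h⟩
    obtain ⟨x, hx, -⟩ := hL.exists_ellipticCurve_zero hp
    exact ⟨_, hL.isOrbitCurve_ellipticCurve (cThree_pos hp) x p.2, hx⟩
  · obtain ⟨h0, h1⟩ := eq_third_of_cThree_eq hp h
    have e : volterraField p = 0 := by
      refine Prod.ext ?_ rfl
      ext i
      fin_cases i <;> simp [volterraField, h0, h1] <;> norm_num
    refine ⟨fun _ ↦ p, fun t ↦ ⟨?_, hp⟩, rfl⟩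
    rw [e]
    exact hasDerivAt_const t p

theorem exists_isHamiltonianFlow : ∃ φ, IsHamiltonianFlow φ := by
  choose! γ hγ using fun p (hp : p ∈ interiorDomain) ↦ exists_isOrbitCurve hp
  refine ⟨fun t p ↦ γ p t, fun p hp ↦ ⟨(hγ p hp).2, fun t ↦ ⟨((hγ p hp).1 t).2, ?_⟩⟩⟩
  rw [hamiltonianField_eq ((hγ p hp).1 t).2]
  exact ((hγ p hp).1 t).1

variable {φ : ℝ → Coord → Coord} {p : Coord}

lemma IsHamiltonianFlow.isOrbitCurve (hφ : IsHamiltonianFlow φ) (hp : p ∈ interiorDomain) :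
    IsOrbitCurve fun t ↦ φ t p := fun t ↦ by
  obtain ⟨h1, h2⟩ := (hφ p hp).2 t
  rw [hamiltonianField_eq h1] at h2
  exact ⟨h2, h1⟩

lemma IsHamiltonianFlow.eq_of_isOrbitCurve (hφ : IsHamiltonianFlow φ) (hp : p ∈ interiorDomain)
    {γ : ℝ → Coord} (hγ : IsOrbitCurve γ) (h0 : γ 0 = p) (t : ℝ) : φ t p = γ t :=
  congrFun ((hφ.isOrbitCurve hp).eq_of_zero hγ (((hφ p hp).1).trans h0.symm)) t

lemma IsHamiltonianFlow.mem (hφ : IsHamiltonianFlow φ) (hp : p ∈ interiorDomain) (t : ℝ) :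
    φ t p ∈ interiorDomain := ((hφ p hp).2 t).1

lemma IsHamiltonianFlow.flow_add (hφ : IsHamiltonianFlow φ) (hp : p ∈ interiorDomain) (s t : ℝ) :
    φ (s + t) p = φ s (φ t p) := by
  refine (hφ.eq_of_isOrbitCurve (hφ.mem hp t) ((hφ.isOrbitCurve hp).comp_add t) ?_ s).symm
  simp

lemma IsHamiltonianFlow.flow_snd (hφ : IsHamiltonianFlow φ) (hp : p ∈ interiorDomain) (t : ℝ) :
    (φ t p).2 = p.2 := by
  have h : ∀ s, HasDerivAt (fun s ↦ (φ s p).2) 0 s := fun s ↦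
    (ContinuousLinearMap.snd ℝ (Fin 2 → ℝ) (Fin 2 → ℝ)).hasFDerivAt.comp_hasDerivAt s
      ((hφ.isOrbitCurve hp) s).1
  have := is_const_of_deriv_eq_zero (fun s ↦ (h s).differentiableAt) (fun s ↦ (h s).deriv) t 0
  rwa [(hφ p hp).1] at this

lemma IsHamiltonianFlow.flow_add_snd (hφ : IsHamiltonianFlow φ) (hp : p ∈ interiorDomain)
    (η : Fin 2 → ℝ) (t : ℝ) : φ t (p + (0, η)) = φ t p + (0, η) := by
  refine hφ.eq_of_isOrbitCurve ?_ ((hφ.isOrbitCurve hp).add_snd η) ?_ t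
  · rw [mem_interiorDomain] at *
    simpa using hp
  · simp only [(hφ p hp).1]

/-- The determinant of the `y`-part of a linear map. -/
def areaFactor (Φ : Coord →L[ℝ] Coord) : ℝ :=
  (Φ (partialY 0)).1 0 * (Φ (partialY 1)).1 1 - (Φ (partialY 0)).1 1 * (Φ (partialY 1)).1 0

/-- Liouville's formula: the Lotka-Volterra field is divergence free in `y`. -/
lemma areaFactor_hasDerivWithinAt {Φ : ℝ → Coord →L[ℝ] Coord} {q : Coord} {s : Set ℝ} {t ε : ℝ}
    (h : HasDerivWithinAt Φ ((ε • volterraDeriv q) ∘L Φ t) s t) :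
    HasDerivWithinAt (fun t ↦ areaFactor (Φ t)) 0 s t := by
  have d : ∀ v : Coord, ∀ i, HasDerivWithinAt (fun t ↦ (Φ t v).1 i)
      (ε * (volterraDeriv q (Φ t v)).1 i) s t := fun v i ↦ by
    have h1 : HasDerivWithinAt (fun t ↦ Φ t v) (ε • volterraDeriv q (Φ t v)) s t := by
      simpa using h.clm_apply (hasDerivWithinAt_const t s v)
    exact (dY i).hasFDerivAt.comp_hasDerivWithinAt t h1
  have h2 := ((d (partialY 0) 0).mul (d (partialY 1) 1)).sub
    ((d (partialY 0) 1).mul (d (partialY 1) 0))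
  refine h2.congr_deriv ?_
  simp only [volterraDeriv_apply, Matrix.cons_val_zero, Matrix.cons_val_one]
  ring

lemma areaFactor_id : areaFactor (ContinuousLinearMap.id ℝ Coord) = 1 := by
  simp [areaFactor, partialY]

/-- The sign `ε` handles both time directions. The Lipschitz constant is `5`, so `2KT ≤ 1` means `T
≤ 1/10`; longer times follow by composing such steps. -/
lemma IsHamiltonianFlow.exists_hasFDerivAt_short (hφ : IsHamiltonianFlow φ)
    (hp : p ∈ interiorDomain) {ε : ℝ} (hε : |ε| = 1) {T : ℝ} (hT : T ∈ Icc (0 : ℝ) (1 / 10)) :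
    ∃ Φ : Coord →L[ℝ] Coord, HasFDerivAt (φ (ε * T)) Φ p ∧ areaFactor Φ = 1 := by
  obtain ⟨Φ, h0, h1, h2⟩ := exists_hasFDerivAt_flow (v := fun q ↦ ε • volterraField q)
    (v' := fun q ↦ ε • volterraDeriv q) isOpen_interiorDomain (K := 5) (C := 3) (by norm_num)
    (continuous_volterraDeriv.const_smul ε).continuousOn
    (fun q hq ↦ by
      rw [norm_smul, Real.norm_eq_abs, hε, one_mul]
      exact norm_volterraDeriv_le hq)
    (by norm_num)
    (LipschitzOnWith.of_dist_le_mul fun q hq r hr ↦ by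
      rw [dist_smul₀, Real.norm_eq_abs, hε, one_mul]
      exact lipschitzOnWith_volterraField.dist_le_mul q hq r hr)
    (fun q _ r _ ↦ by
      rw [smul_apply, ← smul_sub, ← smul_sub, norm_smul, Real.norm_eq_abs, hε,
        one_mul]
      exact norm_volterraField_sub_le q r)
    (ψ := fun t ↦ φ (ε * t)) (fun q hq ↦ by simp [(hφ q hq).1]) (fun q hq t ↦ hφ.mem hq _)
    (fun q hq t ↦ by
      have h := (hφ.isOrbitCurve hq (ε * t)).1
      have hm : HasDerivAt (fun t ↦ ε * t) ε t := by simpa using (hasDerivAt_id t).const_mul ε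
      exact h.scomp t hm)
    hT.1 (by norm_num; linarith [hT.2]) hp
  refine ⟨Φ T, h2 T ⟨hT.1, le_rfl⟩, ?_⟩
  have hd : ∀ t ∈ Icc 0 T, HasDerivWithinAt (fun t ↦ areaFactor (Φ t)) 0 (Icc 0 T) t :=
    fun t ht ↦ areaFactor_hasDerivWithinAt (h1 t ht)
  have := constant_of_has_deriv_right_zero (f := fun t ↦ areaFactor (Φ t)) (a := 0) (b := T)
    (fun t ht ↦ (hd t ht).continuousWithinAt)
    (fun t ht ↦ (hd t ⟨ht.1, ht.2.le⟩).mono_of_mem_nhdsWithin (Icc_mem_nhdsGE_of_mem ht)) T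
    ⟨hT.1, le_rfl⟩
  simp only [h0, areaFactor_id] at this
  exact this

lemma HasFDerivAt.flow_snd (hφ : IsHamiltonianFlow φ) (hp : p ∈ interiorDomain) {t : ℝ}
    {Φ : Coord →L[ℝ] Coord} (h : HasFDerivAt (φ t) Φ p) (v : Coord) : (Φ v).2 = v.2 := by
  have h1 := (ContinuousLinearMap.snd ℝ (Fin 2 → ℝ) (Fin 2 → ℝ)).hasFDerivAt.comp p h
  have h2 : HasFDerivAt ((ContinuousLinearMap.snd ℝ (Fin 2 → ℝ) (Fin 2 → ℝ)) ∘ φ t)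
      (ContinuousLinearMap.snd ℝ (Fin 2 → ℝ) (Fin 2 → ℝ)) p := by
    refine (ContinuousLinearMap.hasFDerivAt _).congr_of_eventuallyEq ?_
    filter_upwards [isOpen_interiorDomain.mem_nhds hp] with q hq
    exact hφ.flow_snd hq t
  exact congrArg (fun f : Coord →L[ℝ] (Fin 2 → ℝ) ↦ f v) (h1.unique h2)

/-- The flow commutes with translations of the angles. -/
lemma HasFDerivAt.flow_snd_direction (hφ : IsHamiltonianFlow φ) (hp : p ∈ interiorDomain) {t : ℝ}
    {Φ : Coord →L[ℝ] Coord} (h : HasFDerivAt (φ t) Φ p) (η : Fin 2 → ℝ) :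
    Φ (0, η) = (0, η) := by
  have hline : HasDerivAt (fun s : ℝ ↦ p + s • ((0, η) : Coord)) (0, η) 0 := by
    simpa using ((hasDerivAt_id (0 : ℝ)).smul_const ((0, η) : Coord)).const_add p
  have h' : HasFDerivAt (φ t) Φ (p + (0 : ℝ) • ((0, η) : Coord)) := by simpa using h
  have h1 := h'.comp_hasDerivAt (0 : ℝ) hline
  have h2 : HasDerivAt (fun s : ℝ ↦ φ t p + s • ((0, η) : Coord)) (0, η) 0 := by
    simpa using ((hasDerivAt_id (0 : ℝ)).smul_const ((0, η) : Coord)).const_add (φ t p)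
  refine h1.unique (h2.congr_of_eventuallyEq (Filter.Eventually.of_forall fun s ↦ ?_))
  have := hφ.flow_add_snd hp (s • η) t
  simpa using this

lemma IsHamiltonianFlow.exists_hasFDerivAt_add (hφ : IsHamiltonianFlow φ) {s t : ℝ}
    (hs : ∀ p ∈ interiorDomain, ∃ Φ, HasFDerivAt (φ s) Φ p ∧ areaFactor Φ = 1)
    (ht : ∀ p ∈ interiorDomain, ∃ Φ, HasFDerivAt (φ t) Φ p ∧ areaFactor Φ = 1) :
    ∀ p ∈ interiorDomain, ∃ Φ, HasFDerivAt (φ (s + t)) Φ p ∧ areaFactor Φ = 1 := by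
  intro p hp
  obtain ⟨Φ, h1, h2⟩ := ht p hp
  obtain ⟨Ψ, h3, h4⟩ := hs _ (hφ.mem hp t)
  refine ⟨Ψ ∘L Φ, (h3.comp p h1).congr_of_eventuallyEq ?_, ?_⟩
  · filter_upwards [isOpen_interiorDomain.mem_nhds hp] with q hq
    exact hφ.flow_add hq s t
  · have key : ∀ i, Φ (partialY i) =
        (Φ (partialY i)).1 0 • partialY 0 + (Φ (partialY i)).1 1 • partialY 1 := fun i ↦ by
      refine Prod.ext ?_ ?_
      · ext j
        fin_cases j <;> simp [partialY]
      · rw [HasFDerivAt.flow_snd hφ hp h1]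
        simp [partialY]
    have e : ∀ i j, ((Ψ ∘L Φ) (partialY i)).1 j = (Φ (partialY i)).1 0 * (Ψ (partialY 0)).1 j +
        (Φ (partialY i)).1 1 * (Ψ (partialY 1)).1 j := fun i j ↦ by
      refine (congrArg (fun v ↦ (Ψ v).1 j) (key i)).trans ?_
      simp only [map_add, map_smul]
      rfl
    rw [areaFactor] at h2 h4 ⊢
    simp only [e]
    linear_combination h4 + ((Ψ (partialY 0)).1 0 * (Ψ (partialY 1)).1 1 -
      (Ψ (partialY 0)).1 1 * (Ψ (partialY 1)).1 0) * h2

theorem IsHamiltonianFlow.exists_hasFDerivAt (hφ : IsHamiltonianFlow φ) (t : ℝ) :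
    ∀ p ∈ interiorDomain, ∃ Φ, HasFDerivAt (φ t) Φ p ∧ areaFactor Φ = 1 := by
  have hshort : ∀ t : ℝ, |t| ≤ 1 / 10 →
      ∀ p ∈ interiorDomain, ∃ Φ, HasFDerivAt (φ t) Φ p ∧ areaFactor Φ = 1 := by
    intro t ht p hp
    rcases le_total 0 t with h | h
    · rw [abs_of_nonneg h] at ht
      simpa using hφ.exists_hasFDerivAt_short hp (ε := 1) (by simp) ⟨h, ht⟩
    · rw [abs_of_nonpos h] at ht
      simpa using hφ.exists_hasFDerivAt_short hp (ε := -1) (by simp) ⟨neg_nonneg.mpr h, ht⟩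
  obtain ⟨n, hn⟩ := exists_nat_gt (10 * |t|)
  have hn0 : (0 : ℝ) < n := (by positivity : (0 : ℝ) ≤ 10 * |t|).trans_lt hn
  have hstep : |t / n| ≤ 1 / 10 := by
    rw [abs_div, Nat.abs_cast, div_le_iff₀ hn0]
    linarith
  have hmul : ∀ k : ℕ, ∀ p ∈ interiorDomain,
      ∃ Φ, HasFDerivAt (φ (k * (t / n))) Φ p ∧ areaFactor Φ = 1 := by
    intro k
    induction k with
    | zero => exact hshort _ (by simp)
    | succ k ih =>
      have := hφ.exists_hasFDerivAt_add ih (hshort _ hstep)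
      rwa [show (k : ℝ) * (t / n) + t / n = ((k + 1 : ℕ) : ℝ) * (t / n) by push_cast; ring] at this
  have := hmul n
  rwa [mul_div_cancel₀ _ hn0.ne'] at this

end ToricCP2

namespace ToricCP2

open Filter Topology

variable {φ : ℝ → Coord → Coord} {p : Coord}

/-! ### The differential of the flow and the deformed complex structure -/

/-- The linear map acting on the `y`-part by the matrix `(a b; c d)` and trivially on the
`θ`-part. -/
noncomputable def yMap (a b c d : ℝ) : Coord →L[ℝ] Coord :=
  (ContinuousLinearMap.pi ![a • dY 0 + b • dY 1, c • dY 0 + d • dY 1]).prod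
    (ContinuousLinearMap.snd ℝ (Fin 2 → ℝ) (Fin 2 → ℝ))

lemma yMap_apply (a b c d : ℝ) (v : Coord) :
    yMap a b c d v = (![a * v.1 0 + b * v.1 1, c * v.1 0 + d * v.1 1], v.2) := by
  refine Prod.ext ?_ rfl
  ext i
  fin_cases i <;> simp [yMap]

lemma yMap_comp_adjugate {a b c d : ℝ} (h : a * d - c * b = 1) (v : Coord) :
    yMap a b c d (yMap d (-b) (-c) a v) = v := by
  rw [yMap_apply, yMap_apply]
  refine Prod.ext ?_ rfl
  ext i
  fin_cases i
  · simp
    linear_combination v.1 0 * h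
  · simp
    linear_combination v.1 1 * h

/-- `yMap a b c d` as an equivalence, when the determinant is one. -/
noncomputable def yEquiv {a b c d : ℝ} (h : a * d - c * b = 1) : Coord ≃L[ℝ] Coord :=
  ContinuousLinearEquiv.equivOfInverse (yMap a b c d) (yMap d (-b) (-c) a)
    (fun v ↦ by
      have := yMap_comp_adjugate (a := d) (b := -b) (c := -c) (d := a) (by linarith) v
      rwa [neg_neg, neg_neg] at this)
    (yMap_comp_adjugate h)

lemma HasFDerivAt.flow_eq_yMap (hφ : IsHamiltonianFlow φ) (hp : p ∈ interiorDomain) {t : ℝ}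
    {Φ : Coord →L[ℝ] Coord} (h : HasFDerivAt (φ t) Φ p) :
    Φ = yMap ((Φ (partialY 0)).1 0) ((Φ (partialY 1)).1 0) ((Φ (partialY 0)).1 1)
      ((Φ (partialY 1)).1 1) := by
  refine ContinuousLinearMap.ext fun v ↦ ?_
  have hv : v = v.1 0 • partialY 0 + v.1 1 • partialY 1 + (0, v.2) := by
    refine Prod.ext ?_ ?_
    · ext j
      fin_cases j <;> simp [partialY]
    · simp [partialY]
  have e : Φ v = v.1 0 • Φ (partialY 0) + v.1 1 • Φ (partialY 1) + (0, v.2) := by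
    conv_lhs => rw [hv]
    rw [map_add, map_add, map_smul, map_smul, HasFDerivAt.flow_snd_direction hφ hp h]
  rw [yMap_apply]
  refine Prod.ext ?_ (HasFDerivAt.flow_snd hφ hp h v)
  rw [e]
  ext j
  fin_cases j <;> simp <;> ring

lemma IsHamiltonianFlow.exists_fderiv_eq (hφ : IsHamiltonianFlow φ) (hp : p ∈ interiorDomain)
    (t : ℝ) : ∃ a b c d : ℝ, a * d - c * b = 1 ∧ HasFDerivAt (φ t) (yMap a b c d) p := by
  obtain ⟨Φ, h1, h2⟩ := hφ.exists_hasFDerivAt t p hp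
  refine ⟨_, _, _, _, h2, ?_⟩
  rw [← HasFDerivAt.flow_eq_yMap hφ hp h1]
  exact h1

theorem IsHamiltonianFlow.differentiableAt (hφ : IsHamiltonianFlow φ) (hp : p ∈ interiorDomain)
    (t : ℝ) : DifferentiableAt ℝ (φ t) p := by
  obtain ⟨a, b, c, d, -, h⟩ := hφ.exists_fderiv_eq hp t
  exact h.differentiableAt

theorem IsHamiltonianFlow.isInvertible_fderiv (hφ : IsHamiltonianFlow φ)
    (hp : p ∈ interiorDomain) (t : ℝ) : (fderiv ℝ (φ t) p).IsInvertible := by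
  obtain ⟨a, b, c, d, hdet, h⟩ := hφ.exists_fderiv_eq hp t
  rw [h.fderiv]
  exact ⟨yEquiv hdet, rfl⟩

lemma Iplus_eq {t a b c d : ℝ} (hdet : a * d - c * b = 1)
    (h : HasFDerivAt (φ t) (yMap a b c d) p) (v : Coord) :
    Iplus φ t p v = yMap d (-b) (-c) a (Iminus (φ t p) (yMap a b c d v)) := by
  have hinv : (yMap a b c d).inverse = yMap d (-b) (-c) a :=
    ContinuousLinearMap.inverse_equiv (yEquiv hdet)
  rw [Iplus, h.fderiv, hinv]
  rfl

lemma IsHamiltonianFlow.cThree_flow (hφ : IsHamiltonianFlow φ) (hp : p ∈ interiorDomain) (t : ℝ) :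
    cThree (φ t p) = cThree p := by
  have h : ∀ s, HasDerivAt (fun s ↦ cThree (φ s p)) 0 s := fun s ↦ by
    have hs := (hφ.isOrbitCurve hp s).1
    have d : ∀ i, HasDerivAt (fun s ↦ (φ s p).1 i) ((volterraField (φ s p)).1 i) s := fun i ↦
      (dY i).hasFDerivAt.comp_hasDerivAt s hs
    simp only [cThree_eq]
    refine (((d 0).mul (d 1)).mul (((d 0).const_sub 1).sub (d 1))).congr_deriv ?_
    simp [volterraField]
    ring
  have := is_const_of_deriv_eq_zero (fun s ↦ (h s).differentiableAt) (fun s ↦ (h s).deriv) t 0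
  simpa only [(hφ p hp).1] using this

/-! ### The equation for `F` -/

lemma hitchinQ_injective (hp : p ∈ interiorDomain) {α β : Coord →L[ℝ] ℝ}
    (h : hitchinQ p α = hitchinQ p β) : α = β := by
  have hc := cThree_pos hp
  have e : ∀ α : Coord →L[ℝ] ℝ, hitchinQ p α =
      (![4 * cThree p * α (partialY 1), -(4 * cThree p * α (partialY 0))],
        ![-α (partialTheta 1), α (partialTheta 0)]) := fun α ↦ by
    refine Prod.ext ?_ ?_ <;> ext i <;> fin_cases i <;> simp [hitchinQ, partialY, partialTheta]
  rw [e, e, Prod.mk.injEq] at h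
  have y1 : α (partialY 1) = β (partialY 1) := by simpa [hc.ne'] using congrFun h.1 0
  have y0 : α (partialY 0) = β (partialY 0) := by simpa [hc.ne'] using congrFun h.1 1
  have t1 : α (partialTheta 1) = β (partialTheta 1) := by simpa using congrFun h.2 0
  have t0 : α (partialTheta 0) = β (partialTheta 0) := by simpa using congrFun h.2 1
  refine ContinuousLinearMap.ext fun v ↦ ?_
  have hv : v = v.1 0 • partialY 0 + v.1 1 • partialY 1 +
      (v.2 0 • partialTheta 0 + v.2 1 • partialTheta 1) := by
    refine Prod.ext ?_ ?_ <;> ext j <;> fin_cases j <;> simp [partialY, partialTheta]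
  rw [hv]
  simp only [map_add, map_smul, y0, y1, t0, t1]

/-- The 2-form `-(I₊^*dθ₁ - I₋^*dθ₁) ∧ dθ₂ + (I₊^*dθ₂ - I₋^*dθ₂) ∧ dθ₁`. -/
noncomputable def gksForm (φ : ℝ → Coord → Coord) (t : ℝ) (p : Coord) : Coord →L[ℝ] Coord →L[ℝ] ℝ :=
  -wedge (dTheta 0 ∘L Iplus φ t p - dTheta 0 ∘L Iminus p) (dTheta 1)
    + wedge (dTheta 1 ∘L Iplus φ t p - dTheta 1 ∘L Iminus p) (dTheta 0)

lemma wedge_apply (α β : Coord →L[ℝ] ℝ) (v w : Coord) :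
    wedge α β v w = α v * β w - β v * α w := by
  simp [wedge]

/-- Cramer's rule with `det G = 1 / (4 c₃)`. -/
lemma hessGInv_eq (hp : p ∈ interiorDomain) : hessGInv p =
    (4 * cThree p) • !![hessG p 1 1, -hessG p 0 1; -hessG p 1 0, hessG p 0 0] := by
  obtain ⟨h0, h1, h2⟩ := mem_interiorDomain.mp hp
  ext i j
  fin_cases i <;> fin_cases j <;> simp [hessGInv, hessG, bary, cThree] <;> field_simp <;> ring

/-- If `A` is the `y`-block of the differential and `G'` the Hessian at the image point, the blocks
of `I₊` are `M = G'A` and `-4 c₃ A⁻¹ adj G'`. Since `det A = 1` and `c₃` is conserved, the second is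
`-4 c₃ adj M`. Hence the `θ`-components of the difference determine the `y`-components, in the way
prescribed by `Q`. -/
lemma IsHamiltonianFlow.Iplus_sub_Iminus (hφ : IsHamiltonianFlow φ) (hp : p ∈ interiorDomain)
    (t : ℝ) (v : Coord) :
    Iplus φ t p v - Iminus p v = -hitchinQ p ((gksForm φ t p).flip v) := by
  obtain ⟨a, b, c, d, hdet, h⟩ := hφ.exists_fderiv_eq hp t
  have g := hessGInv_eq hp
  have g' := hessGInv_eq (hφ.mem hp t)
  rw [hφ.cThree_flow hp] at g'
  have hI : ∀ v, Iplus φ t p v = _ := Iplus_eq hdet h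
  refine Prod.ext ?_ ?_ <;> ext i <;> fin_cases i
  all_goals
    simp only [Fin.zero_eta, Fin.mk_one, gksForm, hitchinQ, hI, yMap_apply, Prod.fst_sub,
      Prod.snd_sub, Pi.sub_apply, Prod.fst_neg, Prod.snd_neg, Pi.neg_apply, Iminus_fst, Iminus_snd,
      ContinuousLinearMap.flip_apply, add_apply, neg_apply, sub_apply, wedge_apply,
      ContinuousLinearMap.comp_apply, dTheta_apply, partialY, partialTheta, g, g']
    simp
    try ring

theorem IsHamiltonianFlow.solvesGKS_iff (hφ : IsHamiltonianFlow φ) (t : ℝ)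
    (F : Coord → Coord →L[ℝ] Coord →L[ℝ] ℝ) :
    SolvesGKS φ t F ↔ ∀ p ∈ interiorDomain, F p = gksForm φ t p := by
  refine ⟨fun h p hp ↦ ?_, fun h p hp v ↦ ?_⟩
  · refine ContinuousLinearMap.ext fun w ↦ ContinuousLinearMap.ext fun v ↦ ?_
    have h1 := (h p hp v).symm.trans (hφ.Iplus_sub_Iminus hp t v)
    exact congrArg (fun f : Coord →L[ℝ] ℝ ↦ f w) (hitchinQ_injective hp (neg_injective h1))
  · rw [h p hp]
    exact hφ.Iplus_sub_Iminus hp t v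

/-! ### The integrals `Yⁱ` -/

/-- The logarithmic coordinates `½ log (yⁱ / y³)`. -/
noncomputable def logCoord (i : Fin 2) (p : Coord) : ℝ :=
  1 / 2 * (Real.log (p.1 i) - Real.log (1 - p.1 0 - p.1 1))

/-- Up to a constant `½ log(yⁱ/y³)` is `∂G/∂yⁱ` for the symplectic potential `G`, so its
differential is `G_{ij} dyʲ = dθ_i ∘ I₋`. -/
lemma hasFDerivAt_logCoord (i : Fin 2) (hp : p ∈ interiorDomain) :
    HasFDerivAt (logCoord i) (dTheta i ∘L Iminus p) p := by
  obtain ⟨h0, h1, h2⟩ := mem_interiorDomain.mp hp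
  have hi : p.1 i ≠ 0 := by fin_cases i <;> simp [h0.ne', h1.ne']
  have h := (((hasFDerivAt_fst_apply i p).log hi).sub
    ((hasFDerivAt_bary_two p).log h2.ne')).const_mul (1 / 2)
  refine h.congr_fderiv (ContinuousLinearMap.ext fun v ↦ ?_)
  rw [ContinuousLinearMap.comp_apply, dTheta_apply, Iminus_snd]
  fin_cases i <;> simp [hessG, bary] <;> field_simp <;> ring

/-- The flow preserves `dθ_i`, so `dθ_i ∘ I₊` is the pullback of `dθ_i ∘ I₋`. -/
lemma IsHamiltonianFlow.hasFDerivAt_logCoord_comp (hφ : IsHamiltonianFlow φ)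
    (hp : p ∈ interiorDomain) (t : ℝ) (i : Fin 2) :
    HasFDerivAt (fun q ↦ logCoord i (φ t q)) (dTheta i ∘L Iplus φ t p) p := by
  obtain ⟨a, b, c, d, hdet, h⟩ := hφ.exists_fderiv_eq hp t
  refine ((hasFDerivAt_logCoord i (hφ.mem hp t)).comp p h).congr_fderiv
    (ContinuousLinearMap.ext fun v ↦ ?_)
  simp only [ContinuousLinearMap.comp_apply, dTheta_apply, Iplus_eq hdet h, yMap_apply]

lemma IsHamiltonianFlow.hasDerivAt_fst (hφ : IsHamiltonianFlow φ) (hp : p ∈ interiorDomain)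
    (i : Fin 2) (t : ℝ) :
    HasDerivAt (fun s ↦ (φ s p).1 i) ((volterraField (φ t p)).1 i) t :=
  (dY i).hasFDerivAt.comp_hasDerivAt t (hφ.isOrbitCurve hp t).1

lemma IsHamiltonianFlow.continuous_fst (hφ : IsHamiltonianFlow φ) (hp : p ∈ interiorDomain)
    (i : Fin 2) : Continuous fun s ↦ (φ s p).1 i :=
  continuous_iff_continuousAt.mpr fun t ↦ (hφ.hasDerivAt_fst hp i t).continuousAt

/-- Each `yᵏ` has logarithmic derivative the difference of the other two, and the `yᵏ` sum to one.
The indices cross: the first logarithm sees only `y²`, the second only `y¹`, which is the source of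
the pairing in `F`. -/
lemma IsHamiltonianFlow.hasDerivAt_logCoord (hφ : IsHamiltonianFlow φ) (hp : p ∈ interiorDomain)
    (i : Fin 2) (t : ℝ) :
    HasDerivAt (fun s ↦ logCoord i (φ s p))
      (1 / 2 * (![3 * (φ t p).1 1 - 1, 1 - 3 * (φ t p).1 0] i)) t := by
  obtain ⟨h0, h1, h2⟩ := mem_interiorDomain.mp (hφ.mem hp t)
  have d0 := hφ.hasDerivAt_fst hp 0 t
  have d1 := hφ.hasDerivAt_fst hp 1 t
  have hi : (φ t p).1 i ≠ 0 := by fin_cases i <;> simp [h0.ne', h1.ne']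
  have h := (((hφ.hasDerivAt_fst hp i t).log hi).sub
    (((d0.const_sub 1).sub d1).log h2.ne')).const_mul (1 / 2)
  refine h.congr_deriv ?_
  fin_cases i <;> simp [volterraField] <;> field_simp <;> ring

lemma IsHamiltonianFlow.integral_logCoord (hφ : IsHamiltonianFlow φ) (hp : p ∈ interiorDomain)
    (i : Fin 2) (t : ℝ) :
    ∫ s in (0 : ℝ)..t, (1 / 2 * (![3 * (φ s p).1 1 - 1, 1 - 3 * (φ s p).1 0] i)) =
      logCoord i (φ t p) - logCoord i p := by
  have c : Continuous fun s ↦ 1 / 2 * (![3 * (φ s p).1 1 - 1, 1 - 3 * (φ s p).1 0] i) := by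
    refine continuous_const.mul ?_
    match i with
    | 0 => exact (continuous_const.mul (hφ.continuous_fst hp 1)).sub continuous_const
    | 1 => exact continuous_const.sub (continuous_const.mul (hφ.continuous_fst hp 0))
  have h := intervalIntegral.integral_eq_sub_of_hasDerivAt (a := 0) (b := t)
    (fun s _ ↦ hφ.hasDerivAt_logCoord hp i s) (c.intervalIntegrable _ _)
  rwa [(hφ p hp).1] at h

lemma IsHamiltonianFlow.integratedY_one (hφ : IsHamiltonianFlow φ) (hp : p ∈ interiorDomain)
    (t : ℝ) : integratedY φ t 1 p = 2 / 3 * (logCoord 0 (φ t p) - logCoord 0 p) + t / 3 := by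
  have h := hφ.integral_logCoord hp 0 t
  have hi := (hφ.continuous_fst hp 1).intervalIntegrable (μ := MeasureTheory.volume) 0 t
  simp only [Matrix.cons_val_zero] at h
  rw [intervalIntegral.integral_const_mul, intervalIntegral.integral_sub (hi.const_mul 3)
    intervalIntegrable_const, intervalIntegral.integral_const_mul,
    intervalIntegral.integral_const] at h
  rw [integratedY, ← h]
  simp
  ring

lemma IsHamiltonianFlow.integratedY_zero (hφ : IsHamiltonianFlow φ) (hp : p ∈ interiorDomain)
    (t : ℝ) : integratedY φ t 0 p = -(2 / 3) * (logCoord 1 (φ t p) - logCoord 1 p) + t / 3 := by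
  have h := hφ.integral_logCoord hp 1 t
  have hi := (hφ.continuous_fst hp 0).intervalIntegrable (μ := MeasureTheory.volume) 0 t
  simp only [Matrix.cons_val_one, Matrix.cons_val_zero] at h
  rw [intervalIntegral.integral_const_mul, intervalIntegral.integral_sub
    intervalIntegrable_const (hi.const_mul 3), intervalIntegral.integral_const_mul,
    intervalIntegral.integral_const] at h
  rw [integratedY, ← h]
  simp
  ring

lemma IsHamiltonianFlow.hasFDerivAt_integratedY_one (hφ : IsHamiltonianFlow φ)
    (hp : p ∈ interiorDomain) (t : ℝ) : HasFDerivAt (integratedY φ t 1)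
      ((2 / 3 : ℝ) • (dTheta 0 ∘L Iplus φ t p - dTheta 0 ∘L Iminus p)) p := by
  refine ((((hφ.hasFDerivAt_logCoord_comp hp t 0).sub (hasFDerivAt_logCoord 0 hp)).const_mul
    (2 / 3)).add_const (t / 3)).congr_of_eventuallyEq ?_
  filter_upwards [isOpen_interiorDomain.mem_nhds hp] with q hq
  exact hφ.integratedY_one hq t

lemma IsHamiltonianFlow.hasFDerivAt_integratedY_zero (hφ : IsHamiltonianFlow φ)
    (hp : p ∈ interiorDomain) (t : ℝ) : HasFDerivAt (integratedY φ t 0)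
      (-(2 / 3 : ℝ) • (dTheta 1 ∘L Iplus φ t p - dTheta 1 ∘L Iminus p)) p := by
  refine ((((hφ.hasFDerivAt_logCoord_comp hp t 1).sub (hasFDerivAt_logCoord 1 hp)).const_mul
    (-(2 / 3))).add_const (t / 3)).congr_of_eventuallyEq ?_
  filter_upwards [isOpen_interiorDomain.mem_nhds hp] with q hq
  exact hφ.integratedY_zero hq t

theorem IsHamiltonianFlow.differentiableAt_integratedY (hφ : IsHamiltonianFlow φ)
    (hp : p ∈ interiorDomain) (t : ℝ) (i : Fin 2) :
    DifferentiableAt ℝ (integratedY φ t i) p := by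
  fin_cases i
  · exact (hφ.hasFDerivAt_integratedY_zero hp t).differentiableAt
  · exact (hφ.hasFDerivAt_integratedY_one hp t).differentiableAt

theorem IsHamiltonianFlow.gksForm_eq (hφ : IsHamiltonianFlow φ) (hp : p ∈ interiorDomain)
    (t : ℝ) : gksForm φ t p =
      -(3 / 2 : ℝ) • ∑ i : Fin 2, wedge (fderiv ℝ (integratedY φ t i) p) (dTheta i) := by
  rw [Fin.sum_univ_two, (hφ.hasFDerivAt_integratedY_zero hp t).fderiv,
    (hφ.hasFDerivAt_integratedY_one hp t).fderiv]
  refine ContinuousLinearMap.ext fun v ↦ ContinuousLinearMap.ext fun w ↦ ?_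
  simp only [gksForm, add_apply, neg_apply, smul_apply, sub_apply, wedge_apply, smul_eq_mul]
  ring

end ToricCP2

namespace ToricCP2

open Filter Topology

/-! ### The integrals through the sigma function -/

/-- A solution of `E' = (y - k) E` with `E(0) = 1` has the real logarithm `∫ y - k t`. -/
lemma log_eq_integral_sub {E : ℝ → ℂ} {y : ℝ → ℝ} {k : ℝ} (hy : Continuous y)
    (hE : ∀ τ, HasDerivAt E ((y τ - k) * E τ) τ) (h0 : E 0 = 1) (t : ℝ) :
    Complex.log (E t) = ((∫ τ in (0 : ℝ)..t, y τ : ℝ) : ℂ) - t * k := by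
  set Y : ℝ → ℝ := fun t ↦ (∫ τ in (0 : ℝ)..t, y τ) - t * k with hY
  have hYd : ∀ τ, HasDerivAt Y (y τ - k) τ := fun τ ↦
    (hy.integral_hasStrictDerivAt 0 τ).hasDerivAt.sub
      (by simpa using (hasDerivAt_id τ).mul_const k)
  -- This product is constant, so `E` is the exponential of the real function `Y` and the principal
  -- logarithm recovers `Y` without branch ambiguity.
  have hd : ∀ τ, HasDerivAt (fun τ ↦ E τ * Complex.exp (-(Y τ : ℂ))) 0 τ := fun τ ↦ by
    refine ((hE τ).mul (hYd τ).ofReal_comp.neg.cexp).congr_deriv ?_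
    push_cast
    ring
  have hconst := is_const_of_deriv_eq_zero (fun τ ↦ (hd τ).differentiableAt)
    (fun τ ↦ (hd τ).deriv) t 0
  have hY0 : Y 0 = 0 := by simp [hY]
  simp only [h0, hY0, Complex.ofReal_zero, neg_zero, Complex.exp_zero, mul_one] at hconst
  rw [Complex.exp_neg, mul_inv_eq_one₀ (Complex.exp_ne_zero _)] at hconst
  rw [hconst, ← Complex.ofReal_exp, ← Complex.ofReal_log (Real.exp_pos _).le, Real.log_exp, hY]
  push_cast
  ring

lemma hasDerivAt_sigma_ratio (L : PeriodPair) {u v C D : ℂ} {τ : ℝ} (hu : u + τ ∉ L.lattice)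
    (hv : v + τ ∉ L.lattice) :
    HasDerivAt (fun τ : ℝ ↦ L.weierstrassSigma (u + τ) * C / (L.weierstrassSigma (v + τ) * D))
      ((L.weierstrassZeta (u + τ) - L.weierstrassZeta (v + τ)) *
        (L.weierstrassSigma (u + τ) * C / (L.weierstrassSigma (v + τ) * D))) τ := by
  have hline : ∀ w : ℂ, HasDerivAt (fun τ : ℝ ↦ w + (τ : ℂ)) 1 τ := fun w ↦
    Complex.ofRealCLM.hasDerivAt.const_add w
  have h1 := (L.hasDerivAt_weierstrassSigma hu).comp τ (hline u)
  have h2 := (L.hasDerivAt_weierstrassSigma hv).comp τ (hline v)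
  have hne := L.weierstrassSigma_ne_zero hv
  have h3 := ((h1.div h2 hne).mul_const (C / D))
  refine (h3.congr_deriv ?_).congr_of_eventuallyEq (Eventually.of_forall fun τ ↦ ?_)
  · simp only [Function.comp_def]
    rw [mul_div_mul_comm]
    field_simp
  · exact mul_div_mul_comm _ _ _ _

variable {φ : ℝ → Coord → Coord} {p : Coord} {L : PeriodPair}

lemma HasPeriods.exists_hasAngle (h : HasPeriods L (cThree p)) (hp : p ∈ interiorDomain) :
    ∃ s, HasAngle L p s := by
  obtain ⟨x, h1, h2, h3⟩ := h.exists_orbit_eq (cThree_pos hp) (hp 0) (hp 1) (hp 2)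
    (by simp [bary]) rfl
  have ha := h.isRectangular.ω₁_re_pos.ne'
  have hpi := Real.pi_ne_zero
  refine ⟨x / (L.ω₁.re / 2 / Real.pi), (hasAngle_iff h (x := x) ?_).mpr
    ⟨h1.symm, h2.symm, h3.symm⟩⟩
  rw [ellipticTime_eq_midline h]
  congr 1
  field_simp

/-- Along the orbit `yⁱ - k` is a difference of two zeta values, that is, the logarithmic derivative
of a quotient of sigma functions normalised to be `1` at time zero; `log_eq_integral_sub` then
applies. -/
theorem IsHamiltonianFlow.integratedY_eq_log (hφ : IsHamiltonianFlow φ) (hp : p ∈ interiorDomain)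
    (h : HasPeriods L (cThree p)) {s : ℝ} (hs : HasAngle L p s) (t : ℝ) :
    (integratedY φ t 0 p : ℂ) =
      Complex.log
        ((L.weierstrassSigma (ellipticTime L s + t)
            * L.weierstrassSigma (ellipticTime L s - thirdPeriod L))
          / (L.weierstrassSigma (ellipticTime L s + t - thirdPeriod L)
            * L.weierstrassSigma (ellipticTime L s)))
        + t * (1 / 2 - L.weierstrassZeta (thirdPeriod L)) ∧
    (integratedY φ t 1 p : ℂ) =
      Complex.log
        ((L.weierstrassSigma (ellipticTime L s + t + thirdPeriod L)
            * L.weierstrassSigma (ellipticTime L s))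
          / (L.weierstrassSigma (ellipticTime L s + t)
            * L.weierstrassSigma (ellipticTime L s + thirdPeriod L)))
        + t * (1 / 2 - L.weierstrassZeta (thirdPeriod L)) := by
  have hc := cThree_pos hp
  have hu := ellipticTime_eq_midline h s
  set x := L.ω₁.re / 2 / Real.pi * s
  obtain ⟨h1, h2, -⟩ := (hasAngle_iff h hu).mp hs
  have hcurve : ∀ τ, φ τ p = ellipticCurve L (cThree p) x p.2 τ := by
    refine hφ.eq_of_isOrbitCurve hp (h.isOrbitCurve_ellipticCurve hc x p.2) (Prod.ext ?_ rfl)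
    ext i
    fin_cases i
    · simpa [ellipticCurve, bary] using h1.symm
    · simpa [ellipticCurve, bary] using h2.symm
  set f := thirdPeriod L with hf
  have hfr : ((L.ω₁.re / 3 : ℝ) : ℂ) = f := ofReal_third h
  -- The third of the period is real and `ζ` is real on the real axis, so the constant `1/2 - ζ(f)`
  -- is real.
  set k : ℝ := 1 / 2 - (L.weierstrassZeta f).re with hk
  have hk' : (k : ℂ) = 1 / 2 - L.weierstrassZeta f := by
    rw [hk, Complex.ofReal_sub, ← hfr, h.isRectangular.ofReal_weierstrassZeta]
    norm_num
  rw [hu, ← hk']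
  set u := L.midline x
  have hmem : ∀ τ : ℝ, u + τ ∉ L.lattice := fun τ ↦ by
    rw [← midline_add]
    exact h.isRectangular.midline_notMem _
  have hmem_sub : ∀ τ : ℝ, u - f + τ ∉ L.lattice := fun τ ↦ by
    have := hmem (τ - L.ω₁.re / 3)
    rwa [Complex.ofReal_sub, hfr, show u + (τ - f) = u - f + τ by ring] at this
  have hmem_add : ∀ τ : ℝ, u + f + τ ∉ L.lattice := fun τ ↦ by
    have := hmem (τ + L.ω₁.re / 3)
    rwa [Complex.ofReal_add, hfr, show u + (τ + f) = u + f + τ by ring] at this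
  have n0 := L.weierstrassSigma_ne_zero (by simpa using hmem 0)
  have n1 := L.weierstrassSigma_ne_zero (by simpa using hmem_sub 0)
  have n2 := L.weierstrassSigma_ne_zero (by simpa using hmem_add 0)
  have y0 : ∀ τ, (((φ τ p).1 0 : ℝ) : ℂ) - k =
      L.weierstrassZeta (u + τ) - L.weierstrassZeta (u - f + τ) := fun τ ↦ by
    have := h.orbit_add_third_eq_zeta hc (x + τ)
    rw [midline_add, ← hk'] at this
    have e : (φ τ p).1 0 = orbit L (cThree p) (x + τ + L.ω₁.re / 3) := by rw [hcurve]; rfl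
    rw [e, show u - f + τ = u + τ - f by ring]
    linear_combination this
  have y1 : ∀ τ, (((φ τ p).1 1 : ℝ) : ℂ) - k =
      L.weierstrassZeta (u + f + τ) - L.weierstrassZeta (u + τ) := fun τ ↦ by
    have := h.orbit_sub_third_eq_zeta hc (x + τ)
    rw [midline_add, ← hk'] at this
    have e : (φ τ p).1 1 = orbit L (cThree p) (x + τ - L.ω₁.re / 3) := by rw [hcurve]; rfl
    rw [e, show u + f + τ = u + τ + f by ring]
    linear_combination this
  constructor
  · have := log_eq_integral_sub (hφ.continuous_fst hp 0) (k := k)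
      (fun τ ↦ by
        rw [y0]
        exact hasDerivAt_sigma_ratio L (C := L.weierstrassSigma (u - f))
          (D := L.weierstrassSigma u) (hmem τ) (hmem_sub τ))
      (by
        simp only [Complex.ofReal_zero, add_zero]
        field_simp) t
    rw [show u + t - f = u - f + t by ring, this, integratedY]
    ring
  · have := log_eq_integral_sub (hφ.continuous_fst hp 1) (k := k)
      (fun τ ↦ by
        rw [y1]
        exact hasDerivAt_sigma_ratio L (C := L.weierstrassSigma u)
          (D := L.weierstrassSigma (u + f)) (hmem_add τ) (hmem τ))
      (by
        simp only [Complex.ofReal_zero, add_zero]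
        field_simp) t
    rw [show u + t + f = u + f + t by ring, this, integratedY]
    ring

end ToricCP2
theorem mainTheorem7 :
    -- the flow exists, and so do the half periods for every value of `c₃` off the centre
    (∃ φ, ToricCP2.IsHamiltonianFlow φ) ∧
    (∀ c ∈ Set.Ioo (0 : ℝ) (1 / 27), ∃ L : PeriodPair, ToricCP2.HasPeriods L c) ∧
    ∀ φ, ToricCP2.IsHamiltonianFlow φ → ∀ Δt : ℝ,
      -- `φ_Δt` is differentiable with invertible differential, so that `I₊` is meaningful
      (∀ p ∈ ToricCP2.interiorDomain, DifferentiableAt ℝ (φ Δt) p ∧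
        (fderiv ℝ (φ Δt) p).IsInvertible) ∧
      -- `F` is the unique solution of `I₊ - I₋ = -QF`
      (∀ F, ToricCP2.IsTwoForm F →
        (ToricCP2.SolvesGKS φ Δt F ↔ ∀ p ∈ ToricCP2.interiorDomain,
          F p =
            -ToricCP2.wedge
              (ToricCP2.dTheta 0 ∘L ToricCP2.Iplus φ Δt p
                - ToricCP2.dTheta 0 ∘L ToricCP2.Iminus p)
              (ToricCP2.dTheta 1)
            + ToricCP2.wedge
              (ToricCP2.dTheta 1 ∘L ToricCP2.Iplus φ Δt p
                - ToricCP2.dTheta 1 ∘L ToricCP2.Iminus p)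
              (ToricCP2.dTheta 0))) ∧
      -- `F = -(3/2) ∑ dYⁱ ∧ dθ_i`
      (∀ p ∈ ToricCP2.interiorDomain,
        ∀ i, DifferentiableAt ℝ (ToricCP2.integratedY φ Δt i) p) ∧
      (∀ F, ToricCP2.IsTwoForm F → ToricCP2.SolvesGKS φ Δt F → ∀ p ∈ ToricCP2.interiorDomain,
        F p = -(3 / 2 : ℝ) • ∑ i : Fin 2,
          ToricCP2.wedge (fderiv ℝ (ToricCP2.integratedY φ Δt i) p) (ToricCP2.dTheta i)) ∧
      -- `Y¹, Y²` through logarithms of the sigma function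
      (∀ p ∈ ToricCP2.interiorDomain, ∀ L : PeriodPair,
        ToricCP2.HasPeriods L (ToricCP2.cThree p) →
        (∃ s, ToricCP2.HasAngle L p s) ∧
        ∀ s, ToricCP2.HasAngle L p s →
          (ToricCP2.integratedY φ Δt 0 p : ℂ) =
            Complex.log
              ((L.weierstrassSigma (ToricCP2.ellipticTime L s + Δt)
                  * L.weierstrassSigma (ToricCP2.ellipticTime L s - ToricCP2.thirdPeriod L))
                / (L.weierstrassSigma
                    (ToricCP2.ellipticTime L s + Δt - ToricCP2.thirdPeriod L)
                  * L.weierstrassSigma (ToricCP2.ellipticTime L s)))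
              + Δt * (1 / 2 - L.weierstrassZeta (ToricCP2.thirdPeriod L)) ∧
          (ToricCP2.integratedY φ Δt 1 p : ℂ) =
            Complex.log
              ((L.weierstrassSigma
                    (ToricCP2.ellipticTime L s + Δt + ToricCP2.thirdPeriod L)
                  * L.weierstrassSigma (ToricCP2.ellipticTime L s))
                / (L.weierstrassSigma (ToricCP2.ellipticTime L s + Δt)
                  * L.weierstrassSigma (ToricCP2.ellipticTime L s + ToricCP2.thirdPeriod L)))
              + Δt * (1 / 2 - L.weierstrassZeta (ToricCP2.thirdPeriod L))) := by
  refine ⟨ToricCP2.exists_isHamiltonianFlow, fun c hc ↦ ToricCP2.exists_hasPeriods hc,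
    fun φ hφ t ↦ ⟨fun p hp ↦ ⟨hφ.differentiableAt hp t, hφ.isInvertible_fderiv hp t⟩,
      fun F _ ↦ hφ.solvesGKS_iff t F, fun p hp i ↦ hφ.differentiableAt_integratedY hp t i,
      fun F _ hF p hp ↦ ?_, fun p hp L h ↦
        ⟨h.exists_hasAngle hp, fun s hs ↦ hφ.integratedY_eq_log hp h hs t⟩⟩⟩
  rw [(hφ.solvesGKS_iff t F).mp hF p hp, hφ.gksForm_eq hp t]
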